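/- Let $n\ge 2$, let $F_q$ be a finite field of characteristic $p$ with $q$ elements, and let $G=\mathrm{GL}_n(q)$. Let $\ell\neq p$ be a prime and let $R$ be a local principal ideal domain of characteristic $0$ with maximal ideal $\ell R$ that contains a primitive $p$-th root of unity; put $K=R/\ell R$. Let $B$ and $U$ be the groups of upper triangular and of upper unitriangular matrices in $G$, identify $S_n$ with the group of permutation matrices, put $\underline{e}=\sum_{\sigma\in S_n}\mathrm{sg}(\sigma)\,\sigma\sum_{b\in B}b\in RG$, and let $I=RG\,\underline{e}$ be the Steinberg lattice. Let $f:I\times I\to R$ be the restriction to $I$ of the bilinear form $(g,h)\mapsto\delta_{g,h}$ on $RG$, divided by $|B|$. For $c\ge 0$ put $$I(c)=\{x\in I: f(x,I)\subseteq \ell^cR\},\qquad L=I/\ell I,\qquad L(c)=(I(c)+\ell I)/\ell I,\qquad M(c)=L(c)/L(c+1),$$ where $L$, $L(c)$ and $M(c)$ are $KG$-modules. A standard parabolic subgroup of $G$ is a subgroup containing $B$. For a composition $(a_1,\dots,a_k)$ of $n$ let $P_{(a_1,\dots,a_k)}$ be the block upper triangular subgroup with diagonal blocks of sizes $a_1,\dots,a_k$.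 An integer $c\ge0$ is a $\mathcal P$-value if $\nu_\ell([G:P])=c$ for some standard parabolic subgroup $P$. Let $e=\min\{i\ge2:\ \ell \text{ divides } (q^i-1)/(q-1)\}$, let $\mathcal P^*$ be the set of all $P_{(a_1,\dots,a_k)}$ with $a_1\le\dots\le a_k$ in which every $a_j$ is $1$ or of the form $e\ell^i$ with $i\ge 0$, and let $\mathcal P^*(c)=\{P\in\mathcal P^*:\nu_\ell([G:P])=c\}$. For a group homomorphism $\lambda:U\to R^\times$ put $F_\lambda=\sum_{u\in U}\lambda(u)u\underline{e}+\ell I\in L$, and let $P(\lambda)$ be the subgroup generated by $B$ and by those transpositions $(i,i+1)$ for which $\lambda$ is non-trivial on the root subgroup $X_{i,i+1}=\{1+aE^{i,i+1}:a\in F_q\}$. For a standard parabolic subgroup $P$ with $c=\nu_\ell([G:P])$ put $L'(P)=KG\cdot F_\lambda$ and $$N(P)=(L'(P)+L(c+1))/L(c+1)\subseteq M(c),$$ where $\lambda$ is any homomorphism with $P(\lambda)=P$. Then the following hold. 0. The submodules $L'(P)$ and $N(P)$ are well defined: for every standard parabolic subgroup $P$ there is a $\lambda$ with $P(\lambda)=P$,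 the submodule $KG\cdot F_\lambda$ is the same for all such $\lambda$, and it is contained in $L(\nu_\ell([G:P]))$. 1. If $c$ is a $\mathcal P$-value, then $M(c)$ is the direct sum of the distinct submodules among the $N(P)$, $P\in\mathcal P^*(c)$; each $N(P)$ is an irreducible $KG$-module, and distinct $N(P)$, $N(Q)$ with $P,Q\in\mathcal P^*(c)$ are non-isomorphic. 2. For every $c\ge 0$, $M(c)$ is irreducible if and only if $c$ is a $\mathcal P$-value and $N(P)=N(Q)$ for all $P,Q\in\mathcal P^*(c)$. In particular, $M(c)$ is irreducible if $|\mathcal P^*(c)|=1$; and if $|\mathcal P^*(c)|=1$ for every $\mathcal P$-value $c$, then the series $L=L(0)\supseteq L(1)\supseteq L(2)\supseteq\cdots$ is, after deletion of repeated terms, a composition series of $L$. -/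

import Mathlib

open scoped MonoidAlgebra

noncomputable section

namespace SteinbergGL

/-! ### The general linear group, its Borel subgroup and its standard parabolic subgroups -/

section Groups

variable (F : Type*) [Field F] (n : ℕ)

/-- The general linear group `GL_n(F)`. -/
abbrev GLn := Matrix.GeneralLinearGroup (Fin n) F

variable {n} in
/-- The group of invertible block upper triangular matrices, the index `i` lying in the block
numbered `blk i`. -/
def blockUpper {α : Type*} [LinearOrder α] (blk : Fin n → α) : Subgroup (GLn F n) where
  carrier := {g | (g : Matrix (Fin n) (Fin n) F).BlockTriangular blk}
  mul_mem' {a b} ha hb := by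
    simpa using Matrix.BlockTriangular.mul ha hb
  one_mem' := by
    simpa using Matrix.blockTriangular_one
  inv_mem' {a} ha := by
    have := Matrix.blockTriangular_inv_of_blockTriangular (M := a.val) ha
    simpa [Matrix.coe_units_inv] using this

/-- The Borel subgroup `B` of upper triangular matrices. -/
def borel : Subgroup (GLn F n) := blockUpper F (id : Fin n → Fin n)

/-- The subgroup `U` of upper unitriangular matrices. -/
def unitri : Subgroup (GLn F n) where
  carrier := {g | g ∈ borel F n ∧ ∀ i, (g : Matrix (Fin n) (Fin n) F) i i = 1}
  mul_mem' {a b} ha hb := by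
    refine ⟨mul_mem ha.1 hb.1, fun i => ?_⟩
    have h1 : ∀ j, j < i → (a : Matrix (Fin n) (Fin n) F) i j = 0 := fun j hj => ha.1 hj
    have h2 : ∀ j, i < j → (b : Matrix (Fin n) (Fin n) F) j i = 0 := fun j hj => hb.1 hj
    rw [Units.val_mul, Matrix.mul_apply, Finset.sum_eq_single i]
    · rw [ha.2, hb.2, one_mul]
    · intro j _ hj
      rcases lt_or_gt_of_ne hj with h | h
      · rw [h1 j h, zero_mul]
      · rw [h2 j h, mul_zero]
    · simp
  one_mem' := ⟨one_mem _, fun i => by simp⟩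
  inv_mem' {a} ha := by
    have hinv := inv_mem ha.1
    refine ⟨hinv, fun i => ?_⟩
    have h1 : ∀ j, j < i → (a : Matrix (Fin n) (Fin n) F) i j = 0 := fun j hj => ha.1 hj
    have h2 : ∀ j, i < j → ((a⁻¹ : GLn F n) : Matrix (Fin n) (Fin n) F) j i = 0 :=
      fun j hj => hinv hj
    have h : ((a * a⁻¹ : GLn F n) : Matrix (Fin n) (Fin n) F) i i = 1 := by simp
    rw [Units.val_mul, Matrix.mul_apply, Finset.sum_eq_single i] at h
    · rwa [ha.2, one_mul] at h
    · intro j _ hj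
      rcases lt_or_gt_of_ne hj with h | h
      · rw [h1 j h, zero_mul]
      · rw [h2 j h, mul_zero]
    · simp

/-- The permutation matrices: `σ` is sent to the matrix with `σ e_i = e_{σ i}`. -/
def perm : Equiv.Perm (Fin n) →* GLn F n :=
  (Matrix.permMatrixHom (n := Fin n) (R := F)).toHomUnits

/-- A standard parabolic subgroup is a subgroup containing `B`. -/
def IsStandardParabolic (P : Subgroup (GLn F n)) : Prop := borel F n ≤ P

variable {F n} in
/-- The standard parabolic subgroup attached to a composition `(a_1, …, a_k)` of `n`: the block
upper triangular group with diagonal blocks of sizes `a_1, …, a_k`. -/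
def ofComposition (a : Composition n) : Subgroup (GLn F n) := blockUpper F a.index

variable (ℓ : ℕ)

/-- `c` is a `𝒫`-value: `ν_ℓ([G : P]) = c` for some standard parabolic subgroup `P`. -/
def IsPValue (c : ℕ) : Prop :=
  ∃ P : Subgroup (GLn F n), IsStandardParabolic F n P ∧ padicValNat ℓ P.index = c

/-- `e = min {i ≥ 2 | ℓ divides (q ^ i - 1) / (q - 1)}`, where `q = |F|`. -/
def eNum : ℕ :=
  sInf {i : ℕ | 2 ≤ i ∧ ℓ ∣ (Nat.card F ^ i - 1) / (Nat.card F - 1)}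

/-- `𝒫^*`: the standard parabolic subgroups attached to the weakly increasing compositions of `n`
(that is, to the partitions of `n`) all of whose parts are `1` or of the form `e * ℓ ^ i`. -/
def PStar : Set (Subgroup (GLn F n)) :=
  {P | ∃ a : Composition n, a.blocks.Pairwise (· ≤ ·) ∧
    (∀ s ∈ a.blocks, s = 1 ∨ ∃ i : ℕ, s = eNum F ℓ * ℓ ^ i) ∧ P = ofComposition a}

/-- `𝒫^*(c)`: the members `P` of `𝒫^*` with `ν_ℓ([G : P]) = c`. -/
def PStarAt (c : ℕ) : Set (Subgroup (GLn F n)) :=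
  {P | P ∈ PStar F n ℓ ∧ padicValNat ℓ P.index = c}

variable {F n} in
/-- The character `lam` of `U` is non-trivial on the root subgroup
`X_{ij} = {1 + a E^{ij} | a ∈ F}`. -/
def NontrivialOnRoot {R : Type*} [CommRing R] (lam : unitri F n →* Rˣ) (i j : Fin n) : Prop :=
  ∃ u : unitri F n,
    (∃ a : F, ((u : GLn F n) : Matrix (Fin n) (Fin n) F) = Matrix.transvection i j a) ∧ lam u ≠ 1

variable {F n} in
/-- `P(λ) = ⟨B, J(λ)⟩`, where `J(λ)` consists of the fundamental transpositions `(i, i + 1)` such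
that `λ` is non-trivial on `X_{i,i+1}`. -/
def parabolicOf {R : Type*} [CommRing R] (lam : unitri F n →* Rˣ) : Subgroup (GLn F n) :=
  Subgroup.closure ((borel F n : Set (GLn F n)) ∪
    {g | ∃ i j : Fin n, (i : ℕ) + 1 = j ∧ NontrivialOnRoot lam i j ∧
      g = perm F n (Equiv.swap i j)})

end Groups

/-! ### The Steinberg lattice and its bilinear form -/

section Lattice

variable (R : Type*) [CommRing R] (F : Type*) [Field F] [Fintype F] (n : ℕ)

open Classical in
/-- The element `∑_{σ ∈ S_n} sg(σ) σ B̂` of `RG`, where `B̂` is the sum of the elements of `B`. -/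
def steinbergElt : R[GLn F n] :=
  ∑ σ : Equiv.Perm (Fin n), ((Equiv.Perm.sign σ : ℤ) : R) •
    (MonoidAlgebra.of R (GLn F n) (perm F n σ) *
      ∑ b : borel F n, MonoidAlgebra.of R (GLn F n) (b : GLn F n))

/-- The Steinberg lattice `I`: the left ideal of `RG` generated by `steinbergElt`. -/
abbrev steinbergLattice : Submodule R[GLn F n] R[GLn F n] :=
  Submodule.span R[GLn F n] {steinbergElt R F n}

variable {R F n}

open Classical in
/-- The canonical symmetric bilinear form on `RG`, given on `G × G` by `(g, h) ↦ δ_{g,h}`. -/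
def canonicalForm (x y : R[GLn F n]) : R := ∑ g : GLn F n, x.coeff g * y.coeff g

open Classical in
lemma canonicalForm_single_mul (g : GLn F n) (r : R) (x y : R[GLn F n]) :
    canonicalForm (MonoidAlgebra.single g r * x) y =
      canonicalForm x (MonoidAlgebra.single g⁻¹ r * y) := by
  unfold canonicalForm
  simp only [MonoidAlgebra.coeff_single_mul_apply, inv_inv]
  rw [← Equiv.sum_comp (Equiv.mulLeft g)]
  refine Finset.sum_congr rfl fun h _ => ?_
  simp [mul_comm, mul_left_comm]

lemma canonicalForm_add_left (x x' y : R[GLn F n]) :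
    canonicalForm (x + x') y = canonicalForm x y + canonicalForm x' y := by
  simp [canonicalForm, add_mul, Finset.sum_add_distrib]

lemma coeff_mul_borel {x : R[GLn F n]} (hx : x ∈ steinbergLattice R F n) (g : GLn F n)
    (b : borel F n) : x.coeff (g * b) = x.coeff g := by
  classical
  have key : x * MonoidAlgebra.single ((b : GLn F n)⁻¹) 1 = x := by
    obtain ⟨a, rfl⟩ := Submodule.mem_span_singleton.1 hx
    rw [smul_eq_mul, mul_assoc]
    congr 1
    unfold steinbergElt
    rw [Finset.sum_mul]
    refine Finset.sum_congr rfl fun σ _ => ?_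
    rw [smul_mul_assoc, mul_assoc]
    congr 2
    rw [Finset.sum_mul, ← Equiv.sum_comp (Equiv.mulRight b)]
    refine Finset.sum_congr rfl fun c _ => ?_
    simp [MonoidAlgebra.of_apply, MonoidAlgebra.single_mul_single]
  conv_rhs => rw [← key]
  simp [MonoidAlgebra.coeff_mul_single_apply]

/-- On `I` the canonical form takes values divisible by `|B|`. -/
lemma card_borel_dvd {x y : R[GLn F n]} (hx : x ∈ steinbergLattice R F n)
    (hy : y ∈ steinbergLattice R F n) : (Nat.card (borel F n) : R) ∣ canonicalForm x y := by
  classical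
  have hbij : Function.Bijective
      fun cb : (GLn F n ⧸ borel F n) × borel F n => cb.1.out * (cb.2 : GLn F n) := by
    constructor
    · rintro ⟨c, b⟩ ⟨c', b'⟩ h
      have h' : c.out * (b : GLn F n) = c'.out * (b' : GLn F n) := h
      have hc : c = c' := by
        have := congrArg (QuotientGroup.mk (s := borel F n)) h'
        simpa using this
      subst hc
      simpa using h'
    · intro g
      refine ⟨(g, ⟨(QuotientGroup.mk (s := borel F n) g).out⁻¹ * g, ?_⟩), by simp⟩
      exact QuotientGroup.eq.1 (by simp)
  unfold canonicalForm
  rw [← hbij.sum_comp, Fintype.sum_prod_type]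
  refine Finset.dvd_sum fun c _ => ?_
  simp only [coeff_mul_borel hx, coeff_mul_borel hy, Finset.sum_const, Finset.card_univ,
    nsmul_eq_mul, Nat.card_eq_fintype_card]
  exact dvd_mul_right _ _

/-- The form `f : I × I → R`: the restriction to `I` of the canonical form, scaled by `1 / |B|`.
It is determined by `card_borel_mul_form` when `|B|` is not a zero divisor in `R`. -/
def form (x y : steinbergLattice R F n) : R := (card_borel_dvd x.2 y.2).choose

lemma card_borel_mul_form (x y : steinbergLattice R F n) :
    (Nat.card (borel F n) : R) * form x y = canonicalForm (x : R[GLn F n]) y :=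
  (card_borel_dvd x.2 y.2).choose_spec.symm

section Domain

variable [IsDomain R] [CharZero R]

lemma form_eq_iff (x y : steinbergLattice R F n) (r : R) :
    form x y = r ↔ canonicalForm (x : R[GLn F n]) y = (Nat.card (borel F n) : R) * r := by
  rw [← card_borel_mul_form, mul_right_inj' (Nat.cast_ne_zero.2 Nat.card_pos.ne')]

lemma form_add_left (x x' y : steinbergLattice R F n) :
    form (x + x') y = form x y + form x' y := by
  rw [form_eq_iff, mul_add, card_borel_mul_form, card_borel_mul_form, Submodule.coe_add,
    canonicalForm_add_left]

lemma form_single_smul (g : GLn F n) (r : R) (x y : steinbergLattice R F n) :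
    form ((MonoidAlgebra.single g r : R[GLn F n]) • x) y =
      form x ((MonoidAlgebra.single g⁻¹ r : R[GLn F n]) • y) := by
  rw [form_eq_iff, card_borel_mul_form]
  exact canonicalForm_single_mul g r _ _

variable (R F n) (ℓ : ℕ)

/-- `I(c) = {x ∈ I | f(x, I) ⊆ ℓ ^ c R}`. -/
def latticeFilt (c : ℕ) : Submodule R[GLn F n] (steinbergLattice R F n) where
  carrier := {x | ∀ y, form x y ∈ Ideal.span {(ℓ : R) ^ c}}
  add_mem' {x x'} hx hx' y := by
    rw [form_add_left]
    exact add_mem (hx y) (hx' y)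
  zero_mem' y := by
    have : form (0 : steinbergLattice R F n) y = 0 := by
      rw [form_eq_iff]
      simp [canonicalForm]
    rw [this]
    exact zero_mem _
  smul_mem' a x hx := by
    induction a using MonoidAlgebra.induction_linear with
    | zero =>
      intro y
      have : form ((0 : R[GLn F n]) • x) y = 0 := by
        rw [form_eq_iff]
        simp [canonicalForm]
      rw [this]
      exact zero_mem _
    | add a b ha hb =>
      intro y
      rw [add_smul, form_add_left]
      exact add_mem (ha y) (hb y)
    | single g r =>
      intro y
      rw [form_single_smul]
      exact hx _

end Domain

end Lattice

/-! ### The reduction of the Steinberg lattice modulo `ℓ` -/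

section Reduction

set_option linter.unusedSectionVars false

variable (R : Type*) [CommRing R] (F : Type*) [Field F] [Fintype F] (n : ℕ) (ℓ : ℕ)

/-- `K = R / ℓ R`. -/
abbrev resField : Type _ := R ⧸ Ideal.span {(ℓ : R)}

/-- The coefficientwise reduction `RG → KG`. -/
abbrev redHom : R[GLn F n] →+* (resField R ℓ)[GLn F n] :=
  MonoidAlgebra.mapRingHom (GLn F n) (Ideal.Quotient.mk (Ideal.span {(ℓ : R)}))

lemma redHom_surjective : Function.Surjective (redHom R F n ℓ) := by
  intro y
  induction y using MonoidAlgebra.induction_linear with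
  | zero => exact ⟨0, map_zero _⟩
  | add a b ha hb =>
    obtain ⟨x, rfl⟩ := ha
    obtain ⟨z, rfl⟩ := hb
    exact ⟨x + z, map_add _ _ _⟩
  | single g r =>
    obtain ⟨s, rfl⟩ := Ideal.Quotient.mk_surjective r
    exact ⟨MonoidAlgebra.single g s, by simp⟩

lemma exists_eq_mul_of_redHom_eq_zero {a : R[GLn F n]} (ha : redHom R F n ℓ a = 0) :
    ∃ b : R[GLn F n], a = (ℓ : R[GLn F n]) * b := by
  classical
  have h : ∀ g, ∃ s, a.coeff g = (ℓ : R) * s := by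
    intro g
    have := congrArg (fun z => z.coeff g) ha
    simp only [MonoidAlgebra.coeff_mapRingHom, MonoidAlgebra.coeff_zero, Finsupp.coe_zero,
      Pi.zero_apply] at this
    exact Ideal.mem_span_singleton.1 (Ideal.Quotient.eq_zero_iff_mem.1 this)
  choose s hs using h
  refine ⟨∑ g : GLn F n, MonoidAlgebra.single g (s g), ?_⟩
  rw [MonoidAlgebra.natCast_def]
  ext g
  rw [MonoidAlgebra.coeff_single_mul_apply]
  simp [hs, Finsupp.single_apply]

/-- The sublattice `ℓ I` of `I`. -/
def ellLattice : Submodule R[GLn F n] (steinbergLattice R F n) where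
  carrier := {x | ∃ y, x = (ℓ : R[GLn F n]) • y}
  add_mem' := by
    rintro _ _ ⟨y, rfl⟩ ⟨z, rfl⟩
    exact ⟨y + z, (smul_add _ _ _).symm⟩
  zero_mem' := ⟨0, (smul_zero _).symm⟩
  smul_mem' := by
    rintro a _ ⟨y, rfl⟩
    exact ⟨a • y, by rw [smul_smul, smul_smul, Nat.cast_comm]⟩

/-- `L = I / ℓ I`, the reduction modulo `ℓ` of the Steinberg lattice. -/
def reduction : Type _ := steinbergLattice R F n ⧸ ellLattice R F n ℓ

instance : AddCommGroup (reduction R F n ℓ) :=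
  inferInstanceAs (AddCommGroup (steinbergLattice R F n ⧸ ellLattice R F n ℓ))

instance : Module R[GLn F n] (reduction R F n ℓ) :=
  inferInstanceAs (Module R[GLn F n] (steinbergLattice R F n ⧸ ellLattice R F n ℓ))

/-- The canonical map `x ↦ x + ℓ I` from `I` to `L`. -/
def toReduction : steinbergLattice R F n →ₗ[R[GLn F n]] reduction R F n ℓ :=
  (ellLattice R F n ℓ).mkQ

lemma toReduction_surjective : Function.Surjective (toReduction R F n ℓ) :=
  (ellLattice R F n ℓ).mkQ_surjective

lemma smul_eq_zero_of_redHom_eq_zero {a : R[GLn F n]} (ha : redHom R F n ℓ a = 0)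
    (x : reduction R F n ℓ) : a • x = 0 := by
  obtain ⟨b, rfl⟩ := exists_eq_mul_of_redHom_eq_zero R F n ℓ ha
  obtain ⟨y, rfl⟩ := toReduction_surjective R F n ℓ x
  rw [← map_smul]
  exact (Submodule.Quotient.mk_eq_zero _).2 ⟨b • y, mul_smul _ _ _⟩

/-- An element of `KG` acts on `L` through any of its preimages in `RG`. -/
instance : SMul (resField R ℓ)[GLn F n] (reduction R F n ℓ) :=
  ⟨fun a x => Function.surjInv (redHom_surjective R F n ℓ) a • x⟩

lemma redHom_smul (a : R[GLn F n]) (x : reduction R F n ℓ) : redHom R F n ℓ a • x = a • x := by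
  change Function.surjInv (redHom_surjective R F n ℓ) (redHom R F n ℓ a) • x = a • x
  rw [← sub_eq_zero, ← sub_smul]
  refine smul_eq_zero_of_redHom_eq_zero R F n ℓ ?_ x
  rw [map_sub, Function.surjInv_eq (redHom_surjective R F n ℓ), sub_self]

/-- `L` as a `KG`-module. -/
instance : Module (resField R ℓ)[GLn F n] (reduction R F n ℓ) :=
  Function.Surjective.moduleLeft (redHom R F n ℓ) (redHom_surjective R F n ℓ)
    (redHom_smul R F n ℓ)

section Filtration

variable [IsDomain R] [CharZero R]

/-- `L(c) = (I(c) + ℓ I) / ℓ I`, the image of `I(c)` in `L`. -/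
def reductionFilt (c : ℕ) : Submodule (resField R ℓ)[GLn F n] (reduction R F n ℓ) where
  carrier := {x | ∃ y ∈ latticeFilt R F n ℓ c, toReduction R F n ℓ y = x}
  add_mem' := by
    rintro _ _ ⟨y, hy, rfl⟩ ⟨z, hz, rfl⟩
    exact ⟨y + z, add_mem hy hz, map_add _ _ _⟩
  zero_mem' := ⟨0, zero_mem _, map_zero _⟩
  smul_mem' := by
    rintro a _ ⟨y, hy, rfl⟩
    obtain ⟨a, rfl⟩ := redHom_surjective R F n ℓ a
    exact ⟨a • y, Submodule.smul_mem _ a hy, by rw [redHom_smul, map_smul]⟩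

/-- The factor `M(c) = L(c) / L(c + 1)`. -/
abbrev factor (c : ℕ) : Type _ :=
  reductionFilt R F n ℓ c ⧸ (reductionFilt R F n ℓ (c + 1)).submoduleOf (reductionFilt R F n ℓ c)

end Filtration

variable {R F n}

open Classical in
/-- `E_λ = ∑_{u ∈ U} λ(u) u e ∈ I`, where `e` is the generator `steinbergElt` of `I`. -/
def charElt (lam : unitri F n →* Rˣ) : steinbergLattice R F n :=
  ∑ u : unitri F n, MonoidAlgebra.single (u : GLn F n) (lam u : R) •
    (⟨steinbergElt R F n, Submodule.mem_span_singleton_self _⟩ : steinbergLattice R F n)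

/-- `F_λ = E_λ + ℓ I ∈ L`. -/
def charVec (lam : unitri F n →* Rˣ) : reduction R F n ℓ := toReduction R F n ℓ (charElt lam)

variable (R) in
/-- `L'(P)`: the `KG`-submodule of `L` generated by the `F_λ` with `P(λ) = P`. -/
def parabolicSubmodule (P : Subgroup (GLn F n)) :
    Submodule (resField R ℓ)[GLn F n] (reduction R F n ℓ) :=
  Submodule.span _ {x | ∃ lam : unitri F n →* Rˣ, parabolicOf lam = P ∧ x = charVec ℓ lam}

variable [IsDomain R] [CharZero R]

variable (R) in
/-- `N(P) = (L'(P) + L(c + 1)) / L(c + 1)` as a `KG`-submodule of `M(c)`, where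
`c = ν_ℓ([G : P])`. -/
def parabolicFactor (c : ℕ) (P : Subgroup (GLn F n)) :
    Submodule (resField R ℓ)[GLn F n] (factor R F n ℓ c) :=
  ((parabolicSubmodule R ℓ P ⊔ reductionFilt R F n ℓ (c + 1)).submoduleOf
    (reductionFilt R F n ℓ c)).map (Submodule.mkQ _)

end Reduction

open Classical in
/-- A module is the internal direct sum of the members of the set `S` of submodules. -/
def IsDirectSumOf {A M : Type*} [Ring A] [AddCommGroup M] [Module A M]
    (S : Set (Submodule A M)) : Prop :=
  DirectSum.IsInternal fun N : S => (N : Submodule A M)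

end SteinbergGL

end

open SteinbergGL

/-! Elements of I are read as right B-invariant functions on G. By `val_rank_one` such a function
sums to zero over the q + 1 flags that differ from a given one in a single position, so it is
determined by its values on the big Bruhat cell (`eq_of_val_big_cell`). This cell is a free U-orbit
of flags. Hence each linear character λ of U occurs in I with multiplicity one: the operator ∑ λ(u)
u (`projElt`) maps I into R · E_λ (`projElt_smul`). A non-trivial additive character ψ of F,
available because R contains a primitive p-th root of unity, parametrises these λ by vectors b of
superdiagonal coefficients (`exists_eq_lamOf`). P(λ) depends only on the support of b, and
characters with equal support are conjugate under the diagonal torus.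

For the form, the operators of λ and λ⁻¹ are adjoint, and a count over Bruhat cells gives f(E_λ, e)
= [G : P(λ)] for the generator e of I (`form_charElt_gen`, `index_parab`). It follows that f(E_λ, x)
= s [G : P(λ)] whenever the λ⁻¹-operator sends x to s E_{λ⁻¹} (`form_charElt`). Since |U| is a unit
of R, F_λ lies in L(c) exactly when c ≤ ν_ℓ([G : P(λ)]) (`charVec_mem_reductionFilt_iff`).

Two further facts control M(c). Any non-zero RG-module contains an eigenvector of U for a linear
character (`exists_eigenvector`, a column-by-column argument that uses that q is a unit), so every
strict inclusion of submodules of L is witnessed by some F_λ (`exists_charVec_mem_notMem`). And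
generation is symmetric: if P(λ) and P(μ) have index valuation c and F_μ ∈ KG F_λ + L(c + 1), then
taking adjoints gives F_λ ∈ KG F_μ (`charVec_mem_span_symm`). `IsEigensystem` isolates these
properties. Pure module theory then shows that the images of the F_λ in M(c) generate simple
submodules, that distinct ones are non-isomorphic and independent, and that they span.

It remains to see that 𝒫^* suffices. If a permutation carries the blocks of J' suitably into those
of J (`IsTransport`), then E_{J'} ∈ RG E_J (`IsTransport.exists_charElt_eq`). Such permutations
exist for exchanging two adjacent blocks and for splitting one block in two. When m is neither 1 nor
of the form e ℓ^i, it can be written as x + y so that |GL_m| and |GL_x| |GL_y| have the same ℓ-part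
(`exists_glVal_split`). Splitting repeatedly and sorting therefore leads from any P to a member of
𝒫^* with the same index valuation (`exists_mem_PStarAt`), and simplicity turns the resulting
inclusion in M(c) into an equality. -/

open scoped MonoidAlgebra

noncomputable section

namespace SteinbergGL

/-! ### Permutation matrices, elementary matrices and the Bruhat decomposition -/

section GroupTheory

variable {F : Type*} [Field F] {n : ℕ}

lemma mem_borel {g : GLn F n} : g ∈ borel F n ↔ ∀ i j, j < i → g.val i j = 0 :=
  ⟨fun h _ _ hij => h hij, fun h _ _ hij => h _ _ hij⟩

lemma perm_val_apply (σ : Equiv.Perm (Fin n)) (i j : Fin n) :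
    (perm F n σ).val i j = if i = σ j then 1 else 0 := by
  change (σ⁻¹).permMatrix F i j = _
  simp only [Equiv.Perm.permMatrix, PEquiv.toMatrix_apply, Equiv.toPEquiv_apply,
    Option.mem_def, Option.some_inj]
  exact if_congr Equiv.Perm.inv_eq_iff_eq rfl rfl

lemma perm_mul_val (σ : Equiv.Perm (Fin n)) (g : GLn F n) (i j : Fin n) :
    (perm F n σ * g).val i j = g.val (σ⁻¹ i) j := by
  rw [Units.val_mul, Matrix.mul_apply, Finset.sum_eq_single (σ⁻¹ i)]
  · simp [perm_val_apply]
  · intro k _ hk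
    rw [perm_val_apply, if_neg, zero_mul]
    rintro rfl
    simp at hk
  · simp

lemma mul_perm_val (σ : Equiv.Perm (Fin n)) (g : GLn F n) (i j : Fin n) :
    (g * perm F n σ).val i j = g.val i (σ j) := by
  rw [Units.val_mul, Matrix.mul_apply, Finset.sum_eq_single (σ j)]
  · simp [perm_val_apply]
  · intro k _ hk
    rw [perm_val_apply, if_neg hk, mul_zero]
  · simp

lemma perm_inv_mul_mul_perm_val (σ τ : Equiv.Perm (Fin n)) (g : GLn F n) (i j : Fin n) :
    ((perm F n σ)⁻¹ * g * perm F n τ).val i j = g.val (σ i) (τ j) := by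
  rw [mul_perm_val, ← map_inv, perm_mul_val, inv_inv]

/-- The elementary matrix `1 + a E^{ij}` as an element of the general linear group. -/
def elem (i j : Fin n) (h : i ≠ j) (a : F) : GLn F n where
  val := Matrix.transvection i j a
  inv := Matrix.transvection i j (-a)
  val_inv := by rw [Matrix.transvection_mul_transvection_same _ _ h]; simp
  inv_val := by rw [Matrix.transvection_mul_transvection_same _ _ h]; simp

@[simp] lemma elem_val (i j : Fin n) (h : i ≠ j) (a : F) :
    (elem i j h a).val = Matrix.transvection i j a := rfl

lemma transvection_apply (i j k l : Fin n) (a : F) :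
    Matrix.transvection i j a k l =
      (if k = l then 1 else 0) + if i = k ∧ j = l then a else 0 := by
  simp [Matrix.transvection, Matrix.one_apply, Matrix.single_apply]

lemma elem_mul_val (i j : Fin n) (h : i ≠ j) (a : F) (g : GLn F n) (k l : Fin n) :
    (elem i j h a * g).val k l = g.val k l + if k = i then a * g.val j l else 0 := by
  rw [Units.val_mul, elem_val]
  split_ifs with hk
  · subst hk; simp
  · simp [Matrix.transvection_mul_apply_of_ne _ _ _ _ hk]

lemma mul_elem_val (i j : Fin n) (h : i ≠ j) (a : F) (g : GLn F n) (k l : Fin n) :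
    (g * elem i j h a).val k l = g.val k l + if l = j then a * g.val k i else 0 := by
  rw [Units.val_mul, elem_val]
  split_ifs with hk
  · subst hk; simp
  · simp [Matrix.mul_transvection_apply_of_ne _ _ _ _ hk]

lemma elem_mul_elem (i j : Fin n) (h : i ≠ j) (a c : F) :
    elem i j h a * elem i j h c = elem i j h (a + c) := by
  ext1
  simp [Matrix.transvection_mul_transvection_same _ _ h]

lemma elem_mem_unitri {i j : Fin n} (h : i < j) (a : F) : elem i j h.ne a ∈ unitri F n := by
  refine ⟨mem_borel.2 fun k l hkl => ?_, fun k => ?_⟩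
  · rw [elem_val, transvection_apply, if_neg hkl.ne', if_neg, add_zero]
    rintro ⟨rfl, rfl⟩
    exact absurd h hkl.not_gt
  · rw [elem_val, transvection_apply, if_pos rfl, if_neg, add_zero]
    rintro ⟨rfl, h'⟩
    exact h.ne' h'

lemma unitri_le_borel : unitri F n ≤ borel F n := fun _ h => h.1

lemma mul_elem_perm (σ : Equiv.Perm (Fin n)) {i j : Fin n} (h : i ≠ j) (a : F) :
    perm F n σ * elem i j h a = elem (σ i) (σ j) (σ.injective.ne h) a * perm F n σ := by
  ext k l
  rw [mul_elem_val, mul_perm_val, perm_val_apply, perm_val_apply, elem_val, transvection_apply]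
  by_cases h1 : l = j
  · subst h1; simp [eq_comm]
  · have : σ j ≠ σ l := fun h => h1 (σ.injective h).symm
    simp [h1, this]

/-- An upper triangular matrix with non-zero diagonal entries as an element of `GL_n`. -/
def mkUpper (M : Matrix (Fin n) (Fin n) F) (h : ∀ i j, j < i → M i j = 0)
    (hd : ∀ i, M i i ≠ 0) : GLn F n :=
  Matrix.GeneralLinearGroup.mkOfDetNeZero M (by
    rw [Matrix.det_of_isUpperTriangular (fun i j hij => h i j hij)]
    exact Finset.prod_ne_zero_iff.2 fun i _ => hd i)

@[simp] lemma mkUpper_val (M : Matrix (Fin n) (Fin n) F) (h : ∀ i j, j < i → M i j = 0)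
    (hd : ∀ i, M i i ≠ 0) : (mkUpper M h hd).val = M := rfl

lemma mkUpper_mem_borel (M : Matrix (Fin n) (Fin n) F) (h : ∀ i j, j < i → M i j = 0)
    (hd : ∀ i, M i i ≠ 0) : mkUpper M h hd ∈ borel F n := mem_borel.2 h

/-- Gaussian elimination column by column. The pivot is the lowest non-zero entry of its column, so
the rest of the column is cleared by upper unitriangular row operations, and the rest of the pivot
row by upper triangular column operations. Both leave the earlier pivot rows and columns intact. -/
lemma exists_elimination (g : GLn F n) (m : ℕ) (hm : m ≤ n) :
    ∃ u ∈ unitri F n, ∃ b ∈ borel F n, ∃ s : Fin n → Fin n, ∀ j : Fin n, (j : ℕ) < m →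
      (∀ i, (u * g * b).val i j = if i = s j then 1 else 0) ∧
      ∀ k, k ≠ j → (u * g * b).val (s j) k = 0 := by
  induction m with
  | zero => exact ⟨1, one_mem _, 1, one_mem _, id, by simp⟩
  | succ m ih =>
    obtain ⟨u, hu, b, hb, s, hs⟩ := ih (by omega)
    set g' := u * g * b with hg'
    let m' : Fin n := ⟨m, hm⟩
    have hex : ∃ i, g'.val i m' ≠ 0 := by
      by_contra! hcon
      have : (g'⁻¹ * g').val m' m' = 0 := by
        rw [Units.val_mul, Matrix.mul_apply]
        exact Finset.sum_eq_zero fun k _ => by rw [hcon, mul_zero]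
      simp at this
    classical
    obtain ⟨i0, hi0, hmax⟩ : ∃ i0, g'.val i0 m' ≠ 0 ∧ ∀ i, i0 < i → g'.val i m' = 0 := by
      have hne : (Finset.univ.filter fun i => g'.val i m' ≠ 0).Nonempty :=
        hex.imp fun i hi => by simpa using hi
      refine ⟨Finset.max' _ hne, by simpa using Finset.max'_mem _ hne, fun i hi => ?_⟩
      by_contra hc
      exact absurd (Finset.le_max' _ i (by simpa using hc)) hi.not_ge
    have hi0s : ∀ j : Fin n, (j : ℕ) < m → i0 ≠ s j := by
      rintro j hj rfl
      exact hi0 ((hs j hj).2 _ (by rintro h; rw [← h] at hj; simp [m'] at hj))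
    have hrow : ∀ k : Fin n, (k : ℕ) < m → g'.val i0 k = 0 := fun k hk => by
      rw [(hs k hk).1, if_neg (hi0s k hk)]
    set p := g'.val i0 m' with hp
    -- Right multiplication by `b1` turns the pivot row into a unit vector. It is upper triangular
    -- because the pivot row vanishes in the columns already treated. Below, `u1` clears the pivot
    -- column.
    let r : Fin n → F := fun k => if k = m' then p⁻¹ else - (g'.val i0 k * p⁻¹)
    let b1 : GLn F n := mkUpper (Matrix.of fun i k => if i = m' then r k else if i = k then 1 else 0)
      (by
        intro i j hij
        by_cases h : i = m'
        · subst h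
          simp [r, hij.ne, hrow j hij]
        · simp [h, hij.ne'])
      (by
        intro i
        by_cases h : i = m'
        · subst h; simpa [r] using hi0
        · simp [h])
    let c : Fin n → F := fun i => if i = i0 then 1 else -(g'.val i m' * p⁻¹)
    let u1 : GLn F n := mkUpper (Matrix.of fun i k => if k = i0 then c i else if i = k then 1 else 0)
      (by
        intro i j hij
        by_cases h : j = i0
        · subst h
          simp [c, hij.ne', hmax i hij]
        · simp [h, hij.ne'])
      (by
        intro i
        by_cases h : i = i0
        · subst h; simp [c]
        · simp [h])
    have hu1 : u1 ∈ unitri F n := by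
      refine ⟨mkUpper_mem_borel _ _ _, fun i => ?_⟩
      by_cases h : i = i0
      · subst h; simp [u1, c]
      · simp [u1, h]
    have hgb : ∀ i k, (g' * b1).val i k = (if k = m' then 0 else g'.val i k) + g'.val i m' * r k := by
      intro i k
      rw [Units.val_mul, Matrix.mul_apply, ← Finset.add_sum_erase _ _ (Finset.mem_univ m'), add_comm]
      congr 1
      · split_ifs with hk
        · subst hk
          refine Finset.sum_eq_zero fun l hl => ?_
          have hl' := (Finset.mem_erase.1 hl).1
          simp [b1, hl']
        · rw [Finset.sum_eq_single k]
          · simp [b1, hk]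
          · intro l hl hlk
            have hl' := (Finset.mem_erase.1 hl).1
            simp [b1, hl', hlk]
          · intro h
            simp [hk] at h
      · simp [b1]
    have hug : ∀ i k, (u1 * (g' * b1)).val i k =
        (if i = i0 then 0 else (g' * b1).val i k) + c i * (g' * b1).val i0 k := by
      intro i k
      rw [Units.val_mul u1, Matrix.mul_apply, ← Finset.add_sum_erase _ _ (Finset.mem_univ i0),
        add_comm]
      congr 1
      · split_ifs with hk
        · subst hk
          refine Finset.sum_eq_zero fun l hl => ?_
          have hl' := (Finset.mem_erase.1 hl).1
          simp [u1, hl', hl'.symm]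
        · rw [Finset.sum_eq_single i]
          · simp [u1, hk]
          · intro l hl hlk
            have hl' := (Finset.mem_erase.1 hl).1
            simp [u1, hl', hlk.symm]
          · intro h
            simp [hk] at h
      · simp [u1]
    have hi0row : ∀ k, (g' * b1).val i0 k = if k = m' then 1 else 0 := by
      intro k
      rw [hgb]
      split_ifs with hk
      · simp [r, hk, ← hp, hi0]
      · simp only [r, if_neg hk, ← hp]
        field_simp
        ring
    have hfin : ∀ i k, (u1 * (g' * b1)).val i k = if k = m' then (if i = i0 then 1 else 0) else
        if i = i0 then 0 else g'.val i k - g'.val i m' * g'.val i0 k * p⁻¹ := by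
      intro i k
      rw [hug, hi0row, hgb]
      by_cases h1 : i = i0 <;> by_cases h2 : k = m' <;> simp [h1, h2, c, r]
      ring
    have hassoc : u1 * u * g * (b * b1) = u1 * (g' * b1) := by
      rw [hg']; simp only [mul_assoc]
    refine ⟨u1 * u, mul_mem hu1 hu, b * b1, mul_mem hb (mkUpper_mem_borel _ _ _),
      fun j => if j = m' then i0 else s j, fun j hj => ?_⟩
    rw [hassoc]
    by_cases hjm : j = m'
    · subst hjm
      refine ⟨fun i => by simp [hfin], fun k hk => ?_⟩
      simp [hfin, hk]
    · simp only [if_neg hjm]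
      have hj' : (j : ℕ) < m := by
        have : (j : ℕ) ≠ m := fun h => hjm (Fin.ext h)
        omega
      have h0 : g'.val (s j) m' = 0 := (hs j hj').2 _ (Ne.symm hjm)
      refine ⟨fun i => ?_, fun k hk => ?_⟩
      · rw [hfin, if_neg hjm, hrow j hj', (hs j hj').1]
        by_cases h : i = i0
        · subst h; simp [hi0s j hj']
        · simp [h]
      · rw [hfin, h0, (hs j hj').2 k hk]
        simp [(hi0s j hj').symm]

/-- The Bruhat decomposition `G = U W B`. -/
lemma exists_bruhat (g : GLn F n) :
    ∃ u ∈ unitri F n, ∃ σ : Equiv.Perm (Fin n), ∃ b ∈ borel F n, g = u * perm F n σ * b := by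
  obtain ⟨u, hu, b, hb, s, hs⟩ := exists_elimination g n le_rfl
  have hinj : Function.Injective s := by
    intro j j' h
    by_contra hne
    have h1 := (hs j j.2).2 j' (Ne.symm hne)
    rw [(hs j' j'.2).1, if_pos h] at h1
    exact one_ne_zero h1
  let σ : Equiv.Perm (Fin n) := Equiv.ofBijective s (Finite.injective_iff_bijective.1 hinj)
  have h : u * g * b = perm F n σ := by
    ext i j
    rw [(hs j j.2).1, perm_val_apply]
    rfl
  refine ⟨u⁻¹, inv_mem hu, σ, b⁻¹, inv_mem hb, ?_⟩
  rw [← h]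
  group

lemma perm_eq_one_of_le {α : Type*} [LinearOrder α] [WellFoundedLT α] (π : Equiv.Perm α)
    (h : ∀ j, π j ≤ j) : π = 1 := by
  ext j
  induction j using WellFoundedLT.induction with
  | ind j ih =>
    rcases (h j).lt_or_eq with hlt | heq
    · exact absurd (π.injective (ih _ hlt)) hlt.ne
    · simpa using heq

/-- Bruhat cells are disjoint: the diagonal entry 1 of `u` at `σ j` is moved to position `(τ⁻¹ (σ
j), j)`, which must lie on or above the diagonal for every `j`. -/
lemma eq_of_perm_inv_mul_mul_perm_mem_borel {u : GLn F n} (hu : u ∈ unitri F n)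
    {σ τ : Equiv.Perm (Fin n)} (h : (perm F n τ)⁻¹ * u * perm F n σ ∈ borel F n) : σ = τ := by
  have : τ⁻¹ * σ = 1 := by
    refine perm_eq_one_of_le _ fun j => ?_
    by_contra hlt
    have := mem_borel.1 h _ _ (not_le.1 hlt)
    rw [perm_inv_mul_mul_perm_val] at this
    simp [hu.2] at this
  exact (inv_mul_eq_one.1 this).symm

end GroupTheory

/-! ### Induction along ascents and descents of permutations -/

section Permutations

variable {n : ℕ}

lemma rel_of_lt_of_adjacent {r : Fin n → Fin n → Prop}
    (htrans : ∀ i j k, r i j → r j k → r i k)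
    (h : ∀ i j : Fin n, (i : ℕ) + 1 = j → r i j) {i j : Fin n} (hij : i < j) : r i j := by
  obtain ⟨j, hj⟩ := j
  induction j with
  | zero => exact absurd hij (by simp [Fin.lt_def])
  | succ m ih =>
    have hm : m < n := by omega
    rcases (Nat.lt_succ_iff.1 (Fin.lt_def.1 hij)).lt_or_eq with hlt | heq
    · exact htrans _ _ _ (ih hm hlt) (h ⟨m, hm⟩ _ rfl)
    · exact h _ _ (by simp [heq])

lemma perm_eq_one_of_strictMono {σ : Equiv.Perm (Fin n)} (h : StrictMono σ) : σ = 1 := by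
  rw [← inv_eq_one]
  refine perm_eq_one_of_le _ fun j => ?_
  simpa using h.le_apply (x := σ⁻¹ j)

lemma exists_descent {σ : Equiv.Perm (Fin n)} (h : σ ≠ 1) :
    ∃ i j : Fin n, (i : ℕ) + 1 = j ∧ σ j < σ i := by
  by_contra! hcon
  refine h (perm_eq_one_of_strictMono fun i j hij => ?_)
  refine rel_of_lt_of_adjacent (r := fun i j => σ i < σ j) (fun _ _ _ => lt_trans)
    (fun i j hij => (hcon i j hij).lt_of_ne ?_) hij
  intro he
  rw [σ.injective he] at hij
  omega

lemma exists_ascent {σ : Equiv.Perm (Fin n)} (h : σ ≠ Fin.revPerm) :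
    ∃ i j : Fin n, (i : ℕ) + 1 = j ∧ σ i < σ j := by
  have h' : Fin.revPerm * σ ≠ 1 := fun h1 => h (by
    ext1 i
    have h2 : (σ i).rev = i := congrArg (fun π => π i) h1
    exact Fin.rev_eq_iff.1 h2)
  obtain ⟨i, j, hij, hlt⟩ := exists_descent h'
  exact ⟨i, j, hij, by simpa using hlt⟩

/-- The termination measure of both inductions: exchanging two adjacent values lowers the weighted
sum by `f (σ j) - f (σ i)`. The identity is used for ascents, `Fin.rev` for descents. -/
lemma sum_mul_swap_lt (σ : Equiv.Perm (Fin n)) (f : Fin n → ℕ) {i j : Fin n}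
    (hij : (i : ℕ) + 1 = j) (h : f (σ i) < f (σ j)) :
    ∑ k : Fin n, (k : ℕ) * f ((σ * Equiv.swap i j) k) < ∑ k : Fin n, (k : ℕ) * f (σ k) := by
  have hne : i ≠ j := fun he => by rw [he] at hij; omega
  rw [← Equiv.sum_comp (Equiv.swap i j)]
  have key : ∑ k : Fin n, (((Equiv.swap i j k : Fin n) : ℕ) : ℤ) * f (σ k) -
      ∑ k : Fin n, ((k : ℕ) : ℤ) * f (σ k) = (f (σ i) : ℤ) - f (σ j) := by
    rw [← Finset.sum_sub_distrib, Fintype.sum_eq_add i j hne]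
    · rw [Equiv.swap_apply_left, Equiv.swap_apply_right, ← hij]
      push_cast
      ring
    · rintro k ⟨hki, hkj⟩
      rw [Equiv.swap_apply_of_ne_of_ne hki hkj, sub_self]
  simp only [Equiv.Perm.mul_apply, Equiv.swap_apply_self]
  zify
  have : (f (σ i) : ℤ) < f (σ j) := by exact_mod_cast h
  linarith

lemma perm_ascent_induction {p : Equiv.Perm (Fin n) → Prop} (h0 : p Fin.revPerm)
    (h : ∀ (σ : Equiv.Perm (Fin n)) (i j : Fin n), (i : ℕ) + 1 = j → σ i < σ j →
      p (σ * Equiv.swap i j) → p σ) (σ : Equiv.Perm (Fin n)) : p σ := by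
  induction hm : ∑ k : Fin n, (k : ℕ) * (σ k : ℕ) using Nat.strong_induction_on generalizing σ with
  | _ m ih =>
    by_cases hσ : σ = Fin.revPerm
    · rwa [hσ]
    · obtain ⟨i, j, hij, hlt⟩ := exists_ascent hσ
      exact h σ i j hij hlt (ih _ (hm ▸ sum_mul_swap_lt σ (fun k => (k : ℕ)) hij hlt) _ rfl)

lemma perm_descent_induction {p : Equiv.Perm (Fin n) → Prop} (h0 : p 1)
    (h : ∀ (σ : Equiv.Perm (Fin n)) (i j : Fin n), (i : ℕ) + 1 = j → σ j < σ i →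
      p (σ * Equiv.swap i j) → p σ) (σ : Equiv.Perm (Fin n)) : p σ := by
  induction hm : ∑ k : Fin n, (k : ℕ) * ((σ k).rev : ℕ) using Nat.strong_induction_on
    generalizing σ with
  | _ m ih =>
    by_cases hσ : σ = 1
    · rwa [hσ]
    · obtain ⟨i, j, hij, hlt⟩ := exists_descent hσ
      exact h σ i j hij hlt (ih _ (hm ▸ sum_mul_swap_lt σ (fun k => (k.rev : ℕ)) hij
        (Fin.rev_lt_rev.2 hlt)) _ rfl)

end Permutations

/-! ### Standard parabolic subgroups and sets of fundamental reflections -/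

section Parabolics

variable {F : Type*} [Field F] {n : ℕ}

lemma mem_blockUpper {α : Type*} [LinearOrder α] {blk : Fin n → α} {g : GLn F n} :
    g ∈ blockUpper F blk ↔ ∀ i j, blk j < blk i → g.val i j = 0 :=
  ⟨fun h _ _ hij => h hij, fun h _ _ hij => h _ _ hij⟩

lemma borel_le_blockUpper {α : Type*} [LinearOrder α] {blk : Fin n → α} (h : Monotone blk) :
    borel F n ≤ blockUpper F blk := fun _ hg =>
  mem_blockUpper.2 fun _ _ hij => mem_borel.1 hg _ _ (h.reflect_lt hij)

lemma perm_mem_blockUpper {α : Type*} [LinearOrder α] {blk : Fin n → α}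
    {σ : Equiv.Perm (Fin n)} : perm F n σ ∈ blockUpper F blk ↔ ∀ i, blk (σ i) ≤ blk i := by
  rw [mem_blockUpper]
  constructor
  · intro h i
    by_contra hlt
    have := h _ _ (not_le.1 hlt)
    simp [perm_val_apply] at this
  · intro h i j hij
    rw [perm_val_apply, if_neg]
    rintro rfl
    exact absurd (h j) hij.not_ge

lemma perm_swap_mem_blockUpper {α : Type*} [LinearOrder α] {blk : Fin n → α} {i j : Fin n} :
    perm F n (Equiv.swap i j) ∈ blockUpper F blk ↔ blk i = blk j := by
  rw [perm_mem_blockUpper]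
  constructor
  · intro h
    have h1 := h i
    have h2 := h j
    simp only [Equiv.swap_apply_left, Equiv.swap_apply_right] at h1 h2
    exact le_antisymm h2 h1
  · intro h k
    rcases eq_or_ne k i with rfl | hi
    · simp [h]
    rcases eq_or_ne k j with rfl | hj
    · simp [h]
    rw [Equiv.swap_apply_of_ne_of_ne hi hj]

lemma ne_of_adjacent {i j : Fin n} (hij : (i : ℕ) + 1 = j) : i ≠ j := fun h => by
  rw [h] at hij; omega

lemma lt_of_adjacent {i j : Fin n} (hij : (i : ℕ) + 1 = j) : i < j := by
  rw [Fin.lt_def]; omega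

/-- A computation with 2 × 2 matrices: the reflection times an upper and then a lower elementary
matrix, with entries -1 and 1, is upper triangular. -/
lemma perm_swap_mem_of_elem_mem {P : Subgroup (GLn F n)} (hP : borel F n ≤ P) {i j : Fin n}
    (hij : (i : ℕ) + 1 = j) (h : elem j i (ne_of_adjacent hij).symm 1 ∈ P) :
    perm F n (Equiv.swap i j) ∈ P := by
  have hlt := lt_of_adjacent hij
  have hb : perm F n (Equiv.swap i j) * (elem i j hlt.ne (-1) * elem j i hlt.ne' 1) ∈
      borel F n := by
    refine mem_borel.2 fun k l hkl => ?_
    rw [perm_mul_val, elem_mul_val, elem_val, transvection_apply, transvection_apply]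
    rw [Equiv.swap_inv]
    rw [Fin.lt_def] at hkl
    rcases eq_or_ne k i with rfl | hki
    · simp only [Equiv.swap_apply_left]
      have h1 : k ≠ l := fun h => by rw [h] at hkl; omega
      have h2 : j ≠ l := fun h => by rw [← h] at hkl; omega
      simp [h1, h2, hlt.ne']
    rcases eq_or_ne k j with rfl | hkj
    · simp only [Equiv.swap_apply_right]
      rcases eq_or_ne l i with rfl | hli
      · simp [hlt.ne']
      · have : k ≠ l := fun h => by rw [h] at hkl; omega
        simp [hli.symm, this, hlt.ne']
    · rw [Equiv.swap_apply_of_ne_of_ne hki hkj]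
      have : k ≠ l := fun h => by rw [h] at hkl; omega
      simp [this, hki, Ne.symm hkj]
  have h2 : elem i j hlt.ne (-1 : F) * elem j i hlt.ne' 1 ∈ P :=
    mul_mem (hP (unitri_le_borel (elem_mem_unitri hlt _))) h
  exact (Subgroup.mul_mem_cancel_right P h2).1 (hP hb)

/-- A standard parabolic subgroup is generated by `B` and the fundamental reflections which it
contains. -/
lemma eq_closure_of_borel_le {P : Subgroup (GLn F n)} (hP : borel F n ≤ P) :
    P = Subgroup.closure ((borel F n : Set (GLn F n)) ∪
      {g | ∃ i j : Fin n, (i : ℕ) + 1 = j ∧ perm F n (Equiv.swap i j) ∈ P ∧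
        g = perm F n (Equiv.swap i j)}) := by
  set H := Subgroup.closure ((borel F n : Set (GLn F n)) ∪
      {g | ∃ i j : Fin n, (i : ℕ) + 1 = j ∧ perm F n (Equiv.swap i j) ∈ P ∧
        g = perm F n (Equiv.swap i j)}) with hH
  have hBH : borel F n ≤ H := fun b hb => Subgroup.subset_closure (Or.inl hb)
  refine le_antisymm (fun g hg => ?_) ?_
  · obtain ⟨u, hu, σ, b, hb, rfl⟩ := exists_bruhat g
    have hσ : perm F n σ ∈ P := by
      have h1 := (Subgroup.mul_mem_cancel_right P (hP hb)).1 hg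
      exact (Subgroup.mul_mem_cancel_left P (hP (unitri_le_borel hu))).1 h1
    refine mul_mem (mul_mem (hBH (unitri_le_borel hu)) ?_) (hBH hb)
    clear hg
    induction σ using perm_descent_induction with
    | h0 => rw [map_one]; exact one_mem _
    | h σ i j hij hlt ih =>
      -- At a descent, conjugation by `σ` makes this lower elementary matrix upper triangular, so
      -- `P` contains it and hence also the reflection.
      have h1 : elem j i (ne_of_adjacent hij).symm (1 : F) ∈ P := by
        have h2 := mul_elem_perm σ (ne_of_adjacent hij).symm (1 : F)
        rw [← eq_inv_mul_iff_mul_eq] at h2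
        rw [h2]
        exact mul_mem (inv_mem hσ) (mul_mem (hP (unitri_le_borel (elem_mem_unitri hlt _))) hσ)
      have h2 := perm_swap_mem_of_elem_mem hP hij h1
      have h3 : perm F n (Equiv.swap i j) ∈ H := Subgroup.subset_closure (Or.inr ⟨i, j, hij, h2, rfl⟩)
      have h4 := ih (by rw [map_mul]; exact mul_mem hσ h2)
      rw [map_mul] at h4
      exact (Subgroup.mul_mem_cancel_right H h3).1 h4
  · rw [hH, Subgroup.closure_le]
    rintro g (hg | ⟨i, j, _, hg, rfl⟩)
    · exact hP hg
    · exact hg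

lemma eq_of_perm_swap_mem_iff {P Q : Subgroup (GLn F n)} (hP : borel F n ≤ P)
    (hQ : borel F n ≤ Q) (h : ∀ i j : Fin n, (i : ℕ) + 1 = j →
      (perm F n (Equiv.swap i j) ∈ P ↔ perm F n (Equiv.swap i j) ∈ Q)) : P = Q := by
  rw [eq_closure_of_borel_le hP, eq_closure_of_borel_le hQ]
  congr 2
  ext g
  exact exists_congr fun i => exists_congr fun j => and_congr_right fun hij =>
    and_congr_left fun _ => h i j hij

open Classical in
/-- The number of the block of `i`, where `i` and `i + 1` belong to the same block if and only if
`i ∈ J`. -/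
def blkOf (J : Set (Fin n)) (i : Fin n) : ℕ := (Finset.univ.filter fun k => k < i ∧ k ∉ J).card

lemma blkOf_mono (J : Set (Fin n)) : Monotone (blkOf J) := fun i j hij => by
  classical
  exact Finset.card_le_card fun k => by
    simp only [Finset.mem_filter, Finset.mem_univ, true_and]
    exact fun h => ⟨h.1.trans_le hij, h.2⟩

lemma blkOf_eq_iff (J : Set (Fin n)) {i j : Fin n} (hij : (i : ℕ) + 1 = j) :
    blkOf J i = blkOf J j ↔ i ∈ J := by
  classical
  have hlt := lt_of_adjacent hij
  constructor
  · intro h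
    by_contra hi
    refine absurd h (Finset.card_lt_card ?_).ne
    refine Finset.ssubset_iff_of_subset (fun k => ?_) |>.2 ⟨i, ?_, ?_⟩
    · simp only [Finset.mem_filter, Finset.mem_univ, true_and]
      exact fun h => ⟨h.1.trans hlt, h.2⟩
    · simp [hlt, hi]
    · simp
  · intro hi
    unfold blkOf
    congr 1
    ext k
    simp only [Finset.mem_filter, Finset.mem_univ, true_and, Fin.lt_def]
    constructor
    · exact fun h => ⟨by omega, h.2⟩
    · refine fun h => ⟨lt_of_le_of_ne (by omega) ?_, h.2⟩
      intro he
      exact h.2 (Fin.ext he ▸ hi)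

/-- The standard parabolic subgroup attached to a set of fundamental reflections. -/
def parab (F : Type*) [Field F] (J : Set (Fin n)) : Subgroup (GLn F n) := blockUpper F (blkOf J)

lemma borel_le_parab (J : Set (Fin n)) : borel F n ≤ parab F J :=
  borel_le_blockUpper (blkOf_mono J)

lemma perm_swap_mem_parab {J : Set (Fin n)} {i j : Fin n} (hij : (i : ℕ) + 1 = j) :
    perm F n (Equiv.swap i j) ∈ parab F J ↔ i ∈ J :=
  perm_swap_mem_blockUpper.trans (blkOf_eq_iff J hij)

/-- The set of fundamental reflections contained in `P`. -/
def refls (P : Subgroup (GLn F n)) : Set (Fin n) :=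
  {i | ∃ j : Fin n, (i : ℕ) + 1 = j ∧ perm F n (Equiv.swap i j) ∈ P}

lemma parab_eq_iff {J : Set (Fin n)} {P : Subgroup (GLn F n)} (hP : borel F n ≤ P) :
    parab F J = P ↔
      ∀ i j : Fin n, (i : ℕ) + 1 = j → (i ∈ J ↔ perm F n (Equiv.swap i j) ∈ P) := by
  constructor
  · rintro rfl i j hij
    rw [perm_swap_mem_parab hij]
  · intro h
    exact eq_of_perm_swap_mem_iff (borel_le_parab J) hP fun i j hij => by
      rw [perm_swap_mem_parab hij, h i j hij]

lemma parab_refls {P : Subgroup (GLn F n)} (hP : borel F n ≤ P) : parab F (refls P) = P :=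
  (parab_eq_iff hP).2 fun i j hij => by
    refine ⟨fun ⟨j', hj', h⟩ => ?_, fun h => ⟨j, hij, h⟩⟩
    rwa [show j = j' from Fin.ext (by omega)]

lemma parab_eq_closure (J : Set (Fin n)) :
    parab F J = Subgroup.closure ((borel F n : Set (GLn F n)) ∪
      {g | ∃ i j : Fin n, (i : ℕ) + 1 = j ∧ i ∈ J ∧ g = perm F n (Equiv.swap i j)}) := by
  rw [eq_closure_of_borel_le (borel_le_parab J)]
  congr 2
  ext g
  exact exists_congr fun i => exists_congr fun j => and_congr_right fun hij =>
    and_congr_left fun _ => perm_swap_mem_parab hij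

end Parabolics

/-! ### Linear characters of the unitriangular group -/

section Characters

variable {F : Type*} [Field F] {n : ℕ} {R : Type*} [CommRing R]

/-- A faithful character of the prime field is composed with the trace, which is non-degenerate. -/
lemma exists_addChar_ne_one [Finite F] [IsDomain R] {p : ℕ} [CharP F p] (hp : p.Prime) {ζ : R}
    (hζ : IsPrimitiveRoot ζ p) : ∃ ψ : AddChar F R, ψ ≠ 1 := by
  obtain rfl : ringChar F = p := ringChar.eq F p ▸ rfl
  have : Fact (ringChar F).Prime := ⟨hp⟩
  let : Algebra (ZMod (ringChar F)) F := ZMod.algebra _ _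
  have hprim := AddChar.zmodChar_primitive_of_primitive_root (ringChar F) hζ
  refine ⟨(AddChar.zmodChar (ringChar F) hζ.pow_eq_one).compAddMonoidHom
    (Algebra.trace (ZMod (ringChar F)) F).toAddMonoidHom, ?_⟩
  obtain ⟨a, ha⟩ := FiniteField.trace_to_zmod_nondegenerate F one_ne_zero
  rw [one_mul] at ha
  refine AddChar.ne_one_iff.2 ⟨a, fun hf => ha ?_⟩
  exact (hprim.zmod_char_eq_one_iff _ _).1 hf

/-- Counting: the shifts of `ψ` are |F| distinct characters, while characters are linearly
independent in the space of functions on `F`, so there are at most |F| of them. -/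
lemma exists_mulShift_eq [Finite F] [IsDomain R] [CharZero R] {ψ : AddChar F R} (hψ : ψ ≠ 1)
    (χ : AddChar F R) : ∃ b : F, ∀ a, χ a = ψ (b * a) := by
  classical
  have := Fintype.ofFinite F
  have hli := (linearIndependent_monoidHom (Multiplicative F) R).comp
    (AddChar.toMonoidHomEquiv : AddChar F R ≃ _) (Equiv.injective _)
  have : Finite (AddChar F R) := hli.finite
  have := Fintype.ofFinite (AddChar F R)
  have hinj := AddChar.to_mulShift_inj_of_isPrimitive (AddChar.IsPrimitive.of_ne_one hψ)
  have hcard : Fintype.card F = Fintype.card (AddChar F R) := by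
    refine le_antisymm (Fintype.card_le_of_injective _ hinj) ?_
    simpa using hli.fintype_card_le_finrank
  obtain ⟨b, hb⟩ := ((Fintype.bijective_iff_injective_and_card _).2 ⟨hinj, hcard⟩).2 χ
  exact ⟨b, fun a => by rw [← hb, AddChar.mulShift_apply]⟩

/-- The linear form `∑ b_i g_{i,i+1}` in the entries above the diagonal. -/
def superdiag (b : Fin n → F) (g : GLn F n) : F :=
  ∑ i : Fin n, ∑ j : Fin n, if (i : ℕ) + 1 = j then b i * g.val i j else 0

lemma superdiag_congr {b : Fin n → F} {g h : GLn F n}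
    (H : ∀ i j : Fin n, (i : ℕ) + 1 = j → b i ≠ 0 → g.val i j = h.val i j) :
    superdiag b g = superdiag b h := by
  refine Finset.sum_congr rfl fun i _ => Finset.sum_congr rfl fun j _ => ?_
  split_ifs with hij
  · by_cases hb : b i = 0
    · simp [hb]
    · rw [H i j hij hb]
  · rfl

lemma superdiag_eq_zero {b : Fin n → F} {g : GLn F n}
    (H : ∀ i j : Fin n, (i : ℕ) + 1 = j → b i ≠ 0 → g.val i j = 0) : superdiag b g = 0 := by
  refine Finset.sum_eq_zero fun i _ => Finset.sum_eq_zero fun j _ => ?_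
  split_ifs with hij
  · by_cases hb : b i = 0
    · simp [hb]
    · rw [H i j hij hb, mul_zero]
  · rfl

lemma superdiag_elem {b : Fin n → F} {i j : Fin n} (hij : i ≠ j) (a : F) :
    superdiag b (elem i j hij a) = if (i : ℕ) + 1 = j then b i * a else 0 := by
  unfold superdiag
  rw [Finset.sum_eq_single i, Finset.sum_eq_single j]
  · simp [transvection_apply, hij]
  · intro l _ hl
    split_ifs with h
    · simp [transvection_apply, ne_of_adjacent h, Ne.symm hl]
    · rfl
  · simp
  · intro k _ hk
    refine Finset.sum_eq_zero fun l _ => ?_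
    split_ifs with h
    · simp [transvection_apply, ne_of_adjacent h, Ne.symm hk]
    · rfl
  · simp

lemma unitri_mul_superdiag_apply {g h : GLn F n} (hg : g ∈ unitri F n) (hh : h ∈ unitri F n)
    {i j : Fin n} (hij : (i : ℕ) + 1 = j) : (g * h).val i j = g.val i j + h.val i j := by
  have hne := ne_of_adjacent hij
  rw [Units.val_mul, Matrix.mul_apply, Fintype.sum_eq_add i j hne, hg.2, hh.2]
  · ring
  · rintro k ⟨hki, hkj⟩
    rcases lt_or_gt_of_ne hki with h1 | h1
    · rw [mem_borel.1 hg.1 _ _ h1, zero_mul]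
    · rw [mem_borel.1 hh.1 _ _ (?_ : j < k), mul_zero]
      rw [Fin.lt_def] at h1 ⊢
      have : (k : ℕ) ≠ j := fun h => hkj (Fin.ext h)
      omega

lemma superdiag_mul (b : Fin n → F) {g h : GLn F n} (hg : g ∈ unitri F n)
    (hh : h ∈ unitri F n) : superdiag b (g * h) = superdiag b g + superdiag b h := by
  unfold superdiag
  simp only [← Finset.sum_add_distrib]
  refine Finset.sum_congr rfl fun i _ => Finset.sum_congr rfl fun j _ => ?_
  split_ifs with hij
  · rw [unitri_mul_superdiag_apply hg hh hij, mul_add]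
  · simp

/-- The linear character `u ↦ ψ (∑ b_i u_{i,i+1})` of `U`. -/
def lamOf (ψ : AddChar F R) (b : Fin n → F) : unitri F n →* Rˣ :=
  MonoidHom.toHomUnits
    { toFun := fun u => ψ (superdiag b u)
      map_one' := by
        rw [superdiag_eq_zero, AddChar.map_zero_eq_one]
        intro i j hij _
        simp [ne_of_adjacent hij]
      map_mul' := fun u v => by
        rw [Subgroup.coe_mul, superdiag_mul b u.2 v.2, AddChar.map_add_eq_mul] }

lemma lamOf_val (ψ : AddChar F R) (b : Fin n → F) (u : unitri F n) :
    (lamOf ψ b u : R) = ψ (superdiag b u) := rfl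

lemma lamOf_inv_val (ψ : AddChar F R) (b : Fin n → F) (u : unitri F n) :
    (((lamOf ψ b u)⁻¹ : Rˣ) : R) = ψ (superdiag (-b) u) := by
  rw [← map_inv, lamOf_val]
  congr 1
  have h := superdiag_mul b u.2 (inv_mem u.2)
  rw [mul_inv_cancel, superdiag_eq_zero (g := 1)] at h
  · rw [Subgroup.coe_inv, ← neg_eq_of_add_eq_zero_right h.symm]
    simp only [superdiag, ← Finset.sum_neg_distrib]
    refine Finset.sum_congr rfl fun i _ => Finset.sum_congr rfl fun j _ => ?_
    split_ifs <;> simp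
  · intro i j hij _
    simp [ne_of_adjacent hij]

lemma inv_lamOf (ψ : AddChar F R) (b : Fin n → F) : (lamOf ψ b)⁻¹ = lamOf ψ (-b) := by
  ext u
  rw [lamOf_val, ← lamOf_inv_val]
  rfl

/-- `U` is generated by the elementary matrices which it contains. -/
lemma unitri_induction {p : GLn F n → Prop} (h1 : p 1)
    (hmul : ∀ (i j : Fin n) (h : i < j) (a : F) (u : GLn F n), u ∈ unitri F n → p u →
      p (elem i j h.ne a * u)) {u : GLn F n} (hu : u ∈ unitri F n) : p u := by
  classical
  induction hm : (Finset.univ.filter fun x : Fin n × Fin n => x.1 < x.2 ∧ u.val x.1 x.2 ≠ 0).card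
    using Nat.strong_induction_on generalizing u with
  | _ m ih =>
    by_cases hex : ∃ i, ∃ j, i < j ∧ u.val i j ≠ 0
    -- With `i` the lowest row having an entry off the diagonal, row `j` is a unit vector, so the
    -- row operation below changes the single entry `(i, j)`.
    · obtain ⟨i, ⟨j, hij, hne⟩, hmax⟩ : ∃ i, (∃ j, i < j ∧ u.val i j ≠ 0) ∧
          ∀ k, i < k → ∀ j, k < j → u.val k j = 0 := by
        have hS : (Finset.univ.filter fun i => ∃ j, i < j ∧ u.val i j ≠ 0).Nonempty :=
          hex.imp fun i hi => by simpa using hi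
        refine ⟨Finset.max' _ hS, by simpa using Finset.max'_mem _ hS, fun k hk j hj => ?_⟩
        by_contra hc
        exact absurd (Finset.le_max' _ k (by simpa using ⟨j, hj, hc⟩)) hk.not_ge
      set u' := elem i j hij.ne (-u.val i j) * u with hu'
      have hu'U : u' ∈ unitri F n := mul_mem (elem_mem_unitri hij _) hu
      have hval : ∀ k l, u'.val k l = if k = i ∧ l = j then 0 else u.val k l := by
        intro k l
        rw [hu', elem_mul_val]
        by_cases hk : k = i
        · subst hk
          rcases lt_trichotomy l j with h | h | h
          · simp [h.ne, mem_borel.1 hu.1 _ _ h]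
          · subst h; simp [hu.2]
          · simp [h.ne', hmax _ hij _ h]
        · simp [hk]
      have hlt : (Finset.univ.filter fun x : Fin n × Fin n =>
          x.1 < x.2 ∧ u'.val x.1 x.2 ≠ 0).card < m := by
        rw [← hm]
        refine Finset.card_lt_card (Finset.ssubset_iff_of_subset (fun x => ?_) |>.2
          ⟨(i, j), by simp [hij, hne], by simp [hval]⟩)
        simp only [Finset.mem_filter, Finset.mem_univ, true_and, hval]
        rintro ⟨h, h'⟩
        split_ifs at h' with hc
        · exact absurd rfl h'
        · exact ⟨h, h'⟩
      have := hmul i j hij (u.val i j) u' hu'U (ih _ hlt hu'U rfl)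
      rwa [hu', ← mul_assoc, elem_mul_elem, add_neg_cancel, show elem i j hij.ne (0 : F) = 1 by
        ext1; simp, one_mul] at this
    · push Not at hex
      have : u = 1 := by
        ext i j
        rcases lt_trichotomy i j with h | h | h
        · rw [hex i j h]; simp [h.ne]
        · subst h; simp [hu.2]
        · rw [mem_borel.1 hu.1 _ _ h]; simp [h.ne']
      rwa [this]

/-- This puts the root subgroups off the superdiagonal into the commutator subgroup of `U`, where
every linear character is trivial. -/
lemma elem_commutator {i k j : Fin n} (hik : i ≠ k) (hkj : k ≠ j) (hij : i ≠ j) (a : F) :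
    elem i k hik a * elem k j hkj 1 = elem i j hij a * (elem k j hkj 1 * elem i k hik a) := by
  ext1
  simp only [Units.val_mul, elem_val, Matrix.transvection]
  simp [add_mul, mul_add, hij.symm, hkj.symm]
  abel

/-- Every linear character of `U` is of the form `lamOf ψ b`. -/
lemma exists_eq_lamOf [Finite F] [IsDomain R] [CharZero R] {ψ : AddChar F R} (hψ : ψ ≠ 1)
    (lam : unitri F n →* Rˣ) : ∃ b : Fin n → F, lam = lamOf ψ b := by
  have hroot : ∀ i : Fin n, ∃ b : F, ∀ (j : Fin n) (hij : (i : ℕ) + 1 = j) (a : F),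
      (lam ⟨elem i j _ a, elem_mem_unitri (lt_of_adjacent hij) a⟩ : R) = ψ (b * a) := by
    intro i
    by_cases hi : (i : ℕ) + 1 < n
    · have hij := lt_of_adjacent (i := i) (j := ⟨i + 1, hi⟩) rfl
      obtain ⟨b, hb⟩ := exists_mulShift_eq hψ
        { toFun := fun a => (lam ⟨elem i ⟨i + 1, hi⟩ _ a, elem_mem_unitri hij a⟩ : R)
          map_zero_eq_one' := by
            rw [show (⟨elem i ⟨i + 1, hi⟩ _ 0, elem_mem_unitri hij 0⟩ : unitri F n) = 1 from
              Subtype.ext (Units.ext (by simp)), map_one, Units.val_one]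
          map_add_eq_mul' := fun a c => by
            rw [← Units.val_mul, ← map_mul]
            congr 2
            exact Subtype.ext (elem_mul_elem _ _ hij.ne a c).symm }
      refine ⟨b, fun j hj a => ?_⟩
      obtain rfl : j = ⟨i + 1, hi⟩ := Fin.ext hj.symm
      exact hb a
    · exact ⟨0, fun j hj => absurd j.2 (by omega)⟩
  choose b hb using hroot
  refine ⟨b, ?_⟩
  have helem : ∀ (i j : Fin n) (h : i < j) (a : F),
      lam ⟨elem i j h.ne a, elem_mem_unitri h a⟩ =
        lamOf ψ b ⟨elem i j h.ne a, elem_mem_unitri h a⟩ := by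
    intro i j h a
    by_cases hij : (i : ℕ) + 1 = j
    · ext
      rw [hb i j hij a, lamOf_val, superdiag_elem, if_pos hij]
    · have h' := Fin.lt_def.1 h
      let k : Fin n := ⟨i + 1, by omega⟩
      have hik : i < k := Fin.lt_def.2 (Nat.lt_succ_self _)
      have hkj : k < j := Fin.lt_def.2 (by simp only [k]; omega)
      have key : ∀ μ : unitri F n →* Rˣ, μ ⟨elem i j _ a, elem_mem_unitri h a⟩ = 1 := by
        intro μ
        have h1 : (⟨elem i k _ a, elem_mem_unitri hik a⟩ : unitri F n) *
            ⟨elem k j _ 1, elem_mem_unitri hkj 1⟩ = ⟨elem i j h.ne a, elem_mem_unitri h a⟩ *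
            (⟨elem k j _ 1, elem_mem_unitri hkj 1⟩ * ⟨elem i k _ a, elem_mem_unitri hik a⟩) :=
          Subtype.ext (elem_commutator hik.ne hkj.ne h.ne a)
        have h2 := congrArg μ h1
        rw [map_mul, map_mul, map_mul, mul_comm (μ ⟨elem k j _ 1, _⟩)] at h2
        exact right_eq_mul.1 h2
      rw [key, key]
  refine MonoidHom.ext fun ⟨u, hu⟩ => ?_
  refine unitri_induction (p := fun u => ∀ hu : u ∈ unitri F n, lam ⟨u, hu⟩ = lamOf ψ b ⟨u, hu⟩)
    ?_ ?_ hu hu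
  · intro h
    rw [show (⟨1, h⟩ : unitri F n) = 1 from rfl, map_one, map_one]
  · intro i j h a u hu ih hu'
    rw [show (⟨elem i j h.ne a * u, hu'⟩ : unitri F n) =
      ⟨elem i j h.ne a, elem_mem_unitri h a⟩ * ⟨u, hu⟩ from rfl, map_mul, map_mul, ih hu, helem i j h a]

lemma nontrivialOnRoot_lamOf [Finite F] {ψ : AddChar F R} (hψ : ψ ≠ 1) {b : Fin n → F} {i j : Fin n}
    (hij : (i : ℕ) + 1 = j) : NontrivialOnRoot (lamOf ψ b) i j ↔ b i ≠ 0 := by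
  have hne := ne_of_adjacent hij
  have helem : ∀ (u : unitri F n) (a : F),
      (u : GLn F n).val = Matrix.transvection i j a → (lamOf ψ b u : R) = ψ (b i * a) := by
    intro u a hu
    have : (u : GLn F n) = elem i j hne a := Units.ext hu
    rw [lamOf_val, this, superdiag_elem, if_pos hij]
  constructor
  · rintro ⟨u, ⟨a, hu⟩, h1⟩ hb
    refine h1 (Units.ext ?_)
    rw [helem u a hu, hb, zero_mul, AddChar.map_zero_eq_one, Units.val_one]
  · intro hb
    obtain ⟨a, ha⟩ := AddChar.ne_one_iff.1 hψ
    refine ⟨⟨elem i j hne ((b i)⁻¹ * a), elem_mem_unitri (lt_of_adjacent hij) _⟩, ⟨_, rfl⟩,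
      fun h => ha ?_⟩
    have h1 := helem ⟨elem i j hne ((b i)⁻¹ * a), elem_mem_unitri (lt_of_adjacent hij) _⟩ _ rfl
    rw [h, mul_inv_cancel_left₀ hb, Units.val_one] at h1
    exact h1.symm

lemma parabolicOf_lamOf [Finite F] {ψ : AddChar F R} (hψ : ψ ≠ 1) (b : Fin n → F) :
    parabolicOf (lamOf ψ b) = parab F (Function.support b) := by
  rw [parab_eq_closure, parabolicOf]
  congr 2
  ext g
  refine exists_congr fun i => exists_congr fun j => and_congr_right fun hij =>
    and_congr_left fun _ => ?_
  rw [nontrivialOnRoot_lamOf hψ hij, Function.mem_support]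

/-- Characters with the same support are conjugate under the diagonal torus. -/
lemma exists_torus_conj {b b' : Fin n → F}
    (h : ∀ i j : Fin n, (i : ℕ) + 1 = j → (b i ≠ 0 ↔ b' i ≠ 0)) :
    ∃ t : GLn F n, (∀ σ, (perm F n σ)⁻¹ * t⁻¹ * perm F n σ ∈ borel F n) ∧
      (∀ u ∈ unitri F n, t⁻¹ * u * t ∈ unitri F n) ∧
      ∀ g : GLn F n, superdiag b (t⁻¹ * g * t) = superdiag b' g := by
  classical
  obtain ⟨d, hd0, hd⟩ : ∃ d : ℕ → F, (∀ i, d i ≠ 0) ∧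
      ∀ i j : Fin n, (i : ℕ) + 1 = j → b i * (d i)⁻¹ * d j = b' i := by
    let r : ℕ → F := fun i => if hi : i < n then
      (if b ⟨i, hi⟩ = 0 ∨ b' ⟨i, hi⟩ = 0 then 1 else b' ⟨i, hi⟩ / b ⟨i, hi⟩) else 1
    have hr0 : ∀ i, r i ≠ 0 := by
      intro i
      simp only [r]
      split_ifs with h1 h2
      · exact one_ne_zero
      · push Not at h2
        exact div_ne_zero h2.2 h2.1
      · exact one_ne_zero
    -- Partial products, so that consecutive diagonal entries of the torus element have quotient `r
    -- i`, that is `b' i / b i` on the common support.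
    refine ⟨fun m => ∏ i ∈ Finset.range m, r i, fun m => Finset.prod_ne_zero_iff.2 fun i _ => hr0 i,
      fun i j hij => ?_⟩
    have hp : (∏ k ∈ Finset.range i, r k) ≠ 0 := Finset.prod_ne_zero_iff.2 fun i _ => hr0 i
    simp only [← hij, Finset.prod_range_succ]
    have : b i * r i = b' i := by
      simp only [r, i.2, dif_pos, Fin.eta]
      by_cases hb : b i = 0
      · have hb' : b' i = 0 := by
          by_contra h'
          exact (h i j hij).2 h' hb
        simp [hb, hb']
      · have hb' := (h i j hij).1 hb
        rw [if_neg (by tauto)]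
        field_simp
    rw [← this]
    field_simp
  let t : GLn F n := mkUpper (Matrix.diagonal fun i => d i)
    (fun i j hij => by simp [hij.ne']) (fun i => by simpa using hd0 i)
  have hti : (t⁻¹).val = Matrix.diagonal fun i : Fin n => (d i)⁻¹ := by
    rw [Matrix.coe_units_inv]
    refine Matrix.inv_eq_left_inv ?_
    simp [t, Matrix.diagonal_mul_diagonal, hd0]
  have hval : ∀ (g : GLn F n) (i j : Fin n),
      (t⁻¹ * g * t).val i j = (d i)⁻¹ * g.val i j * d j := by
    intro g i j
    rw [Units.val_mul, Units.val_mul, hti, mkUpper_val, Matrix.mul_diagonal, Matrix.diagonal_mul]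
  refine ⟨t, fun σ => mem_borel.2 fun i j hij => ?_, fun u hu =>
    ⟨mem_borel.2 fun i j hij => ?_, fun i => ?_⟩, fun g => ?_⟩
  · rw [perm_inv_mul_mul_perm_val, hti]
    exact Matrix.diagonal_apply_ne _ (σ.injective.ne hij.ne')
  · rw [hval, mem_borel.1 hu.1 _ _ hij, mul_zero, zero_mul]
  · rw [hval, hu.2, mul_one, inv_mul_cancel₀ (hd0 i)]
  · refine Finset.sum_congr rfl fun i _ => Finset.sum_congr rfl fun j _ => ?_
    split_ifs with hij
    · rw [hval, ← hd i j hij]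
      ring
    · rfl

end Characters

/-! ### Stabilisers in U of the flags σB -/

section Stabilizers

variable {F : Type*} [Field F] {n : ℕ} {R : Type*} [CommRing R]

lemma borel_diag_ne_zero {g : GLn F n} (hg : g ∈ borel F n) (i : Fin n) : g.val i i ≠ 0 := by
  have h : (g * g⁻¹).val i i = 1 := by simp
  rw [Units.val_mul, Matrix.mul_apply, Finset.sum_eq_single i] at h
  · exact left_ne_zero_of_mul_eq_one h
  · intro j _ hj
    rcases lt_or_gt_of_ne hj with h | h
    · rw [mem_borel.1 hg _ _ h, zero_mul]
    · rw [mem_borel.1 (inv_mem hg) _ _ h, mul_zero]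
  · simp

lemma perm_conj_mem_borel {σ : Equiv.Perm (Fin n)} {u : GLn F n} :
    (perm F n σ)⁻¹ * u * perm F n σ ∈ borel F n ↔ ∀ i j, σ⁻¹ j < σ⁻¹ i → u.val i j = 0 := by
  rw [mem_borel]
  constructor
  · intro h i j hij
    have := h _ _ hij
    simpa [perm_inv_mul_mul_perm_val] using this
  · intro h i j hij
    rw [perm_inv_mul_mul_perm_val]
    exact h _ _ (by simpa using hij)

/-- The pairs `i < j` which are not inverted by `σ⁻¹`. -/
def noninv (σ : Equiv.Perm (Fin n)) : Finset (Fin n × Fin n) :=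
  Finset.univ.filter fun x => x.1 < x.2 ∧ σ⁻¹ x.1 < σ⁻¹ x.2

/-- The group `U ∩ σ B σ⁻¹`. -/
def stabU (F : Type*) [Field F] (σ : Equiv.Perm (Fin n)) : Subgroup (unitri F n) :=
  ((borel F n).comap (MulAut.conj (perm F n σ)⁻¹).toMonoidHom).subgroupOf (unitri F n)

lemma mem_stabU {σ : Equiv.Perm (Fin n)} {u : unitri F n} :
    u ∈ stabU F σ ↔ (perm F n σ)⁻¹ * (u : GLn F n) * perm F n σ ∈ borel F n := by
  simp [stabU, Subgroup.mem_subgroupOf]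

/-- The entries at the pairs kept in order by `σ⁻¹` are free parameters, and all other entries above
the diagonal vanish. -/
lemma card_stabU [Fintype F] (σ : Equiv.Perm (Fin n)) :
    Nat.card (stabU F σ) = Fintype.card F ^ (noninv σ).card := by
  classical
  let e : stabU F σ ≃ (noninv σ → F) :=
    { toFun := fun u x => (u : GLn F n).val x.1.1 x.1.2
      invFun := fun f => ⟨⟨mkUpper (Matrix.of fun i j => if i = j then 1 else
          if h : (i, j) ∈ noninv σ then f ⟨(i, j), h⟩ else 0)
          (fun i j hij => by simp [hij.ne', noninv, hij.not_gt]) (fun i => by simp),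
          mkUpper_mem_borel _ _ _, fun i => by simp⟩, by
        rw [mem_stabU, perm_conj_mem_borel]
        intro i j hij
        have hne : i ≠ j := by rintro rfl; exact lt_irrefl _ hij
        have hni : (i, j) ∉ noninv σ := fun h => (Finset.mem_filter.1 h).2.2.not_gt hij
        simp [hne, hni]⟩
      left_inv := by
        rintro ⟨⟨u, hu⟩, hs⟩
        rw [mem_stabU, perm_conj_mem_borel] at hs
        refine Subtype.ext (Subtype.ext (Units.ext (Matrix.ext fun i j => ?_)))
        simp only [mkUpper_val, Matrix.of_apply]
        split_ifs with h1 h2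
        · subst h1; exact (hu.2 i).symm
        · rfl
        · simp only [noninv, Finset.mem_filter, Finset.mem_univ, true_and, not_and, not_lt] at h2
          rcases lt_or_gt_of_ne h1 with h | h
          · exact (hs i j ((h2 h).lt_of_ne fun he => h1 (σ⁻¹.injective he.symm))).symm
          · exact (mem_borel.1 hu.1 _ _ h).symm
      right_inv := by
        intro f
        ext ⟨⟨i, j⟩, h⟩
        have hne : i ≠ j := by
          have := (Finset.mem_filter.1 h).2.1
          exact this.ne
        simp [hne, h] }
  rw [Nat.card_congr e, Nat.card_fun]
  simp

lemma noninv_rev : noninv (Fin.revPerm : Equiv.Perm (Fin n)) = ∅ := by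
  refine Finset.filter_eq_empty_iff.2 fun x _ => ?_
  rintro ⟨h1, h2⟩
  exact absurd (Fin.rev_lt_rev.1 h2) h1.not_gt

lemma card_unitri [Fintype F] :
    Nat.card (unitri F n) = Fintype.card F ^ (noninv (1 : Equiv.Perm (Fin n))).card := by
  rw [← card_stabU]
  refine Nat.card_congr (Equiv.symm (Equiv.subtypeUnivEquiv fun u => ?_))
  rw [mem_stabU]
  simpa using u.2.1

/-- The permutations `σ` such that `σ⁻¹` inverts all the `(i, i + 1)` with `b i ≠ 0`. -/
def InvertsOn (b : Fin n → F) (σ : Equiv.Perm (Fin n)) : Prop :=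
  ∀ i j : Fin n, (i : ℕ) + 1 = j → b i ≠ 0 → σ⁻¹ j < σ⁻¹ i

lemma invertsOn_rev (b : Fin n → F) : InvertsOn b Fin.revPerm := fun _ _ hij _ =>
  Fin.rev_lt_rev.2 (lt_of_adjacent hij)

lemma lamOf_eq_one_of_mem_stabU {ψ : AddChar F R} {b : Fin n → F} {σ : Equiv.Perm (Fin n)}
    (hσ : InvertsOn b σ) {w : unitri F n} (hw : w ∈ stabU F σ) : lamOf ψ b w = 1 := by
  ext
  rw [lamOf_val, superdiag_eq_zero, AddChar.map_zero_eq_one, Units.val_one]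
  exact fun i j hij hb => perm_conj_mem_borel.1 (mem_stabU.1 hw) _ _ (hσ i j hij hb)

end Stabilizers

/-! ### The Steinberg lattice as functions on G, and the values of E_λ -/

section Functions

open Classical

variable {R : Type*} [CommRing R] {F : Type*} [Field F] [Fintype F] {n : ℕ}

/-- The value at `g` of an element of the Steinberg lattice, viewed as a function on `G`. -/
def val (x : steinbergLattice R F n) (g : GLn F n) : R := (x : R[GLn F n]).coeff g

lemma val_ext {x y : steinbergLattice R F n} (h : ∀ g, val x g = val y g) : x = y :=
  Subtype.ext (MonoidAlgebra.ext (Finsupp.ext h))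

lemma val_add (x y : steinbergLattice R F n) (g : GLn F n) : val (x + y) g = val x g + val y g :=
  rfl

lemma val_sum {ι : Type*} (s : Finset ι) (x : ι → steinbergLattice R F n) (g : GLn F n) :
    val (∑ i ∈ s, x i) g = ∑ i ∈ s, val (x i) g := by
  induction s using Finset.induction_on with
  | empty => rfl
  | insert i s hi ih => rw [Finset.sum_insert hi, Finset.sum_insert hi, val_add, ih]

lemma val_single_smul (h : GLn F n) (r : R) (x : steinbergLattice R F n) (g : GLn F n) :
    val ((MonoidAlgebra.single h r : R[GLn F n]) • x) g = r * val x (h⁻¹ * g) := by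
  simp [val, MonoidAlgebra.coeff_single_mul_apply]

lemma val_mul_borel (x : steinbergLattice R F n) (g : GLn F n) {b : GLn F n}
    (hb : b ∈ borel F n) : val x (g * b) = val x g :=
  coeff_mul_borel x.2 g ⟨b, hb⟩

variable (R F n) in
/-- The generator of the Steinberg lattice. -/
def gen : steinbergLattice R F n := ⟨steinbergElt R F n, Submodule.mem_span_singleton_self _⟩

lemma val_gen (g : GLn F n) : val (gen R F n) g = ∑ σ : Equiv.Perm (Fin n),
    ((Equiv.Perm.sign σ : ℤ) : R) * if (perm F n σ)⁻¹ * g ∈ borel F n then 1 else 0 := by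
  simp only [val, gen, steinbergElt, MonoidAlgebra.coeff_sum, Finset.sum_apply',
    MonoidAlgebra.of_apply]
  refine Finset.sum_congr rfl fun σ _ => ?_
  rw [MonoidAlgebra.coeff_smul_apply, smul_eq_mul, MonoidAlgebra.coeff_single_mul_apply, one_mul]
  congr 1
  rw [MonoidAlgebra.coeff_sum, Finset.sum_apply']
  simp only [MonoidAlgebra.coeff_single, Finsupp.single_apply]
  split_ifs with h
  · rw [Finset.sum_eq_single ⟨_, h⟩]
    · simp
    · intro b _ hb
      rw [if_neg]
      rintro he
      exact hb (Subtype.ext he)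
    · simp
  · refine Finset.sum_eq_zero fun b _ => if_neg ?_
    rintro he
    exact h (he ▸ b.2)

/-- The minimal parabolic subgroup of the reflection `(i, j)` is the disjoint union of q + 1 cosets
of `B`: exactly one of the listed elements lies in `B`. -/
lemma indicator_rank_one {i j : Fin n} (hij : (i : ℕ) + 1 = j) (g : GLn F n) :
    ((if g ∈ borel F n then 1 else 0) + ∑ a : F,
      if g * (elem i j (ne_of_adjacent hij) a * perm F n (Equiv.swap i j)) ∈ borel F n then 1
        else 0 : R) = if g ∈ parab F {i} then 1 else 0 := by
  have hne := ne_of_adjacent hij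
  have hs : perm F n (Equiv.swap i j) ∈ parab F ({i} : Set (Fin n)) :=
    (perm_swap_mem_parab hij).2 rfl
  have hes : ∀ a, elem i j hne a * perm F n (Equiv.swap i j) ∈ parab F ({i} : Set (Fin n)) :=
    fun a => mul_mem (borel_le_parab _ (unitri_le_borel (elem_mem_unitri (lt_of_adjacent hij) a))) hs
  -- Inside this parabolic subgroup, membership in `B` is decided by the one entry `(j, i)`. For the
  -- translates by `a` it is an affine function of `a`.
  have hQ : ∀ {h : GLn F n}, h ∈ parab F ({i} : Set (Fin n)) →
      (h ∈ borel F n ↔ h.val j i = 0) := by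
    intro h hh
    refine ⟨fun hb => mem_borel.1 hb _ _ (lt_of_adjacent hij), fun h0 => mem_borel.2 ?_⟩
    intro k l hkl
    by_cases hkl' : blkOf {i} l < blkOf {i} k
    · exact mem_blockUpper.1 hh _ _ hkl'
    · have heq : ∀ m : Fin n, l ≤ m → m < k → m = i := by
        intro m hlm hmk
        by_contra hmi
        refine hkl' (Finset.card_lt_card (Finset.ssubset_iff_of_subset ?_ |>.2 ⟨m, ?_, ?_⟩))
        · intro x
          simp only [Finset.mem_filter, Finset.mem_univ, true_and]
          exact fun h => ⟨h.1.trans hkl, h.2⟩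
        · simp [hmk, hmi]
        · simp [hlm]
      have hl := heq l le_rfl hkl
      have hk : k = j := by
        by_contra hkj
        have hjk : j < k := by
          rw [Fin.lt_def, hl] at hkl
          rw [Fin.lt_def]
          have : (k : ℕ) ≠ j := fun h => hkj (Fin.ext h)
          omega
        exact hne (heq j (by rw [hl]; exact (lt_of_adjacent hij).le) hjk).symm
      rw [hk, hl, h0]
  by_cases hg : g ∈ parab F ({i} : Set (Fin n))
  · rw [if_pos hg]
    have hval : ∀ a, (g * (elem i j hne a * perm F n (Equiv.swap i j))).val j i =
        g.val j j + a * g.val j i := by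
      intro a
      rw [← mul_assoc, mul_perm_val, Equiv.swap_apply_left, mul_elem_val, if_pos rfl]
    simp only [hQ hg, hQ (mul_mem hg (hes _)), hval]
    by_cases h0 : g.val j i = 0
    · have := borel_diag_ne_zero ((hQ hg).2 h0) j
      simp [h0, this]
    · rw [if_neg h0, zero_add, Finset.sum_eq_single (-(g.val j j) / g.val j i)]
      · rw [if_pos]
        field_simp
        ring
      · intro a _ ha
        refine if_neg fun h => ha ?_
        rw [eq_div_iff h0]
        linear_combination h
      · simp
  · rw [if_neg hg, if_neg fun h => hg (borel_le_parab _ h), zero_add]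
    refine Finset.sum_eq_zero fun a _ => if_neg fun h => hg ?_
    exact (Subgroup.mul_mem_cancel_right _ (hes a)).1 (borel_le_parab _ h)

/-- Summation replaces `B` by the minimal parabolic subgroup `Q`. Then `σ` and `σ * swap i j` give
the same coset of `Q` with opposite signs, so the terms cancel in pairs. -/
lemma val_gen_rank_one {i j : Fin n} (hij : (i : ℕ) + 1 = j) (g : GLn F n) :
    val (gen R F n) g + ∑ a : F,
      val (gen R F n) (g * (elem i j (ne_of_adjacent hij) a * perm F n (Equiv.swap i j))) = 0 := by
  simp only [val_gen]
  rw [Finset.sum_comm, ← Finset.sum_add_distrib]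
  simp only [← Finset.mul_sum, ← mul_add, ← mul_assoc (perm F n _)⁻¹ g]
  simp only [indicator_rank_one hij]
  refine Finset.sum_involution (fun σ _ => σ * Equiv.swap i j) ?_ ?_ (fun _ _ => Finset.mem_univ _)
    ?_
  · intro σ _
    have : (perm F n (σ * Equiv.swap i j))⁻¹ * g ∈ parab F ({i} : Set (Fin n)) ↔
        (perm F n σ)⁻¹ * g ∈ parab F ({i} : Set (Fin n)) := by
      rw [map_mul, mul_inv_rev, mul_assoc]
      exact Subgroup.mul_mem_cancel_left _ (inv_mem ((perm_swap_mem_parab hij).2 rfl))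
    simp only [this, Equiv.Perm.sign_mul, Equiv.Perm.sign_swap (ne_of_adjacent hij)]
    push_cast
    split_ifs <;> simp
  · intro σ _ _ h
    rw [mul_eq_left, Equiv.swap_eq_one_iff] at h
    exact ne_of_adjacent hij h
  · intro σ _
    rw [mul_assoc, Equiv.swap_mul_self, mul_one]

/-- The functions in the Steinberg lattice sum to zero over the flags which differ from a given
flag in one position only. -/
lemma val_rank_one {i j : Fin n} (hij : (i : ℕ) + 1 = j) (x : steinbergLattice R F n)
    (g : GLn F n) : val x g = - ∑ a : F,
      val x (g * (elem i j (ne_of_adjacent hij) a * perm F n (Equiv.swap i j))) := by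
  rw [eq_neg_iff_add_eq_zero]
  -- Right multiplication by `Y` forms the sum in question. It annihilates the generator, hence the
  -- whole left ideal.
  let Y : R[GLn F n] := 1 + ∑ a : F,
    MonoidAlgebra.single (elem i j (ne_of_adjacent hij) a * perm F n (Equiv.swap i j))⁻¹ 1
  have hY : ∀ (z : R[GLn F n]) (g : GLn F n), (z * Y).coeff g = z.coeff g + ∑ a : F,
      z.coeff (g * (elem i j (ne_of_adjacent hij) a * perm F n (Equiv.swap i j))) := by
    intro z g
    simp only [Y, mul_add, mul_one, Finset.mul_sum, MonoidAlgebra.coeff_add,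
      MonoidAlgebra.coeff_sum, Finsupp.add_apply, Finset.sum_apply',
      MonoidAlgebra.coeff_mul_single_apply, inv_inv, mul_one]
  obtain ⟨a, ha⟩ := Submodule.mem_span_singleton.1 x.2
  have hgen : steinbergElt R F n * Y = 0 := by
    ext g
    rw [hY]
    exact val_gen_rank_one hij g
  have h2 : (x : R[GLn F n]) * Y = 0 := by
    rw [← ha, smul_eq_mul, mul_assoc, hgen, mul_zero]
  have h3 := hY (x : R[GLn F n]) g
  rw [h2] at h3
  exact h3.symm

lemma val_perm_rank_one {i j : Fin n} (hij : (i : ℕ) + 1 = j) (x : steinbergLattice R F n)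
    (σ : Equiv.Perm (Fin n)) (u : GLn F n) : val x (u * perm F n σ) = - ∑ a : F,
      val x (u * elem (σ i) (σ j) (σ.injective.ne (ne_of_adjacent hij)) a *
        perm F n (σ * Equiv.swap i j)) := by
  rw [val_rank_one hij]
  congr 1
  refine Finset.sum_congr rfl fun a _ => ?_
  rw [map_mul, mul_assoc u, ← mul_assoc (perm F n σ), mul_elem_perm, mul_assoc u, mul_assoc]

/-- An element of the Steinberg lattice is determined by its values on the big cell. -/
lemma eq_of_val_big_cell {x y : steinbergLattice R F n}
    (h : ∀ u ∈ unitri F n, val x (u * perm F n Fin.revPerm) = val y (u * perm F n Fin.revPerm)) :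
    x = y := by
  have key : ∀ (σ : Equiv.Perm (Fin n)), ∀ u ∈ unitri F n,
      val x (u * perm F n σ) = val y (u * perm F n σ) := by
    intro σ
    induction σ using perm_ascent_induction with
    | h0 => exact h
    | h σ i j hij hlt ih =>
      intro u hu
      rw [val_perm_rank_one hij, val_perm_rank_one hij]
      congr 1
      exact Finset.sum_congr rfl fun a _ => ih _ (mul_mem hu (elem_mem_unitri hlt a))
  refine val_ext fun g => ?_
  obtain ⟨u, hu, σ, b, hb, rfl⟩ := exists_bruhat g
  rw [val_mul_borel _ _ hb, val_mul_borel _ _ hb, key σ u hu]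

lemma val_gen_cell {u : GLn F n} (hu : u ∈ unitri F n) (σ : Equiv.Perm (Fin n)) :
    val (gen R F n) (u * perm F n σ) = ((Equiv.Perm.sign σ : ℤ) : R) *
      if (perm F n σ)⁻¹ * u * perm F n σ ∈ borel F n then 1 else 0 := by
  rw [val_gen, Finset.sum_eq_single σ, mul_assoc]
  · intro τ _ hτ
    rw [if_neg, mul_zero]
    rw [← mul_assoc]
    exact fun h => hτ (eq_of_perm_inv_mul_mul_perm_mem_borel hu h).symm
  · simp

lemma val_charElt (lam : unitri F n →* Rˣ) (g : GLn F n) :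
    val (charElt lam) g = ∑ u : unitri F n, (lam u : R) * val (gen R F n) ((u : GLn F n)⁻¹ * g) := by
  rw [charElt, val_sum]
  exact Finset.sum_congr rfl fun u _ => val_single_smul _ _ _ _

/-- After the substitution of `u * w⁻¹` for the summation variable, only those `w` contribute that
fix the flag `σB`. What remains is a character sum over the stabiliser, which is either its order or
zero. -/
lemma val_charElt_cell (lam : unitri F n →* Rˣ) (u : unitri F n) (σ : Equiv.Perm (Fin n)) :
    val (charElt lam) ((u : GLn F n) * perm F n σ) = ((Equiv.Perm.sign σ : ℤ) : R) * (lam u : R) *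
      ∑ w : stabU F σ, (((lam w)⁻¹ : Rˣ) : R) := by
  rw [val_charElt, ← Equiv.sum_comp ((Equiv.inv (unitri F n)).trans (Equiv.mulLeft u)),
    Finset.mul_sum]
  have h1 : ∀ w : unitri F n, val (gen R F n) ((((u * w⁻¹ : unitri F n)) : GLn F n)⁻¹ *
      ((u : GLn F n) * perm F n σ)) =
      if w ∈ stabU F σ then ((Equiv.Perm.sign σ : ℤ) : R) else 0 := by
    intro w
    have : (((u * w⁻¹ : unitri F n)) : GLn F n)⁻¹ * ((u : GLn F n) * perm F n σ) =
        (w : GLn F n) * perm F n σ := by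
      simp
    rw [this, val_gen_cell w.2]
    simp [mem_stabU]
  have h2 : ∀ w : unitri F n, (lam (((Equiv.inv (unitri F n)).trans (Equiv.mulLeft u)) w) : R) *
      val (gen R F n) (((((Equiv.inv (unitri F n)).trans (Equiv.mulLeft u)) w : unitri F n) :
        GLn F n)⁻¹ * ((u : GLn F n) * perm F n σ)) = if w ∈ stabU F σ then
        ((Equiv.Perm.sign σ : ℤ) : R) * (lam u : R) * (((lam w)⁻¹ : Rˣ) : R) else 0 := by
    intro w
    have := h1 w
    simp only [Equiv.trans_apply, Equiv.inv_apply, Equiv.coe_mulLeft] at this ⊢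
    rw [this, map_mul, map_inv]
    split_ifs
    · push_cast; ring
    · simp
  rw [Finset.sum_congr rfl fun w _ => h2 w, ← Finset.sum_filter]
  exact (Finset.sum_subtype _ (by simp) _)

lemma val_charElt_of_invertsOn {ψ : AddChar F R} {b : Fin n → F} {σ : Equiv.Perm (Fin n)}
    (hσ : InvertsOn b σ) (u : unitri F n) :
    val (charElt (lamOf ψ b)) ((u : GLn F n) * perm F n σ) =
      ((Equiv.Perm.sign σ : ℤ) : R) * (lamOf ψ b u : R) * (Fintype.card F : R) ^ (noninv σ).card := by
  rw [val_charElt_cell, Finset.sum_congr rfl fun w _ => by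
    rw [lamOf_eq_one_of_mem_stabU hσ w.2, inv_one, Units.val_one], Finset.sum_const,
    Finset.card_univ, ← Nat.card_eq_fintype_card, card_stabU]
  simp

lemma val_charElt_of_not_invertsOn [IsDomain R] {ψ : AddChar F R} (hψ : ψ ≠ 1) {b : Fin n → F}
    {σ : Equiv.Perm (Fin n)} (hσ : ¬ InvertsOn b σ) (u : unitri F n) :
    val (charElt (lamOf ψ b)) ((u : GLn F n) * perm F n σ) = 0 := by
  rw [val_charElt_cell]
  simp only [InvertsOn, not_forall, not_lt] at hσ
  obtain ⟨i, j, hij, hb, hle⟩ := hσ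
  have hne := ne_of_adjacent hij
  obtain ⟨v, ⟨a, hv⟩, hv1⟩ := (nontrivialOnRoot_lamOf hψ hij).2 hb
  have hv' : (v : GLn F n) = elem i j hne a := Units.ext hv
  have hvs : v ∈ stabU F σ := by
    rw [mem_stabU, perm_conj_mem_borel, hv']
    intro k l hkl
    rw [elem_val, transvection_apply, if_neg (by rintro rfl; exact lt_irrefl _ hkl), if_neg, add_zero]
    rintro ⟨rfl, rfl⟩
    exact hkl.not_ge hle
  suffices h : ∑ w : stabU F σ, (((lamOf ψ b w)⁻¹ : Rˣ) : R) = 0 by rw [h, mul_zero]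
  -- The root element `v` lies in the stabiliser and has a non-trivial character value. Translation
  -- by `v` multiplies the sum by this value, so the sum vanishes in the domain `R`.
  have h1 : (((lamOf ψ b v)⁻¹ : Rˣ) : R) * ∑ w : stabU F σ, (((lamOf ψ b w)⁻¹ : Rˣ) : R) =
      ∑ w : stabU F σ, (((lamOf ψ b w)⁻¹ : Rˣ) : R) := by
    conv_rhs => rw [← Equiv.sum_comp (Equiv.mulLeft (⟨v, hvs⟩ : stabU F σ))]
    rw [Finset.mul_sum]
    refine Finset.sum_congr rfl fun w _ => ?_
    simp [mul_comm]
  have h2 : (((lamOf ψ b v)⁻¹ : Rˣ) : R) ≠ 1 := by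
    intro h
    rw [Units.val_eq_one, inv_eq_one] at h
    exact hv1 h
  by_contra hne0
  exact h2 (mul_right_cancel₀ hne0 (h1.trans (one_mul _).symm))

lemma val_charElt_big_cell (ψ : AddChar F R) (b : Fin n → F) (u : unitri F n) :
    val (charElt (lamOf ψ b)) ((u : GLn F n) * perm F n Fin.revPerm) =
      ((Equiv.Perm.sign (Fin.revPerm : Equiv.Perm (Fin n)) : ℤ) : R) * (lamOf ψ b u : R) := by
  rw [val_charElt_of_invertsOn (invertsOn_rev b), noninv_rev]
  simp

end Functions

/-! ### Permutations transporting one block structure into another -/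

section BlockSort

variable {F : Type*} [Field F] {n : ℕ}

/-- A permutation which reverses the order inside each of the blocks attached to `J`. -/
lemma exists_block_reversal (J : Set (Fin n)) : ∃ σ : Equiv.Perm (Fin n), ∀ i j,
    σ⁻¹ i < σ⁻¹ j ↔ blkOf J i < blkOf J j ∨ (blkOf J i = blkOf J j ∧ j < i) := by
  -- Sorting by block number first and by decreasing index second.
  let key : Fin n → ℕ ×ₗ (Fin n)ᵒᵈ := fun i => toLex (blkOf J i, OrderDual.toDual i)
  have hinj : Function.Injective key := fun i j h => by
    have h1 : blkOf J i = blkOf J j ∧ i = j := by simpa [key] using h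
    exact h1.2
  have hmono : StrictMono (key ∘ Tuple.sort key) :=
    (Tuple.monotone_sort key).strictMono_of_injective (hinj.comp (Tuple.sort key).injective)
  refine ⟨Tuple.sort key, fun i j => ?_⟩
  rw [← hmono.lt_iff_lt]
  simp [key, Prod.Lex.toLex_lt_toLex]

/-- The block diagonal part of an upper unitriangular matrix. -/
lemma exists_block_factor (J : Set (Fin n)) {u : GLn F n} (hu : u ∈ unitri F n) :
    ∃ m ∈ unitri F n, (∀ i j, blkOf J i = blkOf J j → m.val i j = u.val i j) ∧
      (∀ i j, blkOf J i ≠ blkOf J j → m.val i j = 0) ∧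
      ∀ i j, blkOf J i = blkOf J j → i < j → (m⁻¹ * u).val i j = 0 := by
  classical
  let m : GLn F n := mkUpper (Matrix.of fun i j => if blkOf J i = blkOf J j then u.val i j else 0)
    (fun i j hij => by simp [mem_borel.1 hu.1 _ _ hij]) (fun i => by simp [hu.2])
  have hm : m ∈ unitri F n := ⟨mkUpper_mem_borel _ _ _, fun i => by simp [m, hu.2]⟩
  refine ⟨m, hm, fun i j h => by simp [m, h], fun i j h => by simp [m, h], fun i j h hij => ?_⟩
  -- In the product for entry `(i, j)` only indices between `i` and `j` matter. They lie in the same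
  -- block, where `u` and `m` agree, so `u` may be replaced by `m`.
  have h0 : (m⁻¹ * m).val i j = 0 := by simp [hij.ne]
  rw [← h0, Units.val_mul, Units.val_mul, Matrix.mul_apply, Matrix.mul_apply]
  refine Finset.sum_congr rfl fun k _ => ?_
  rcases lt_or_ge k i with hk | hk
  · rw [mem_borel.1 (inv_mem hm.1) _ _ hk, zero_mul, zero_mul]
  rcases lt_or_ge j k with hk' | hk'
  · rw [mem_borel.1 hu.1 _ _ hk', mem_borel.1 hm.1 _ _ hk']
  · have h1 := blkOf_mono J hk
    have h2 := blkOf_mono J hk'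
    have : blkOf J k = blkOf J j := by omega
    simp [m, this]

/-- The permutation `h` carries the blocks of `J'` to intervals inside the blocks of `J`, and
reverses the order of the images inside a block of `J`. -/
structure IsTransport (J J' : Set (Fin n)) (h : Equiv.Perm (Fin n)) : Prop where
  map_adjacent : ∀ i j : Fin n, (i : ℕ) + 1 = j → i ∈ J' → (h i : ℕ) + 1 = h j ∧ h i ∈ J
  adjacent_or_lt : ∀ i j : Fin n, (h i : ℕ) + 1 = h j → h i ∈ J →
    ((i : ℕ) + 1 = j ∧ i ∈ J') ∨ j < i

lemma lt_of_blkOf_eq {α : Type*} [LinearOrder α] {J : Set (Fin n)} {f : Fin n → α}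
    (hf : ∀ i j : Fin n, (i : ℕ) + 1 = j → i ∈ J → f i < f j) {i j : Fin n} (hij : i < j)
    (hb : blkOf J i = blkOf J j) : f i < f j := by
  refine (rel_of_lt_of_adjacent
    (r := fun i j => blkOf J i ≤ blkOf J j ∧ (blkOf J i = blkOf J j → f i < f j))
    ?_ ?_ hij).2 hb
  · rintro i j k ⟨h1, h2⟩ ⟨h3, h4⟩
    exact ⟨h1.trans h3, fun he => (h2 (by omega)).trans (h4 (by omega))⟩
  · intro i j hij
    exact ⟨blkOf_mono _ (lt_of_adjacent hij).le, fun he => hf i j hij ((blkOf_eq_iff J hij).1 he)⟩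

lemma IsTransport.lt {J J' : Set (Fin n)} {h : Equiv.Perm (Fin n)} (H : IsTransport J J' h)
    {i j : Fin n} (hij : i < j) (hb : blkOf J' i = blkOf J' j) : h i < h j :=
  lt_of_blkOf_eq (fun i j hij hi => lt_of_adjacent (H.map_adjacent i j hij hi).1) hij hb

open Classical in
/-- The indicator function of `J` with values in `F`. -/
def indic (F : Type*) [Field F] (J : Set (Fin n)) (i : Fin n) : F := if i ∈ J then 1 else 0

lemma indic_ne_zero_iff {J : Set (Fin n)} {i : Fin n} : indic F J i ≠ 0 ↔ i ∈ J := by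
  classical
  simp [indic]

lemma support_indic (J : Set (Fin n)) : Function.support (indic F J) = J := by
  ext i
  rw [Function.mem_support, indic_ne_zero_iff]

/-- Conjugating the block part `m` of `u` by `h` turns the character of `J` into that of `J'`: a
position on the superdiagonal inside a block of `J` comes either from such a position for `J'` or
from an entry of `m` below the diagonal, which is zero. -/
lemma IsTransport.superdiag_eq {J J' : Set (Fin n)} {h : Equiv.Perm (Fin n)}
    (H : IsTransport J J' h) {u m w : GLn F n} (hm : m ∈ unitri F n)
    (hmu : ∀ i j, blkOf J' i = blkOf J' j → m.val i j = u.val i j)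
    (hw : ∀ i j, w.val (h i) (h j) = m.val i j) :
    superdiag (indic F J) w = superdiag (indic F J') u := by
  classical
  unfold superdiag
  rw [← Equiv.sum_comp h]
  refine Finset.sum_congr rfl fun i _ => ?_
  rw [← Equiv.sum_comp h]
  refine Finset.sum_congr rfl fun j _ => ?_
  rw [hw]
  by_cases h1 : (h i : ℕ) + 1 = h j ∧ h i ∈ J
  · rw [if_pos h1.1]
    rcases H.adjacent_or_lt i j h1.1 h1.2 with h2 | h2
    · rw [if_pos h2.1, hmu i j ((blkOf_eq_iff J' h2.1).2 h2.2)]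
      simp [indic, h1.2, h2.2]
    · rw [mem_borel.1 hm.1 _ _ h2, mul_zero, if_neg]
      intro h3
      exact absurd (lt_of_adjacent h3) h2.not_gt
  · have h2 : (if (h i : ℕ) + 1 = h j then indic F J (h i) * m.val i j else 0) = 0 := by
      split_ifs with h3
      · have : h i ∉ J := fun h4 => h1 ⟨h3, h4⟩
        simp [indic, this]
      · rfl
    rw [h2]
    split_ifs with h3
    · have : i ∉ J' := fun h4 => h1 (H.map_adjacent i j h3 h4)
      simp [indic, this]
    · rfl

/-- Two neighbours in a block of `J` come either from neighbours in a block of `J'`, which `σ`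
reverses, or from indices in the wrong order. The latter lie in different blocks of `J'`, as `h`
increases on each block, and `σ` keeps the order of the blocks. -/
lemma IsTransport.invertsOn {J J' : Set (Fin n)} {h : Equiv.Perm (Fin n)}
    (H : IsTransport J J' h) {σ : Equiv.Perm (Fin n)}
    (hσ : ∀ i j, σ⁻¹ i < σ⁻¹ j ↔
      blkOf J' i < blkOf J' j ∨ (blkOf J' i = blkOf J' j ∧ j < i)) :
    InvertsOn (indic F J) (h * σ) := by
  intro i j hij hb
  obtain ⟨i, rfl⟩ := h.surjective i
  obtain ⟨j, rfl⟩ := h.surjective j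
  rw [indic_ne_zero_iff] at hb
  suffices h : σ⁻¹ j < σ⁻¹ i by simpa using h
  rw [hσ]
  rcases H.adjacent_or_lt i j hij hb with h1 | h1
  · exact Or.inr ⟨((blkOf_eq_iff J' h1.1).2 h1.2).symm, lt_of_adjacent h1.1⟩
  · rcases (blkOf_mono J' h1.le).lt_or_eq with h2 | h2
    · exact Or.inl h2
    · exact absurd (H.lt h1 h2) (lt_of_adjacent hij).not_gt

end BlockSort

/-! ### Multiplicity one of linear characters, and transport of the vectors E_λ -/

section Projections

open Classical

variable {R : Type*} [CommRing R] {F : Type*} [Field F] [Fintype F] {n : ℕ}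

/-- The element `∑ λ(u) u` of the group algebra. -/
def projElt (lam : unitri F n →* Rˣ) : R[GLn F n] :=
  ∑ u : unitri F n, MonoidAlgebra.single (u : GLn F n) (lam u : R)

lemma charElt_eq (lam : unitri F n →* Rˣ) : charElt lam = projElt lam • gen R F n := by
  rw [projElt, Finset.sum_smul]
  rfl

lemma single_mul_projElt (lam : unitri F n →* Rˣ) (v : unitri F n) :
    MonoidAlgebra.single (v : GLn F n) (lam v : R) * projElt lam = projElt lam := by
  rw [projElt, Finset.mul_sum]
  conv_rhs => rw [← Equiv.sum_comp (Equiv.mulLeft v)]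
  exact Finset.sum_congr rfl fun u _ => by simp [MonoidAlgebra.single_mul_single]

lemma projElt_mul_projElt (lam : unitri F n →* Rˣ) : projElt lam * projElt lam =
    MonoidAlgebra.single 1 (Nat.card (unitri F n) : R) * projElt lam := by
  conv_lhs => enter [1]; rw [projElt]
  rw [Finset.sum_mul, Finset.sum_congr rfl fun v _ => single_mul_projElt lam v, Finset.sum_const,
    Finset.card_univ, ← Nat.card_eq_fintype_card, ← MonoidAlgebra.natCast_def, nsmul_eq_mul]

lemma projElt_smul_charElt (lam : unitri F n →* Rˣ) : projElt lam • charElt lam =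
    (MonoidAlgebra.single 1 (Nat.card (unitri F n) : R) : R[GLn F n]) • charElt lam := by
  rw [charElt_eq, ← mul_smul, projElt_mul_projElt, mul_smul]

/-- The twisted sums of the values of `x` over a Bruhat cell. -/
def cellSum (lam : unitri F n →* Rˣ) (σ : Equiv.Perm (Fin n)) (x : steinbergLattice R F n) : R :=
  ∑ u : unitri F n, (((lam u)⁻¹ : Rˣ) : R) * val x ((u : GLn F n) * perm F n σ)

/-- The rank-one relation expresses the values on the cell of `σ` by those on the cell of `σ * swap
i j`. The root subgroup at `(σ i, σ j)` over which it sums lies in the kernel of λ, since `σ⁻¹`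
inverts every simple root on which λ is non-trivial. Each of its q elements thus contributes the
same sum. -/
lemma cellSum_swap {ψ : AddChar F R} {b : Fin n → F} {σ : Equiv.Perm (Fin n)}
    (hσ : InvertsOn b σ) {i j : Fin n} (hij : (i : ℕ) + 1 = j) (hlt : σ i < σ j)
    (x : steinbergLattice R F n) : cellSum (lamOf ψ b) σ x =
      -(Fintype.card F : R) * cellSum (lamOf ψ b) (σ * Equiv.swap i j) x := by
  unfold cellSum
  have htriv : ∀ a, superdiag b (elem (σ i) (σ j) hlt.ne a) = 0 := by
    intro a
    rw [superdiag_elem]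
    split_ifs with h
    · by_contra hne
      have := hσ _ _ h (left_ne_zero_of_mul hne)
      exact absurd (by simpa using this) (lt_of_adjacent hij).not_gt
    · rfl
  simp only [val_perm_rank_one hij x σ, mul_neg, Finset.mul_sum, Finset.sum_neg_distrib, neg_mul]
  rw [Finset.sum_comm]
  congr 1
  have key : ∀ a : F, ∑ u : unitri F n, (((lamOf ψ b u)⁻¹ : Rˣ) : R) *
      val x ((u : GLn F n) * elem (σ i) (σ j) hlt.ne a * perm F n (σ * Equiv.swap i j)) =
      ∑ u : unitri F n, (((lamOf ψ b u)⁻¹ : Rˣ) : R) *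
        val x ((u : GLn F n) * perm F n (σ * Equiv.swap i j)) := by
    intro a
    let v : unitri F n := ⟨elem (σ i) (σ j) hlt.ne a, elem_mem_unitri hlt a⟩
    have hv : lamOf ψ b v = 1 := by
      ext
      rw [lamOf_val, htriv, AddChar.map_zero_eq_one, Units.val_one]
    conv_rhs => rw [← Equiv.sum_comp (Equiv.mulRight v)]
    refine Finset.sum_congr rfl fun u _ => ?_
    have h1 : lamOf ψ b (u * v) = lamOf ψ b u := by rw [map_mul, hv, mul_one]
    simp only [Equiv.coe_mulRight, h1]
    rfl
  rw [Finset.sum_congr rfl fun a _ => key a, Finset.sum_const, Finset.card_univ, nsmul_eq_mul,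
    Finset.mul_sum]

lemma exists_cellSum_eq {ψ : AddChar F R} {b : Fin n → F} {σ : Equiv.Perm (Fin n)}
    (hσ : InvertsOn b σ) : ∃ m : ℕ, ∀ x : steinbergLattice R F n, cellSum (lamOf ψ b) σ x =
      (-(Fintype.card F : R)) ^ m * cellSum (lamOf ψ b) Fin.revPerm x := by
  induction σ using perm_ascent_induction with
  | h0 => exact ⟨0, fun x => by simp⟩
  | h σ i j hij hlt ih =>
    obtain ⟨m, hm⟩ := ih (by
      intro k l hkl hb
      have h1 := hσ k l hkl hb
      rw [mul_inv_rev, Equiv.swap_inv, Equiv.Perm.mul_apply, Equiv.Perm.mul_apply]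
      -- Only the pair `(i, j)` itself could have its order changed by an adjacent transposition,
      -- and that pair is an ascent of `σ`.
      have h2 : ¬ (σ⁻¹ l = i ∧ σ⁻¹ k = j) := by
        rintro ⟨rfl, rfl⟩
        exact absurd (by simpa using hlt) (lt_of_adjacent hkl).not_gt
      have h3 : σ⁻¹ l ≠ σ⁻¹ k := h1.ne
      revert h1 h2 h3
      generalize σ⁻¹ l = l'
      generalize σ⁻¹ k = k'
      intro h1 h2 h3
      simp only [Equiv.swap_apply_def]
      rw [Fin.lt_def] at h1 ⊢
      simp only [Fin.ext_iff] at h2 h3 ⊢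
      split_ifs <;> omega)
    exact ⟨m + 1, fun x => by rw [cellSum_swap hσ hij hlt, hm, pow_succ]; ring⟩

/-- Both sides are multiples of λ on the big cell, which determines them. The sign compensates the
sign in the value of E_λ there. -/
lemma projElt_smul (ψ : AddChar F R) (b : Fin n → F) (x : steinbergLattice R F n) :
    projElt (lamOf ψ b) • x = (MonoidAlgebra.single 1
      (((Equiv.Perm.sign (Fin.revPerm : Equiv.Perm (Fin n)) : ℤ) : R) *
        cellSum (lamOf ψ b) Fin.revPerm x) : R[GLn F n]) • charElt (lamOf ψ b) := by
  refine eq_of_val_big_cell fun u hu => ?_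
  have h1 := val_charElt_big_cell ψ b ⟨u, hu⟩
  simp only at h1
  rw [val_single_smul, inv_one, one_mul, h1, projElt, Finset.sum_smul, val_sum]
  simp only [val_single_smul]
  rw [← Equiv.sum_comp ((Equiv.inv (unitri F n)).trans (Equiv.mulLeft ⟨u, hu⟩)), cellSum,
    Finset.mul_sum, Finset.sum_mul]
  refine Finset.sum_congr rfl fun w _ => ?_
  have h2 : (((((Equiv.inv (unitri F n)).trans (Equiv.mulLeft ⟨u, hu⟩)) w : unitri F n) :
      GLn F n)⁻¹ * (u * perm F n Fin.revPerm)) = (w : GLn F n) * perm F n Fin.revPerm := by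
    simp
  have h3 : ((Equiv.Perm.sign (Fin.revPerm : Equiv.Perm (Fin n)) : ℤ) : R) *
      ((Equiv.Perm.sign (Fin.revPerm : Equiv.Perm (Fin n)) : ℤ) : R) = 1 := by
    rw [← Int.cast_mul, ← Units.val_mul, Int.units_mul_self]
    simp
  rw [h2]
  simp only [Equiv.trans_apply, Equiv.inv_apply, Equiv.coe_mulLeft, map_mul, map_inv, Units.val_mul]
  linear_combination (-(lamOf ψ b ⟨u, hu⟩ : R) * (((lamOf ψ b w)⁻¹ : Rˣ) : R) *
    val x ((w : GLn F n) * perm F n Fin.revPerm)) * h3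

lemma exists_projElt_smul (ψ : AddChar F R) (b : Fin n → F) (x : steinbergLattice R F n) :
    ∃ s : R, projElt (lamOf ψ b) • x =
      (MonoidAlgebra.single 1 s : R[GLn F n]) • charElt (lamOf ψ b) := ⟨_, projElt_smul ψ b x⟩

lemma single_one_smul_charElt_injective [IsDomain R] {ψ : AddChar F R} {b : Fin n → F} {r s : R}
    (h : (MonoidAlgebra.single 1 r : R[GLn F n]) • charElt (lamOf ψ b) =
      (MonoidAlgebra.single 1 s : R[GLn F n]) • charElt (lamOf ψ b)) : r = s := by
  have h1 := congrArg (fun x => val x (((1 : unitri F n) : GLn F n) * perm F n Fin.revPerm)) h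
  simp only [val_single_smul, inv_one, one_mul] at h1
  rw [val_charElt_big_cell, map_one, Units.val_one, mul_one] at h1
  refine mul_right_cancel₀ ?_ h1
  rcases Int.units_eq_one_or (Equiv.Perm.sign (Fin.revPerm : Equiv.Perm (Fin n))) with h | h <;>
    simp [h]

/-- If `h` transports `J'` into `J`, then `E_{J'}` lies in the submodule generated by `E_J`. -/
theorem IsTransport.exists_charElt_eq (hq : IsUnit (Fintype.card F : R)) (ψ : AddChar F R)
    {J J' : Set (Fin n)} {h : Equiv.Perm (Fin n)} (H : IsTransport J J' h) :
    ∃ a : R[GLn F n],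
      charElt (lamOf ψ (indic F J')) = a • charElt (lamOf ψ (indic F J)) := by
  obtain ⟨σ, hσ⟩ := exists_block_reversal J'
  have hσ' : InvertsOn (indic F J') σ := by
    intro i j hij hb
    rw [hσ]
    exact Or.inr ⟨((blkOf_eq_iff J' hij).2 (indic_ne_zero_iff.1 hb)).symm, lt_of_adjacent hij⟩
  have hhσ := H.invertsOn (F := F) hσ
  -- The translate of E_J by `h⁻¹` agrees, on the cell of `σ`, with a unit multiple of the character
  -- of `J'`. Its component at that character is therefore a unit multiple of E_{J'}.
  set x : steinbergLattice R F n :=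
    (MonoidAlgebra.single (perm F n h)⁻¹ 1 : R[GLn F n]) • charElt (lamOf ψ (indic F J)) with hx
  set C : R := ((Equiv.Perm.sign (h * σ) : ℤ) : R) * (Fintype.card F : R) ^ (noninv (h * σ)).card
    with hC
  have hval : ∀ u : unitri F n, val x ((u : GLn F n) * perm F n σ) =
      (lamOf ψ (indic F J') u : R) * C := by
    intro u
    obtain ⟨m, hm, hmu, hm0, hmv⟩ := exists_block_factor J' u.2
    set v := m⁻¹ * (u : GLn F n) with hv
    have hvU : v ∈ unitri F n := mul_mem (inv_mem hm) u.2
    have hvB : (perm F n σ)⁻¹ * v * perm F n σ ∈ borel F n := by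
      rw [perm_conj_mem_borel]
      intro i j hij
      rcases (hσ _ _).1 hij with h1 | h1
      · exact mem_borel.1 hvU.1 _ _ ((blkOf_mono J').reflect_lt h1)
      · exact hmv i j h1.1.symm h1.2
    set w := perm F n h * m * (perm F n h)⁻¹ with hw
    have hwval : ∀ i j, w.val (h i) (h j) = m.val i j := by
      intro i j
      have h1 : (perm F n h)⁻¹ * w * perm F n h = m := by rw [hw]; group
      rw [← perm_inv_mul_mul_perm_val, h1]
    have hwU : w ∈ unitri F n := by
      refine ⟨mem_borel.2 fun i j hij => ?_, fun i => ?_⟩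
      · obtain ⟨i, rfl⟩ := h.surjective i
        obtain ⟨j, rfl⟩ := h.surjective j
        rw [hwval]
        by_cases hb : blkOf J' i = blkOf J' j
        · refine mem_borel.1 hm.1 _ _ (lt_of_not_ge fun hle => ?_)
          rcases hle.lt_or_eq with h1 | h1
          · exact hij.not_gt (H.lt h1 hb)
          · rw [h1] at hij
            exact lt_irrefl _ hij
        · exact hm0 i j hb
      · obtain ⟨i, rfl⟩ := h.surjective i
        rw [hwval, hm.2]
    -- The block diagonal part of `u` passes through `h` to an element of `U`, and the remaining
    -- part passes through `σ` into `B`, where it is absorbed.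
    have hfac : (perm F n h) * ((u : GLn F n) * perm F n σ) =
        w * perm F n (h * σ) * ((perm F n σ)⁻¹ * v * perm F n σ) := by
      rw [hw, hv, map_mul]; group
    rw [hx, val_single_smul, inv_inv, one_mul, hfac, val_mul_borel _ _ hvB]
    have h1 := val_charElt_of_invertsOn (ψ := ψ) hhσ ⟨w, hwU⟩
    simp only at h1
    rw [h1, hC, lamOf_val, lamOf_val, H.superdiag_eq hm hmu hwval]
    ring
  obtain ⟨k, hk⟩ := exists_cellSum_eq (ψ := ψ) hσ'
  have hS : cellSum (lamOf ψ (indic F J')) σ x = (Nat.card (unitri F n) : R) * C := by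
    rw [cellSum, Finset.sum_congr rfl fun u _ => by
      rw [hval, ← mul_assoc, Units.inv_mul, one_mul], Finset.sum_const, Finset.card_univ,
      nsmul_eq_mul, Nat.card_eq_fintype_card]
  -- The twisted sum on the cell of `σ` is a power of q up to sign, and moving to the big cell
  -- changes it only by a power of -q.
  have hunit : IsUnit (cellSum (lamOf ψ (indic F J')) Fin.revPerm x) := by
    have h1 : IsUnit (cellSum (lamOf ψ (indic F J')) σ x) := by
      rw [hS, hC, card_unitri]
      push_cast
      refine (hq.pow _).mul (IsUnit.mul ?_ (hq.pow _))
      exact (Units.isUnit _).map (Int.castRingHom R)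
    rw [hk] at h1
    exact isUnit_of_mul_isUnit_right h1
  have hsgn : IsUnit ((Equiv.Perm.sign (Fin.revPerm : Equiv.Perm (Fin n)) : ℤ) : R) :=
    (Units.isUnit _).map (Int.castRingHom R)
  obtain ⟨s, hs⟩ := hsgn.mul hunit
  have hp := projElt_smul ψ (indic F J') x
  rw [← hs] at hp
  refine ⟨MonoidAlgebra.single 1 ((s⁻¹ : Rˣ) : R) * (projElt (lamOf ψ (indic F J')) *
    MonoidAlgebra.single (perm F n h)⁻¹ 1), ?_⟩
  rw [mul_smul, mul_smul, ← hx, hp, ← mul_smul, MonoidAlgebra.single_mul_single, Units.inv_mul,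
    one_mul, ← MonoidAlgebra.one_def, one_smul]

/-- Characters with the same support generate the same submodule. -/
lemma exists_charElt_eq_of_support (ψ : AddChar F R) {b b' : Fin n → F}
    (h : ∀ i j : Fin n, (i : ℕ) + 1 = j → (b i ≠ 0 ↔ b' i ≠ 0)) :
    ∃ a : R[GLn F n], charElt (lamOf ψ b') = a • charElt (lamOf ψ b) := by
  obtain ⟨t, ht1, ht2, ht3⟩ := exists_torus_conj h
  refine ⟨MonoidAlgebra.single t 1, eq_of_val_big_cell fun u hu => ?_⟩
  have h1 := val_charElt_big_cell ψ b' ⟨u, hu⟩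
  have h2 := val_charElt_big_cell ψ b ⟨_, ht2 u hu⟩
  simp only at h1 h2
  -- The torus element is moved past the longest permutation and absorbed into `B`, leaving a
  -- conjugation of `u`.
  have h3 : t⁻¹ * (u * perm F n Fin.revPerm) = t⁻¹ * u * t * perm F n Fin.revPerm *
      ((perm F n Fin.revPerm)⁻¹ * t⁻¹ * perm F n Fin.revPerm) := by group
  rw [val_single_smul, one_mul, h3, val_mul_borel _ _ (ht1 _), h1, h2, lamOf_val, lamOf_val, ht3]

end Projections

/-! ### The index of a standard parabolic subgroup -/

section Index

variable {F : Type*} [Field F] {n : ℕ}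

/-- The permutations which are increasing on the blocks attached to `J`. -/
def IncrOn (J : Set (Fin n)) (d : Equiv.Perm (Fin n)) : Prop :=
  ∀ i j : Fin n, (i : ℕ) + 1 = j → i ∈ J → d i < d j

lemma exists_incrOn (J : Set (Fin n)) (σ : Equiv.Perm (Fin n)) :
    ∃ τ : Equiv.Perm (Fin n), IncrOn J (σ * τ) ∧ ∀ i, blkOf J (τ i) = blkOf J i := by
  let key : Fin n → ℕ ×ₗ Fin n := fun i => toLex (blkOf J i, σ i)
  have hinj : Function.Injective key := fun i j h => by
    have h1 : blkOf J i = blkOf J j ∧ i = j := by simpa [key] using h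
    exact h1.2
  have hmono : StrictMono (key ∘ Tuple.sort key) :=
    (Tuple.monotone_sort key).strictMono_of_injective (hinj.comp (Tuple.sort key).injective)
  have hlex : ∀ i j, i < j → blkOf J (Tuple.sort key i) < blkOf J (Tuple.sort key j) ∨
      (blkOf J (Tuple.sort key i) = blkOf J (Tuple.sort key j) ∧
        σ (Tuple.sort key i) < σ (Tuple.sort key j)) := by
    intro i j hij
    simpa [key, Prod.Lex.toLex_lt_toLex] using hmono hij
  have h1 : Monotone (blkOf J ∘ Tuple.sort key) := by
    intro i j hij
    rcases hij.lt_or_eq with h | rfl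
    · rcases hlex i j h with h | h
      · exact h.le
      · exact h.1.le
    · exact le_rfl
  -- The block numbers are already weakly increasing, so sorting leaves their sequence unchanged.
  have h2 := Tuple.unique_monotone (σ := Tuple.sort key) (τ := 1) h1 (by simpa using blkOf_mono J)
  have h3 : ∀ i, blkOf J (Tuple.sort key i) = blkOf J i := fun i => congrFun h2 i
  refine ⟨Tuple.sort key, fun i j hij hi => ?_, h3⟩
  rcases hlex i j (lt_of_adjacent hij) with h | h
  · rw [h3, h3, (blkOf_eq_iff J hij).2 hi] at h
    exact absurd h (lt_irrefl _)
  · exact h.2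

/-- The unit diagonal of `w` forces `d⁻¹ * d'` never to raise a block number. As the block numbers
have the same total before and after, it preserves them, and monotonicity on the blocks leaves only
the identity. -/
lemma eq_of_perm_inv_mul_mul_perm_mem_parab {J : Set (Fin n)} {d d' : Equiv.Perm (Fin n)}
    (hd : IncrOn J d) (hd' : IncrOn J d') {w : GLn F n} (hw : w ∈ unitri F n)
    (h : (perm F n d)⁻¹ * w * perm F n d' ∈ parab F J) :
    d = d' ∧ (perm F n d)⁻¹ * w * perm F n d ∈ borel F n := by
  have hle : ∀ j, blkOf J ((d⁻¹ * d') j) ≤ blkOf J j := by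
    intro j
    by_contra hlt
    have := mem_blockUpper.1 h _ _ (not_le.1 hlt)
    rw [perm_inv_mul_mul_perm_val] at this
    simp [hw.2] at this
  have heq : ∀ j, blkOf J ((d⁻¹ * d') j) = blkOf J j := by
    intro j
    have := (Finset.sum_eq_sum_iff_of_le (fun i (_ : i ∈ Finset.univ) => hle i)).1
      (Equiv.sum_comp (d⁻¹ * d') (blkOf J))
    exact this j (Finset.mem_univ _)
  have h1 : d⁻¹ * d' = 1 := by
    refine perm_eq_one_of_strictMono fun k l hkl => ?_
    rcases (blkOf_mono J hkl.le).lt_or_eq with hb | hb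
    · refine (blkOf_mono J).reflect_lt ?_
      rwa [heq, heq]
    · have h2 : d ((d⁻¹ * d') k) < d ((d⁻¹ * d') l) := by
        simpa using lt_of_blkOf_eq hd' hkl hb
      by_contra hnot
      rcases (not_lt.1 hnot).lt_or_eq with h3 | h3
      · exact (lt_of_blkOf_eq hd h3 (by rw [heq, heq, hb])).not_gt h2
      · rw [h3] at h2
        exact lt_irrefl _ h2
  obtain rfl : d = d' := inv_mul_eq_one.1 h1
  refine ⟨rfl, mem_borel.2 fun k l hlk => ?_⟩
  rcases (blkOf_mono J hlk.le).lt_or_eq with hb | hb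
  · exact mem_blockUpper.1 h _ _ hb
  · rw [perm_inv_mul_mul_perm_val]
    exact mem_borel.1 hw.1 _ _ (lt_of_blkOf_eq hd hlk hb)

variable [Fintype F]

open Classical in
-- The pairs `i < j` split according to whether `d` preserves or reverses their order.
lemma card_noninv (d : Equiv.Perm (Fin n)) :
    (noninv d).card + (noninv (d⁻¹ * Fin.revPerm)).card =
      (noninv (1 : Equiv.Perm (Fin n))).card := by
  have h1 : (noninv d).card =
      ((noninv (1 : Equiv.Perm (Fin n))).filter fun x => d x.1 < d x.2).card := by
    refine Finset.card_equiv (Equiv.prodCongr d⁻¹ d⁻¹) fun x => ?_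
    simp [noninv, and_comm]
  have h2 : noninv (d⁻¹ * Fin.revPerm) =
      (noninv (1 : Equiv.Perm (Fin n))).filter fun x => ¬ d x.1 < d x.2 := by
    ext x
    have : (d⁻¹ * Fin.revPerm)⁻¹ = Fin.revPerm * d := by
      rw [mul_inv_rev, inv_inv]; rfl
    simp only [noninv, this, Finset.mem_filter, Finset.mem_univ, true_and, Equiv.Perm.mul_apply,
      Fin.revPerm_apply, Fin.rev_lt_rev, inv_one, Equiv.Perm.one_apply, and_self, not_lt]
    refine and_congr_right fun hx => ⟨le_of_lt, fun hle => hle.lt_of_ne fun he => ?_⟩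
    exact hx.ne (d.injective he.symm)
  rw [h1, h2, Finset.card_filter_add_card_filter_not]

lemma index_stabU (d : Equiv.Perm (Fin n)) :
    (stabU F d).index = Fintype.card F ^ (noninv (d⁻¹ * Fin.revPerm)).card := by
  have h := (stabU F d).card_mul_index
  rw [card_stabU, card_unitri, ← card_noninv d, pow_add] at h
  exact Nat.eq_of_mul_eq_mul_left (pow_pos Fintype.card_pos _) h

open Classical in
-- The cosets of the parabolic subgroup are partitioned into U-orbits, represented by the
-- permutations increasing on the blocks. The stabiliser of such a coset in `U` is that of the flag
-- `dB`.
lemma index_parab_eq_sum_stabU (J : Set (Fin n)) : (parab F J).index =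
    ∑ d ∈ Finset.univ.filter fun d => IncrOn J d, (stabU F d).index := by
  let Φ : (Σ d : {d // IncrOn J d}, unitri F n ⧸ stabU F d.1) → GLn F n ⧸ parab F J :=
    fun x => Quotient.liftOn' x.2
      (fun u => (((u : GLn F n) * perm F n x.1.1 : GLn F n) : GLn F n ⧸ parab F J)) (by
        intro u v huv
        rw [QuotientGroup.leftRel_apply, mem_stabU] at huv
        rw [QuotientGroup.eq]
        refine borel_le_parab J ?_
        convert huv using 1
        simp [mul_assoc])
  have hΦ : ∀ d (u : unitri F n), Φ ⟨d, (u : unitri F n ⧸ stabU F d.1)⟩ =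
      (((u : GLn F n) * perm F n d.1 : GLn F n) : GLn F n ⧸ parab F J) := fun _ _ => rfl
  have hbij : Function.Bijective Φ := by
    constructor
    · rintro ⟨⟨d, hd⟩, x⟩ ⟨⟨d', hd'⟩, y⟩ hxy
      obtain ⟨u, rfl⟩ := QuotientGroup.mk_surjective x
      obtain ⟨v, rfl⟩ := QuotientGroup.mk_surjective y
      rw [hΦ, hΦ, QuotientGroup.eq] at hxy
      obtain ⟨h1, h2⟩ := eq_of_perm_inv_mul_mul_perm_mem_parab hd hd'
        (w := ((u⁻¹ * v : unitri F n) : GLn F n)) (u⁻¹ * v).2 (by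
          convert hxy using 1
          simp [mul_assoc])
      subst h1
      congr 1
      rw [QuotientGroup.eq, mem_stabU]
      exact h2
    · intro z
      obtain ⟨g, rfl⟩ := QuotientGroup.mk_surjective z
      obtain ⟨u, hu, σ, b, hb, rfl⟩ := exists_bruhat g
      obtain ⟨τ, h1, h2⟩ := exists_incrOn J σ
      refine ⟨⟨⟨σ * τ, h1⟩, ((⟨u, hu⟩ : unitri F n) : unitri F n ⧸ stabU F (σ * τ))⟩, ?_⟩
      rw [hΦ, QuotientGroup.eq, map_mul]
      have hτ : perm F n τ ∈ parab F J := perm_mem_blockUpper.2 fun i => (h2 i).le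
      convert mul_mem (inv_mem hτ) (borel_le_parab J hb) using 1
      group
  have h := Nat.card_congr (Equiv.ofBijective Φ hbij)
  rw [Nat.card_sigma] at h
  rw [Subgroup.index, ← h]
  exact (Finset.sum_subtype _ (p := fun d => IncrOn J d) (by simp)
    fun d => (stabU F d).index).symm

open Classical in
/-- The index of a standard parabolic subgroup. -/
lemma index_parab (J : Set (Fin n)) : (parab F J).index =
    ∑ σ ∈ Finset.univ.filter fun σ => InvertsOn (indic F J) σ,
      Fintype.card F ^ (noninv σ).card := by
  rw [index_parab_eq_sum_stabU]
  simp only [index_stabU]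
  -- Substituting `d⁻¹ * revPerm` matches the sum with the cells on which E_λ does not vanish.
  refine Finset.sum_equiv ((Equiv.inv _).trans (Equiv.mulRight Fin.revPerm)) (fun d => ?_)
    fun d _ => rfl
  have h : (d⁻¹ * Fin.revPerm)⁻¹ = Fin.revPerm * d := by
    rw [mul_inv_rev, inv_inv]; rfl
  rw [Finset.mem_filter, Finset.mem_filter]
  simp only [Finset.mem_univ, true_and, Equiv.trans_apply, Equiv.inv_apply,
    Equiv.coe_mulRight, InvertsOn, h, indic_ne_zero_iff, IncrOn, Equiv.Perm.mul_apply,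
    Fin.revPerm_apply, Fin.rev_lt_rev]

end Index

/-! ### The bilinear form on the vectors E_λ -/

section Form

open Classical

variable {R : Type*} [CommRing R] [IsDomain R] [CharZero R] {F : Type*} [Field F] [Fintype F]
  {n : ℕ}

lemma form_comm (x y : steinbergLattice R F n) : form x y = form y x := by
  rw [form_eq_iff, card_borel_mul_form, canonicalForm, canonicalForm]
  exact Finset.sum_congr rfl fun g _ => mul_comm _ _

lemma form_add_right (x y z : steinbergLattice R F n) :
    form x (y + z) = form x y + form x z := by
  rw [form_comm, form_add_left, form_comm y, form_comm z]

lemma form_single_one_smul (r : R) (x y : steinbergLattice R F n) :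
    form ((MonoidAlgebra.single 1 r : R[GLn F n]) • x) y = r * form x y := by
  rw [form_eq_iff, mul_left_comm, card_borel_mul_form, canonicalForm, canonicalForm,
    Finset.mul_sum]
  refine Finset.sum_congr rfl fun g _ => ?_
  have := val_single_smul 1 r x g
  rw [inv_one, one_mul, val, val] at this
  rw [this, mul_assoc]

lemma form_single_one_smul_right (r : R) (x y : steinbergLattice R F n) :
    form x ((MonoidAlgebra.single 1 r : R[GLn F n]) • y) = r * form x y := by
  rw [form_comm, form_single_one_smul, form_comm]

lemma form_zero_left (y : steinbergLattice R F n) : form 0 y = 0 := by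
  rw [form_eq_iff]
  simp [canonicalForm]

lemma form_sum_left {ι : Type*} (s : Finset ι) (x : ι → steinbergLattice R F n)
    (y : steinbergLattice R F n) : form (∑ i ∈ s, x i) y = ∑ i ∈ s, form (x i) y := by
  induction s using Finset.induction_on with
  | empty => exact form_zero_left y
  | insert i s hi ih => rw [Finset.sum_insert hi, Finset.sum_insert hi, form_add_left, ih]

lemma form_sum_right {ι : Type*} (s : Finset ι) (x : ι → steinbergLattice R F n)
    (y : steinbergLattice R F n) : form y (∑ i ∈ s, x i) = ∑ i ∈ s, form y (x i) := by
  rw [form_comm, form_sum_left]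
  exact Finset.sum_congr rfl fun i _ => form_comm _ _

lemma exists_adjoint (a : R[GLn F n]) : ∃ a' : R[GLn F n], ∀ x y : steinbergLattice R F n,
    form (a • x) y = form x (a' • y) := by
  induction a using MonoidAlgebra.induction_linear with
  | zero =>
    refine ⟨0, fun x y => ?_⟩
    rw [zero_smul, zero_smul, form_comm x, form_zero_left, form_zero_left]
  | add a c ha hc =>
    obtain ⟨a', ha'⟩ := ha
    obtain ⟨c', hc'⟩ := hc
    exact ⟨a' + c', fun x y => by rw [add_smul, add_smul, form_add_left, form_add_right, ha', hc']⟩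
  | single g r => exact ⟨_, fun x y => form_single_smul g r x y⟩

lemma form_projElt_smul (lam : unitri F n →* Rˣ) (x y : steinbergLattice R F n) :
    form (projElt lam • x) y = form x (projElt lam⁻¹ • y) := by
  rw [projElt, projElt, Finset.sum_smul, Finset.sum_smul, form_sum_left, form_sum_right,
    ← Equiv.sum_comp (Equiv.inv (unitri F n))]
  refine Finset.sum_congr rfl fun u _ => ?_
  rw [form_single_smul]
  simp

/-- Since `x` is constant on the coset σB, pairing it with the sum over that coset gives |B| times
its value at `σ`. The factor |B| is the one divided out in the form. -/
lemma form_gen (x : steinbergLattice R F n) : form x (gen R F n) =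
    ∑ σ : Equiv.Perm (Fin n), ((Equiv.Perm.sign σ : ℤ) : R) * val x (perm F n σ) := by
  rw [form_eq_iff, canonicalForm]
  have h1 : ∀ g : GLn F n, ((gen R F n : steinbergLattice R F n) : R[GLn F n]).coeff g =
      val (gen R F n) g := fun _ => rfl
  simp only [h1, val_gen, Finset.mul_sum]
  rw [Finset.sum_comm]
  refine Finset.sum_congr rfl fun σ _ => ?_
  rw [← Equiv.sum_comp (Equiv.mulLeft (perm F n σ))]
  simp only [Equiv.coe_mulLeft, inv_mul_cancel_left, mul_ite, mul_one, mul_zero]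
  rw [← Finset.sum_filter]
  have h2 : ∀ g ∈ Finset.univ.filter fun g => g ∈ borel F n,
      (x : R[GLn F n]).coeff (perm F n σ * g) * ((Equiv.Perm.sign σ : ℤ) : R) =
      val x (perm F n σ) * ((Equiv.Perm.sign σ : ℤ) : R) := by
    intro g hg
    congr 1
    exact val_mul_borel x _ (Finset.mem_filter.1 hg).2
  rw [Finset.sum_congr rfl h2, Finset.sum_const, nsmul_eq_mul]
  have h3 : (Finset.univ.filter fun g => g ∈ borel F n).card = Nat.card (borel F n) := by
    rw [Nat.card_eq_fintype_card]
    exact (Fintype.card_subtype _).symm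
  rw [h3]
  ring

/-- The signs of E_λ and of the generator cancel, and the surviving powers of q are those in the
index formula. -/
lemma form_charElt_gen {ψ : AddChar F R} (hψ : ψ ≠ 1) (b : Fin n → F) :
    form (charElt (lamOf ψ b)) (gen R F n) = ((parab F (Function.support b)).index : R) := by
  have h0 : ∀ σ, InvertsOn (indic F (Function.support b)) σ ↔ InvertsOn b σ := by
    intro σ
    simp only [InvertsOn, indic_ne_zero_iff, Function.mem_support]
  rw [form_gen, index_parab]
  simp only [h0]
  rw [Finset.sum_filter]
  push_cast
  refine Finset.sum_congr rfl fun σ _ => ?_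
  have h1 : val (charElt (lamOf ψ b)) (perm F n σ) =
      val (charElt (lamOf ψ b)) (((1 : unitri F n) : GLn F n) * perm F n σ) := by simp
  have h3 : ((Equiv.Perm.sign σ : ℤ) : R) * ((Equiv.Perm.sign σ : ℤ) : R) = 1 := by
    rw [← Int.cast_mul, ← Units.val_mul, Int.units_mul_self]
    simp
  rw [h1]
  split_ifs with h
  · rw [val_charElt_of_invertsOn h, map_one, Units.val_one, mul_one, ← mul_assoc, h3, one_mul]
  · rw [val_charElt_of_not_invertsOn hψ h, mul_zero]

lemma form_charElt_charElt_inv {ψ : AddChar F R} (hψ : ψ ≠ 1) (b : Fin n → F) :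
    form (charElt (lamOf ψ b)) (charElt (lamOf ψ (-b))) =
      (Nat.card (unitri F n) : R) * ((parab F (Function.support b)).index : R) := by
  rw [← inv_lamOf, charElt_eq (lamOf ψ b)⁻¹, ← form_projElt_smul, projElt_smul_charElt,
    form_single_one_smul, form_charElt_gen hψ]

/-- The values of `f(E_λ, -)` are determined by the component of the second variable in the
eigenspace of `λ⁻¹`. -/
lemma form_charElt {ψ : AddChar F R} (hψ : ψ ≠ 1) (b : Fin n → F) {x : steinbergLattice R F n}
    {s : R} (hs : projElt (lamOf ψ (-b)) • x =
      (MonoidAlgebra.single 1 s : R[GLn F n]) • charElt (lamOf ψ (-b))) :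
    form (charElt (lamOf ψ b)) x = s * ((parab F (Function.support b)).index : R) := by
  have h1 := form_projElt_smul (lamOf ψ b) (charElt (lamOf ψ b)) x
  rw [projElt_smul_charElt, form_single_one_smul, inv_lamOf, hs, form_single_one_smul_right,
    form_charElt_charElt_inv hψ] at h1
  refine mul_left_cancel₀ (Nat.cast_ne_zero.2 (Nat.card_pos (α := unitri F n)).ne') ?_
  rw [h1]
  ring

end Form

/-! ### Unitriangular matrices supported in the last columns, and single-column subgroups -/

section Columns

variable {F : Type*} [Field F] {n : ℕ}

/-- The first `j` columns of `u` are those of the identity matrix. -/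
def InCols (j : ℕ) (u : GLn F n) : Prop :=
  ∀ i k : Fin n, (k : ℕ) < j → u.val i k = if i = k then 1 else 0

/-- The rows of `g` with number at least `j` are those of the identity matrix. -/
def InRows (j : ℕ) (g : GLn F n) : Prop :=
  ∀ i k : Fin n, j ≤ (i : ℕ) → g.val i k = if i = k then 1 else 0

lemma InRows.mul_apply {j : ℕ} {g : GLn F n} (hg : InRows j g) (M : Matrix (Fin n) (Fin n) F)
    {i : Fin n} (hi : j ≤ (i : ℕ)) (k : Fin n) : (g.val * M) i k = M i k := by
  rw [Matrix.mul_apply, Finset.sum_eq_single i]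
  · simp [hg i i hi]
  · intro l _ hl
    simp [hg i l hi, hl.symm]
  · simp

lemma InRows.inv {j : ℕ} {g : GLn F n} (hg : InRows j g) : InRows j g⁻¹ := by
  intro i k hi
  rw [← hg.mul_apply (g⁻¹).val hi, ← Units.val_mul, mul_inv_cancel]
  simp [Matrix.one_apply]

lemma InRows.mul {j : ℕ} {g h : GLn F n} (hg : InRows j g) (hh : InRows j h) :
    InRows j (g * h) := by
  intro i k hi
  rw [Units.val_mul, hg.mul_apply _ hi, hh i k hi]

/-- Write u = 1 + N with N vanishing in columns up to `j`. As `g` is the identity in rows from `j`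
on, N g = N and the conjugate is 1 + g⁻¹N, in which rows from `j` on are unchanged. Every
superdiagonal entry in a later column lies in such a row. -/
lemma InRows.conj {j : ℕ} {g : GLn F n} (hg : InRows j g) {u : GLn F n} (hu : u ∈ unitri F n)
    (hc : InCols (j + 1) u) : g⁻¹ * u * g ∈ unitri F n ∧ InCols (j + 1) (g⁻¹ * u * g) ∧
      ∀ b, superdiag b (g⁻¹ * u * g) = superdiag b u := by
  set N : Matrix (Fin n) (Fin n) F := u.val - 1 with hN
  have hN0 : ∀ i k : Fin n, (k : ℕ) < j + 1 → N i k = 0 := by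
    intro i k hk
    rw [hN, Matrix.sub_apply, hc i k hk, Matrix.one_apply, sub_self]
  have hNg : N * g.val = N := by
    ext i k
    rw [Matrix.mul_apply, Finset.sum_eq_single k]
    · by_cases hk : (k : ℕ) < j + 1
      · rw [hN0 i k hk, zero_mul]
      · rw [hg k k (by omega)]; simp
    · intro l _ hl
      by_cases hl' : (l : ℕ) < j + 1
      · rw [hN0 i l hl', zero_mul]
      · rw [hg l k (by omega), if_neg hl, mul_zero]
    · simp
  have hy : (g⁻¹ * u * g).val = 1 + (g⁻¹).val * N := by
    have : u.val = 1 + N := by rw [hN]; abel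
    rw [Units.val_mul, Units.val_mul, this, mul_assoc, add_mul, hNg, one_mul, mul_add,
      ← Units.val_mul, inv_mul_cancel, Units.val_one]
  have h1 : ∀ i k : Fin n, j ≤ (i : ℕ) → (g⁻¹ * u * g).val i k = u.val i k := by
    intro i k hi
    rw [hy, Matrix.add_apply, hg.inv.mul_apply _ hi, hN, Matrix.sub_apply]
    ring
  have h2 : ∀ i k : Fin n, (k : ℕ) < j + 1 →
      (g⁻¹ * u * g).val i k = if i = k then 1 else 0 := by
    intro i k hk
    rw [hy, Matrix.add_apply, Matrix.mul_apply, Finset.sum_eq_zero, add_zero, Matrix.one_apply]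
    exact fun l _ => by rw [hN0 l k hk, mul_zero]
  refine ⟨⟨mem_borel.2 fun i k hik => ?_, fun i => ?_⟩, h2, fun b => ?_⟩
  · by_cases hk : (k : ℕ) < j + 1
    · rw [h2 i k hk, if_neg hik.ne']
    · rw [Fin.lt_def] at hik
      rw [h1 i k (by omega), mem_borel.1 hu.1 _ _ hik]
  · by_cases hk : (i : ℕ) < j + 1
    · rw [h2 i i hk, if_pos rfl]
    · rw [h1 i i (by omega), hu.2]
  · refine superdiag_congr fun i k hik _ => ?_
    by_cases hk : (k : ℕ) < j + 1
    · rw [h2 i k hk, hc i k hk]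
    · exact h1 i k (by omega)

/-- The matrix `1 + c e_jᵀ`, where the vector `c` is supported in the positions before `j`. -/
def colElt (j : Fin n) (c : {i : Fin n // i < j} → F) : GLn F n :=
  mkUpper (Matrix.of fun i k => if i = k then 1 else
      if h : i < j ∧ k = j then c ⟨i, h.1⟩ else 0)
    (fun i k hik => by
      have : ¬ (i < j ∧ k = j) := by rintro ⟨h1, rfl⟩; exact h1.not_gt hik
      simp [hik.ne', this]) (fun i => by simp)

lemma colElt_val (j : Fin n) (c : {i : Fin n // i < j} → F) (i k : Fin n) :
    (colElt j c).val i k =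
      if i = k then 1 else if h : i < j ∧ k = j then c ⟨i, h.1⟩ else 0 := rfl

lemma colElt_mem (j : Fin n) (c : {i : Fin n // i < j} → F) : colElt j c ∈ unitri F n :=
  ⟨mkUpper_mem_borel _ _ _, fun i => by simp [colElt_val]⟩

lemma colElt_apply_col (j : Fin n) (c : {i : Fin n // i < j} → F) {i : Fin n} (hi : i < j) :
    (colElt j c).val i j = c ⟨i, hi⟩ := by
  simp [colElt_val, hi.ne, hi]

lemma colElt_inRows (j : Fin n) (c : {i : Fin n // i < j} → F) : InRows j (colElt j c) := by
  intro i k hi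
  have : ¬ i < j := not_lt.2 (Fin.le_def.2 hi)
  simp [colElt_val, this]

lemma colElt_of_ne (j : Fin n) (c : {i : Fin n // i < j} → F) {k : Fin n} (hk : k ≠ j)
    (i : Fin n) : (colElt j c).val i k = if i = k then 1 else 0 := by
  simp [colElt_val, hk]

lemma eq_colElt {j : Fin n} {u : GLn F n} (hu : u ∈ unitri F n)
    (h : ∀ i k, k ≠ j → u.val i k = if i = k then 1 else 0) :
    u = colElt j fun i => u.val i j := by
  ext i k
  rw [colElt_val]
  by_cases hk : k = j
  · subst hk
    rcases lt_trichotomy i k with h1 | h1 | h1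
    · simp [h1, h1.ne]
    · subst h1; simp [hu.2]
    · simp [h1.ne', h1.not_gt, mem_borel.1 hu.1 _ _ h1]
  · simp [h i k hk, hk]

lemma mul_colElt_val_of_ne (g : GLn F n) (j : Fin n) (c : {i : Fin n // i < j} → F) {k : Fin n}
    (hk : k ≠ j) (i : Fin n) : (g * colElt j c).val i k = g.val i k := by
  rw [Units.val_mul, Matrix.mul_apply, Finset.sum_eq_single k]
  · simp [colElt_of_ne _ _ hk]
  · intro l _ hl
    simp [colElt_of_ne _ _ hk, hl]
  · simp

lemma mul_colElt_val_col (g : GLn F n) (j : Fin n) (c : {i : Fin n // i < j} → F) (i : Fin n) :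
    (g * colElt j c).val i j = g.val i j + ∑ k : {i : Fin n // i < j}, g.val i k * c k := by
  classical
  have h1 : ∑ k : {i : Fin n // i < j}, g.val i k * c k =
      ∑ k : Fin n, if h : k < j then g.val i k * c ⟨k, h⟩ else 0 := by
    rw [← Finset.sum_subset (Finset.filter_subset (fun k : Fin n => k < j) Finset.univ)]
    · rw [Finset.sum_subtype (Finset.univ.filter fun k : Fin n => k < j) (p := fun k => k < j)
        (by simp)]
      exact Finset.sum_congr rfl fun k _ => by simp [k.2]
    · intro k _ hk
      simp only [Finset.mem_filter, Finset.mem_univ, true_and] at hk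
      simp [hk]
  rw [h1, Units.val_mul, Matrix.mul_apply, ← Finset.add_sum_erase _ _ (Finset.mem_univ j),
    ← Finset.add_sum_erase (Finset.univ : Finset (Fin n))
      (fun k : Fin n => if h : k < j then g.val i k * c ⟨k, h⟩ else 0) (Finset.mem_univ j)]
  rw [dif_neg (lt_irrefl j), zero_add, (colElt_mem j c).2, mul_one]
  congr 1
  refine Finset.sum_congr rfl fun k hk => ?_
  have hk' := (Finset.mem_erase.1 hk).1
  by_cases h : k < j <;> simp [colElt_val, hk', h]

lemma superdiag_colElt (j : Fin n) (c : {i : Fin n // i < j} → F) (b : Fin n → F) :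
    superdiag b (colElt j c) =
      ∑ i : {i : Fin n // i < j}, if ((i : Fin n) : ℕ) + 1 = j then b i * c i else 0 := by
  classical
  unfold superdiag
  rw [← Finset.sum_subset (Finset.filter_subset (fun k : Fin n => k < j) Finset.univ)]
  · rw [Finset.sum_subtype (Finset.univ.filter fun k : Fin n => k < j) (p := fun k => k < j)
        (by simp)]
    refine Finset.sum_congr rfl fun i _ => ?_
    rw [Finset.sum_eq_single j]
    · rw [colElt_apply_col j c i.2]
    · intro k _ hk
      split_ifs with h
      · simp [colElt_of_ne j c hk, ne_of_adjacent h]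
      · rfl
    · simp
  · intro i _ hi
    simp only [Finset.mem_filter, Finset.mem_univ, true_and] at hi
    refine Finset.sum_eq_zero fun k _ => ?_
    split_ifs with h
    · simp [colElt_val, hi, ne_of_adjacent h]
    · rfl

lemma colElt_mul (j : Fin n) (c c' : {i : Fin n // i < j} → F) :
    colElt j c * colElt j c' = colElt j (c + c') := by
  rw [eq_colElt (mul_mem (colElt_mem j c) (colElt_mem j c')) (u := colElt j c * colElt j c')]
  · congr 1
    ext i
    rw [mul_colElt_val_col, colElt_apply_col j c i.2, Finset.sum_eq_single i]
    · simp [(colElt_mem j c).2]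
    · intro k _ hk
      rw [colElt_of_ne j c k.2.ne, if_neg (fun h => hk (Subtype.ext h.symm)), zero_mul]
    · simp
  · intro i k hk
    rw [mul_colElt_val_of_ne _ _ _ hk, colElt_of_ne j c hk]

lemma colElt_zero (j : Fin n) : colElt j (0 : {i : Fin n // i < j} → F) = 1 := by
  ext i k
  simp [colElt_val, Matrix.one_apply]

lemma InRows.conj_colElt {j : Fin n} {g : GLn F n} (hg : InRows j g)
    (c : {i : Fin n // i < j} → F) : ∃ x, g⁻¹ * colElt j c * g = colElt j x := by
  set N : Matrix (Fin n) (Fin n) F := (colElt j c).val - 1 with hN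
  have hN0 : ∀ i k : Fin n, k ≠ j → N i k = 0 := by
    intro i k hk
    rw [hN, Matrix.sub_apply, colElt_of_ne j c hk, Matrix.one_apply, sub_self]
  have hN1 : ∀ i k : Fin n, (j : ℕ) ≤ i → N i k = 0 := by
    intro i k hi
    rw [hN, Matrix.sub_apply, colElt_inRows j c i k hi, Matrix.one_apply, sub_self]
  have hNg : N * g.val = N := by
    ext i k
    rw [Matrix.mul_apply, Finset.sum_eq_single j]
    · rw [hg j k le_rfl]
      by_cases hk : j = k
      · simp [hk]
      · rw [if_neg hk, mul_zero, hN0 i k (Ne.symm hk)]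
    · intro l _ hl
      rw [hN0 i l hl, zero_mul]
    · simp
  have hy : (g⁻¹ * colElt j c * g).val = 1 + (g⁻¹).val * N := by
    have : (colElt j c).val = 1 + N := by rw [hN]; abel
    rw [Units.val_mul, Units.val_mul, this, mul_assoc, add_mul, hNg, one_mul, mul_add,
      ← Units.val_mul, inv_mul_cancel, Units.val_one]
  have h2 : ∀ i k : Fin n, k ≠ j →
      (g⁻¹ * colElt j c * g).val i k = if i = k then 1 else 0 := by
    intro i k hk
    rw [hy, Matrix.add_apply, Matrix.mul_apply, Finset.sum_eq_zero, add_zero, Matrix.one_apply]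
    exact fun l _ => by rw [hN0 l k hk, mul_zero]
  have h3 : InRows j (g⁻¹ * colElt j c * g) := (hg.inv.mul (colElt_inRows j c)).mul hg
  refine ⟨_, eq_colElt ⟨mem_borel.2 fun i k hik => ?_, fun i => ?_⟩ h2⟩
  · by_cases hk : k = j
    · rw [h3 i k (by rw [← hk]; exact (Fin.lt_def.1 hik).le), if_neg hik.ne']
    · rw [h2 i k hk, if_neg hik.ne']
  · by_cases hk : i = j
    · rw [h3 i i (by rw [hk]), if_pos rfl]
    · rw [h2 i i hk, if_pos rfl]

/-- There is an invertible matrix with a prescribed non-zero row. -/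
lemma exists_inRows_row {j m : Fin n} (hmj : m < j) {d : {i : Fin n // i < j} → F} (hd : d ≠ 0) :
    ∃ g : GLn F n, InRows j g ∧ (∀ i : {i : Fin n // i < j}, g.val m i = d i) ∧
      g.val m j = 0 ∧ ∀ i : Fin n, i < j → g.val i j = 0 := by
  classical
  obtain ⟨r, hr⟩ := Function.ne_iff.1 hd
  let row : Fin n → F := fun i => if h : i < j then d ⟨i, h⟩ else 0
  have hrow : row r ≠ 0 := by simpa [row, r.2] using hr
  -- The identity matrix with row `r` replaced has determinant equal to the entry of that row at
  -- `r`, hence `r` is chosen where `d` does not vanish. A transposition then brings the row to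
  -- position `m`.
  let T : GLn F n := Matrix.GeneralLinearGroup.mkOfDetNeZero
    ((1 : Matrix (Fin n) (Fin n) F).updateRow r row) (by
      rw [← Matrix.cramer_transpose_apply]
      simpa using hrow)
  have hT : ∀ i k, T.val i k = if i = r then row k else if i = k then 1 else 0 := by
    intro i k
    change (1 : Matrix (Fin n) (Fin n) F).updateRow r row i k = _
    rw [Matrix.updateRow_apply]
    simp [Matrix.one_apply]
  have hrj : row j = 0 := by simp [row]
  refine ⟨perm F n (Equiv.swap (r : Fin n) m) * T, ?_, ?_, ?_, ?_⟩
  · intro i k hi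
    have h1 : i ≠ r := fun h => absurd r.2 (by rw [← h]; exact not_lt.2 hi)
    have h2 : i ≠ m := fun h => absurd hmj (by rw [← h]; exact not_lt.2 hi)
    rw [perm_mul_val, Equiv.swap_inv, Equiv.swap_apply_of_ne_of_ne h1 h2, hT, if_neg h1]
  · intro i
    rw [perm_mul_val, Equiv.swap_inv, Equiv.swap_apply_right, hT, if_pos rfl]
    simp [row, i.2]
  · rw [perm_mul_val, Equiv.swap_inv, Equiv.swap_apply_right, hT, if_pos rfl, hrj]
  · intro i hi
    rw [perm_mul_val, Equiv.swap_inv, hT, hrj]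
    split_ifs with h1 h2
    · rfl
    · rw [Equiv.swap_apply_eq_iff, Equiv.swap_apply_of_ne_of_ne (ne_of_gt r.2) hmj.ne'] at h2
      exact absurd h2 hi.ne
    · rfl

end Columns

/-! ### Existence of eigenvectors of U in an arbitrary non-zero module -/

section Eigenvectors

variable {R : Type*} [CommRing R] {F : Type*} [Field F] {n : ℕ}
  {V : Type*} [AddCommGroup V] [Module R[GLn F n] V]

lemma single_smul_single_smul (g h : GLn F n) (r s : R) (v : V) :
    (MonoidAlgebra.single g r : R[GLn F n]) • (MonoidAlgebra.single h s : R[GLn F n]) • v =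
      (MonoidAlgebra.single (g * h) (r * s) : R[GLn F n]) • v := by
  rw [← mul_smul, MonoidAlgebra.single_mul_single]

lemma single_smul_conj (g h : GLn F n) (r s : R) (v : V) :
    (MonoidAlgebra.single g r : R[GLn F n]) • (MonoidAlgebra.single h s : R[GLn F n]) • v =
      (MonoidAlgebra.single h s : R[GLn F n]) •
        (MonoidAlgebra.single (h⁻¹ * g * h) r : R[GLn F n]) • v := by
  rw [single_smul_single_smul, single_smul_single_smul, mul_comm r s]
  congr 2
  group

/-- A matrix with `j` trivial columns is one with `j + 1` trivial columns times a matrix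
concentrated in column `j`. Only the coefficient in position `j - 1` of the character is new, and it
becomes `t`. -/
lemma eigenvector_of_column {ψ : AddChar F R} {j : Fin n} {b : Fin n → F} {v : V} {t : F}
    (h : ∀ u ∈ unitri F n, InCols (j + 1) u →
      (MonoidAlgebra.single u (ψ (superdiag b u)) : R[GLn F n]) • v = v)
    (ht : ∀ c : {i : Fin n // i < j} → F, (MonoidAlgebra.single (colElt j c)
      (ψ (∑ i : {i : Fin n // i < j}, if ((i : Fin n) : ℕ) + 1 = j then t * c i else 0)) :
        R[GLn F n]) • v = v)
    {u : GLn F n} (hu : u ∈ unitri F n) (hc : InCols j u) :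
    (MonoidAlgebra.single u
      (ψ (superdiag (fun i => if (i : ℕ) + 1 = j then t else b i) u)) : R[GLn F n]) • v = v := by
  set b' : Fin n → F := fun i => if (i : ℕ) + 1 = j then t else b i with hb'
  let c : {i : Fin n // i < j} → F := fun i => u.val i j
  set u' := u * colElt j (-c) with hu'
  have huu : u = u' * colElt j c := by
    rw [hu', mul_assoc, colElt_mul, neg_add_cancel, colElt_zero, mul_one]
  have hu'U : u' ∈ unitri F n := mul_mem hu (colElt_mem j _)
  have hu'c : InCols (j + 1) u' := by
    intro i k hk
    by_cases hkj : k = j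
    · subst hkj
      rw [hu', mul_colElt_val_col]
      by_cases hi : i < k
      · rw [Finset.sum_eq_single ⟨i, hi⟩]
        · simp [hu.2, c, hi.ne]
        · intro l _ hl
          rw [hc i l (Fin.lt_def.1 l.2), if_neg fun h => hl (Subtype.ext h.symm), zero_mul]
        · simp
      · rw [Finset.sum_eq_zero, add_zero]
        · split_ifs with h1
          · rw [h1, hu.2]
          · exact mem_borel.1 hu.1 _ _ (lt_of_le_of_ne (not_lt.1 hi) (Ne.symm h1))
        · intro l _
          rw [hc i l (Fin.lt_def.1 l.2), if_neg, zero_mul]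
          exact fun h => hi (h ▸ l.2)
    · rw [hu', mul_colElt_val_of_ne _ _ _ hkj]
      refine hc i k ?_
      have : (k : ℕ) ≠ j := fun h => hkj (Fin.ext h)
      omega
  have hb1 : superdiag b' u' = superdiag b u' := by
    unfold superdiag
    refine Finset.sum_congr rfl fun i _ => Finset.sum_congr rfl fun k _ => ?_
    split_ifs with hik
    · by_cases hij : (i : ℕ) + 1 = j
      · rw [hu'c i k (by omega), if_neg (ne_of_adjacent hik), mul_zero, mul_zero]
      · simp [hb', hij]
    · rfl
  have hb2 : superdiag b' (colElt j c) =
      ∑ i : {i : Fin n // i < j}, if ((i : Fin n) : ℕ) + 1 = j then t * c i else 0 := by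
    rw [superdiag_colElt]
    refine Finset.sum_congr rfl fun i _ => ?_
    split_ifs with hij
    · simp [hb', hij]
    · rfl
  rw [huu, superdiag_mul _ hu'U (colElt_mem j c), AddChar.map_add_eq_mul,
    ← single_smul_single_smul, hb1, hb2, ht, h u' hu'U hu'c]

open Classical

variable [Fintype F]

/-- The component of `v` at a character of the group of the matrices `colElt j c`. -/
def colProj (ψ : AddChar F R) (j : Fin n) (d : {i : Fin n // i < j} → F) (v : V) : V :=
  ∑ c : {i : Fin n // i < j} → F,
    (MonoidAlgebra.single (colElt j c) (ψ (∑ i, d i * c i)) : R[GLn F n]) • v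

lemma colProj_eigen (ψ : AddChar F R) (j : Fin n) (d c : {i : Fin n // i < j} → F) (v : V) :
    (MonoidAlgebra.single (colElt j c) (ψ (∑ i, d i * c i)) : R[GLn F n]) • colProj ψ j d v =
      colProj ψ j d v := by
  rw [colProj, Finset.smul_sum]
  conv_rhs => rw [← Equiv.sum_comp (Equiv.addLeft c)]
  refine Finset.sum_congr rfl fun x _ => ?_
  rw [single_smul_single_smul, colElt_mul, ← AddChar.map_add_eq_mul, ← Finset.sum_add_distrib]
  simp [mul_add]

lemma colProj_stable {ψ : AddChar F R} {j : Fin n} {b : Fin n → F} {v : V}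
    (h : ∀ u ∈ unitri F n, InCols (j + 1) u →
      (MonoidAlgebra.single u (ψ (superdiag b u)) : R[GLn F n]) • v = v)
    (d : {i : Fin n // i < j} → F) {u : GLn F n} (hu : u ∈ unitri F n) (hc : InCols (j + 1) u) :
    (MonoidAlgebra.single u (ψ (superdiag b u)) : R[GLn F n]) • colProj ψ j d v =
      colProj ψ j d v := by
  rw [colProj, Finset.smul_sum]
  refine Finset.sum_congr rfl fun c _ => ?_
  obtain ⟨h1, h2, h3⟩ := (colElt_inRows j c).conj hu hc
  rw [single_smul_conj, ← h3 b, h _ h1 h2]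

/-- Fourier inversion: by orthogonality of characters the components of `v` add up to a power of q
times `v`, and q is a unit. -/
lemma exists_colProj_ne_zero [IsDomain R] (hq : IsUnit (Fintype.card F : R)) {ψ : AddChar F R}
    (hψ : ψ ≠ 1) (j : Fin n) {v : V} (hv : v ≠ 0) :
    ∃ d : {i : Fin n // i < j} → F, colProj ψ j d v ≠ 0 := by
  by_contra! hcon
  have h1 : ∀ c : {i : Fin n // i < j} → F, c ≠ 0 →
      ∑ d : {i : Fin n // i < j} → F, ψ (∑ i, d i * c i) = 0 := by
    intro c hc
    let χ : AddChar ({i : Fin n // i < j} → F) R := ψ.compAddMonoidHom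
      { toFun := fun d => ∑ i, d i * c i
        map_zero' := by simp
        map_add' := fun x y => by simp [add_mul, Finset.sum_add_distrib] }
    refine AddChar.sum_eq_zero_of_ne_one (ψ := χ) ?_
    obtain ⟨i, hi⟩ := Function.ne_iff.1 hc
    obtain ⟨a, ha⟩ := AddChar.ne_one_iff.1 hψ
    refine AddChar.ne_one_iff.2 ⟨Pi.single i (a * (c i)⁻¹), ?_⟩
    change ψ (∑ k, (Pi.single i (a * (c i)⁻¹) : {i : Fin n // i < j} → F) k * c k) ≠ 1
    rw [Finset.sum_eq_single i]
    · rwa [Pi.single_eq_same, inv_mul_cancel_right₀ hi]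
    · intro k _ hk
      rw [Pi.single_eq_of_ne hk, zero_mul]
    · simp
  have h2 : ∑ d : {i : Fin n // i < j} → F, colProj ψ j d v = (MonoidAlgebra.single 1
      ((Fintype.card F : R) ^ Fintype.card {i : Fin n // i < j}) : R[GLn F n]) • v := by
    unfold colProj
    rw [Finset.sum_comm, Finset.sum_eq_single 0]
    · simp only [Pi.zero_apply, mul_zero, Finset.sum_const_zero, AddChar.map_zero_eq_one,
        Finset.sum_const, Finset.card_univ, colElt_zero]
      rw [← Nat.cast_smul_eq_nsmul R[GLn F n], ← mul_smul, MonoidAlgebra.natCast_def,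
        MonoidAlgebra.single_mul_single]
      simp
    · intro c _ hc
      rw [← Finset.sum_smul]
      have : ∑ d : {i : Fin n // i < j} → F, (MonoidAlgebra.single (colElt j c)
          (ψ (∑ i, d i * c i)) : R[GLn F n]) =
          MonoidAlgebra.single (colElt j c) (∑ d : {i : Fin n // i < j} → F,
            ψ (∑ i, d i * c i)) := by
        exact (map_sum (MonoidAlgebra.singleAddHom (colElt j c)) _ _).symm
      rw [this, h1 c hc, MonoidAlgebra.single_zero, zero_smul]
    · simp
  rw [Finset.sum_eq_zero fun d _ => hcon d] at h2
  obtain ⟨s, hs⟩ := hq.pow (Fintype.card {i : Fin n // i < j})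
  have h3 := congrArg (fun x => (MonoidAlgebra.single 1 ((s⁻¹ : Rˣ) : R) : R[GLn F n]) • x) h2
  simp only [smul_zero, ← hs] at h3
  rw [single_smul_single_smul, mul_one, Units.inv_mul, ← MonoidAlgebra.one_def, one_smul] at h3
  exact hv h3.symm

/-- Column `j` is added to the group acting by a character. The abelian group of that column acts on
some non-zero component through a character `d`. If `d` is non-zero, an invertible matrix in the
first `j` coordinates moves it to the one that reads only the entry in row `j - 1`, which is the
form a linear character of `U` must have. -/
lemma eigenvector_step [IsDomain R] (hq : IsUnit (Fintype.card F : R)) {ψ : AddChar F R}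
    (hψ : ψ ≠ 1) {j : Fin n} {b : Fin n → F} {v : V} (hv : v ≠ 0)
    (h : ∀ u ∈ unitri F n, InCols (j + 1) u →
      (MonoidAlgebra.single u (ψ (superdiag b u)) : R[GLn F n]) • v = v) :
    ∃ (b' : Fin n → F) (v' : V), v' ≠ 0 ∧ ∀ u ∈ unitri F n, InCols j u →
      (MonoidAlgebra.single u (ψ (superdiag b' u)) : R[GLn F n]) • v' = v' := by
  obtain ⟨d, hd⟩ := exists_colProj_ne_zero hq hψ j hv
  by_cases hd0 : d = 0
  · refine ⟨_, colProj ψ j d v, hd, fun u hu hc => eigenvector_of_column (t := 0)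
      (fun u hu hc => colProj_stable h d hu hc) (fun c => ?_) hu hc⟩
    have := colProj_eigen ψ j d c v
    simpa [hd0] using this
  · obtain ⟨i0, -⟩ := Function.ne_iff.1 hd0
    have hj : 0 < (j : ℕ) := by
      have := Fin.lt_def.1 i0.2
      omega
    let m : Fin n := ⟨j - 1, by omega⟩
    have hmj : m < j := Fin.lt_def.2 (by simp only [m]; omega)
    obtain ⟨g, hg1, hg2, hg3, hg4⟩ := exists_inRows_row hmj hd0
    refine ⟨_, (MonoidAlgebra.single g 1 : R[GLn F n]) • colProj ψ j d v, fun h0 => hd ?_,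
      fun u hu hc => eigenvector_of_column (t := 1) (b := b) (fun u hu hc => ?_) (fun c => ?_)
        hu hc⟩
    · have := congrArg (fun x => (MonoidAlgebra.single g⁻¹ 1 : R[GLn F n]) • x) h0
      simp only [smul_zero] at this
      rwa [single_smul_single_smul, inv_mul_cancel, mul_one, ← MonoidAlgebra.one_def,
        one_smul] at this
    · obtain ⟨h1, h2, h3⟩ := hg1.conj hu hc
      rw [single_smul_conj, ← h3 b, colProj_stable h d h1 h2]
    · obtain ⟨x, hx⟩ := hg1.conj_colElt c
      have hsum : (∑ i : {i : Fin n // i < j}, if ((i : Fin n) : ℕ) + 1 = j then 1 * c i else 0) =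
          ∑ i, d i * x i := by
        have h1 : g * colElt j x = colElt j c * g := by rw [← hx]; group
        have h2 := congrArg (fun y : GLn F n => y.val m j) h1
        rw [mul_colElt_val_col, hg3, zero_add] at h2
        simp only [← hg2]
        rw [h2, Units.val_mul, Matrix.mul_apply,
          Finset.sum_eq_single j, hg1 j j le_rfl, if_pos rfl, mul_one, colElt_apply_col j c hmj,
          Finset.sum_eq_single ⟨m, hmj⟩]
        · rw [if_pos (show (j : ℕ) - 1 + 1 = j by omega), one_mul]
        · intro i _ hi
          refine if_neg fun h => hi (Subtype.ext (Fin.ext ?_))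
          simp only [m]
          omega
        · simp
        · intro l _ hl
          rcases lt_or_gt_of_ne hl with h | h
          · rw [hg4 l h, mul_zero]
          · rw [hg1 l j (Fin.lt_def.1 h).le, if_neg hl, mul_zero]
        · simp
      rw [single_smul_conj, hx, hsum, colProj_eigen]

/-- Every non-zero module contains an eigenvector of `U`. -/
theorem exists_eigenvector [IsDomain R] [Nontrivial V] (hq : IsUnit (Fintype.card F : R))
    {ψ : AddChar F R} (hψ : ψ ≠ 1) : ∃ (b : Fin n → F) (v : V), v ≠ 0 ∧ ∀ u : unitri F n,
      (MonoidAlgebra.single (u : GLn F n) (lamOf ψ b u : R) : R[GLn F n]) • v = v := by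
  -- Here `k` counts the columns already treated, starting from the right.
  have key : ∀ k ≤ n, ∃ (b : Fin n → F) (v : V), v ≠ 0 ∧ ∀ u ∈ unitri F n, InCols (n - k) u →
      (MonoidAlgebra.single u (ψ (superdiag b u)) : R[GLn F n]) • v = v := by
    intro k
    induction k with
    | zero =>
      intro _
      obtain ⟨v, hv⟩ := exists_ne (0 : V)
      refine ⟨0, v, hv, fun u _ hc => ?_⟩
      have : u = 1 := by
        ext i k
        rw [hc i k (by omega), Units.val_one, Matrix.one_apply]
      rw [superdiag_eq_zero (b := (0 : Fin n → F)) (fun _ _ _ h => absurd rfl h),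
        AddChar.map_zero_eq_one, this, ← MonoidAlgebra.one_def, one_smul]
    | succ k ih =>
      intro hk
      obtain ⟨b, v, hv, h⟩ := ih (by omega)
      refine eigenvector_step (j := ⟨n - (k + 1), by omega⟩) hq hψ hv fun u hu hc => h u hu ?_
      rwa [show n - k = n - (k + 1) + 1 by omega]
  obtain ⟨b, v, hv, h⟩ := key n le_rfl
  refine ⟨b, v, hv, fun u => h u u.2 fun i k hk => ?_⟩
  omega

end Eigenvectors

/-! ### Module theory: socle-type decomposition from symmetric generation and projections -/

section Eigensystems

open Submodule

variable {A M ι : Type*} [Ring A] [AddCommGroup M] [Module A M]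

/-- A family of vectors `f i`, with operators `π i` projecting onto them up to scalars, that
detects the submodules of `M` and in which generation is symmetric. -/
structure IsEigensystem (f : ι → M) (π : ι → A) : Prop where
  exists_mem_notMem : ∀ X Y : Submodule A M, X < Y → ∃ i, f i ∈ Y ∧ f i ∉ X
  smul_eq_zero_or : ∀ i x, π i • x = 0 ∨ f i ∈ span A {x}
  smul_self_ne_zero : ∀ i, π i • f i ≠ 0
  symm : ∀ i j, f i ∈ span A {f j} → f j ∈ span A {f i}

namespace IsEigensystem

variable {f : ι → M} {π : ι → A}

lemma ne_zero (H : IsEigensystem f π) (i : ι) : f i ≠ 0 := fun h => H.smul_self_ne_zero i (by rw [h, smul_zero])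

/-- A non-zero submodule properly inside contains some `f j`, and by symmetry `f j` generates `f i`
again. -/
lemma isAtom (H : IsEigensystem f π) (i : ι) : IsAtom (span A {f i}) := by
  refine ⟨fun h => H.ne_zero i (span_singleton_eq_bot.1 h), fun X hX => ?_⟩
  by_contra hne
  obtain ⟨j, hj, -⟩ := H.exists_mem_notMem ⊥ X (bot_lt_iff_ne_bot.2 hne)
  have h1 := H.symm j i (hX.le hj)
  exact hX.not_ge ((span_singleton_le_iff_mem _ _).2 ((span_singleton_le_iff_mem _ _).2 hj h1))

lemma isSimpleModule (H : IsEigensystem f π) (i : ι) : IsSimpleModule A (span A {f i}) :=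
  isSimpleModule_iff_isAtom.2 (H.isAtom i)

lemma span_eq_of_mem (H : IsEigensystem f π) {i j : ι} (h : f i ∈ span A {f j}) : span A {f i} = span A {f j} :=
  le_antisymm ((span_singleton_le_iff_mem _ _).2 h)
    ((span_singleton_le_iff_mem _ _).2 (H.symm i j h))

lemma span_eq_of_smul_ne_zero (H : IsEigensystem f π) {i j : ι} {x : M} (hx : x ∈ span A {f j}) (h : π i • x ≠ 0) :
    span A {f i} = span A {f j} :=
  H.span_eq_of_mem ((span_singleton_le_iff_mem _ _).2 hx ((H.smul_eq_zero_or i x).resolve_left h))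

/-- Independence: `π i` annihilates every other member of the family but not `f i`, so the simple
module of `f i` is not contained in the sum of the others. Generation: a proper sum would miss some
`f i`, yet by symmetry `f i` lies in the span of a member indexed by `T`. -/
lemma isDirectSumOf (H : IsEigensystem f π) (T : Set ι) (hT : ∀ i, ∃ j ∈ T, f j ∈ span A {f i}) :
    IsDirectSumOf ((fun i => span A {f i}) '' T) := by
  classical
  refine (DirectSum.isInternal_submodule_iff_iSupIndep_and_iSup_eq_top _).2 ⟨?_, ?_⟩
  · rintro ⟨_, i, hi, rfl⟩
    refine (H.isAtom i).not_le_iff_disjoint.1 fun hle => H.smul_self_ne_zero i ?_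
    have hmem := hle (mem_span_singleton_self (f i))
    have key : ∀ x ∈ ⨆ (N : (fun i => span A {f i}) '' T) (_ : N ≠ ⟨_, i, hi, rfl⟩),
        (N : Submodule A M), π i • x = 0 := by
      intro x hx
      rw [iSup_subtype'] at hx
      induction hx using Submodule.iSup_induction' with
      | mem N x hx =>
        obtain ⟨⟨_, j, hj, rfl⟩, hN⟩ := N
        by_contra hne
        exact hN (Subtype.ext (H.span_eq_of_smul_ne_zero hx hne).symm)
      | zero => exact smul_zero _
      | add x y _ _ hx hy => rw [smul_add, hx, hy, add_zero]
    exact key _ hmem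
  · by_contra hne
    obtain ⟨i, -, hi⟩ := H.exists_mem_notMem _ ⊤ (lt_top_iff_ne_top.2 hne)
    obtain ⟨j, hj, hji⟩ := hT i
    refine hi ?_
    have h1 : span A {f j} ≤ ⨆ N : (fun i => span A {f i}) '' T, (N : Submodule A M) :=
      le_iSup (fun N : (fun i => span A {f i}) '' T => (N : Submodule A M)) ⟨_, j, hj, rfl⟩
    exact h1 (H.symm j i hji)

/-- An isomorphism would carry `f i` to a vector not killed by `π i`, which then generates `f i`. -/
lemma isEmpty_linearEquiv (H : IsEigensystem f π) {i j : ι} (hne : span A {f i} ≠ span A {f j}) :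
    IsEmpty (span A {f i} ≃ₗ[A] span A {f j}) := by
  refine ⟨fun φ => hne ?_⟩
  let v : span A {f i} := ⟨f i, mem_span_singleton_self _⟩
  refine H.span_eq_of_smul_ne_zero (φ v).2 fun h => H.smul_self_ne_zero i ?_
  have h1 : φ (π i • v) = 0 := by
    rw [map_smul]
    exact Subtype.ext h
  exact congrArg Subtype.val ((map_eq_zero_iff φ φ.injective).1 h1)

lemma isSimpleModule_iff (H : IsEigensystem f π) (T : Set ι) (hT : ∀ i, ∃ j ∈ T, f j ∈ span A {f i}) :
    IsSimpleModule A M ↔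
      Nonempty ι ∧ ∀ i ∈ T, ∀ j ∈ T, span A {f i} = span A {f j} := by
  constructor
  · intro hM
    obtain ⟨i, -, -⟩ := H.exists_mem_notMem ⊥ ⊤ bot_lt_top
    have htop : ∀ i, span A {f i} = ⊤ := fun i => (eq_bot_or_eq_top _).resolve_left (H.isAtom i).1
    exact ⟨⟨i⟩, fun i _ j _ => (htop i).trans (htop j).symm⟩
  · rintro ⟨⟨i⟩, h⟩
    obtain ⟨i, hi, -⟩ := hT i
    have htop : span A {f i} = ⊤ := by
      by_contra hne
      obtain ⟨k, -, hk⟩ := H.exists_mem_notMem _ ⊤ (lt_top_iff_ne_top.2 hne)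
      obtain ⟨j, hj, hjk⟩ := hT k
      refine hk ?_
      rw [h i hi j hj]
      exact H.symm j k hjk
    have := H.isSimpleModule i
    rw [htop] at this
    exact topEquiv.isSimpleModule_iff.1 this

end IsEigensystem

end Eigensystems

/-! ### Composition series from a descending chain with repetitions -/

section CompositionSeries

variable {X : Type*} [Lattice X] [JordanHolderLattice X]

lemma exists_compositionSeries_of_antitone (f : ℕ → X)
    (h : ∀ c, JordanHolderLattice.IsMaximal (f (c + 1)) (f c) ∨ f (c + 1) = f c) (C k : ℕ) :
    ∃ s : CompositionSeries X, RelSeries.head s = f (C + k) ∧ RelSeries.last s = f C ∧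
      Set.range s = f '' Set.Icc C (C + k) := by
  induction k generalizing C with
  | zero => exact ⟨RelSeries.singleton _ (f C), rfl, rfl, by
      rw [add_zero, Set.Icc_self, Set.image_singleton]
      exact Set.range_eq_singleton (fun _ => rfl)⟩
  | succ k ih =>
    obtain ⟨s, h1, h2, h3⟩ := ih (C + 1)
    have hI : Set.Icc C (C + (k + 1)) = insert C (Set.Icc (C + 1) (C + 1 + k)) := by
      ext x
      simp only [Set.mem_Icc, Set.mem_insert_iff]
      omega
    rw [show C + 1 + k = C + (k + 1) by omega] at h1
    rcases h C with h | h
    · refine ⟨RelSeries.snoc s (f C) (h2 ▸ h), by simpa using h1, by simp, ?_⟩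
      rw [hI, Set.image_insert_eq, ← h3]
      ext x
      exact (RelSeries.mem_snoc (p := s) (rel := h2 ▸ h)).trans or_comm
    · refine ⟨s, h1, h2.trans h, ?_⟩
      rw [h3, hI, Set.image_insert_eq, Set.insert_eq_of_mem]
      exact ⟨C + 1, by simp, h⟩

end CompositionSeries

/-! ### Units and powers of ℓ in the local ring -/

section LocalRing

variable {R : Type*} [CommRing R] [IsLocalRing R] {ℓ : ℕ}

lemma mem_span_or_isUnit (hmax : IsLocalRing.maximalIdeal R = Ideal.span {(ℓ : R)}) (s : R) :
    s ∈ Ideal.span {(ℓ : R)} ∨ IsUnit s := by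
  rw [← hmax, IsLocalRing.mem_maximalIdeal, mem_nonunits_iff]
  exact (em _).symm

lemma isUnit_natCast (hℓ : ℓ.Prime) (hmax : IsLocalRing.maximalIdeal R = Ideal.span {(ℓ : R)})
    {m : ℕ} (h : ¬ ℓ ∣ m) : IsUnit (m : R) := by
  obtain ⟨x, y, hxy⟩ := (Nat.isCoprime_iff_coprime.2 ((hℓ.coprime_iff_not_dvd).2 h)).map
    (Int.castRingHom R)
  simp only [eq_intCast, Int.cast_natCast] at hxy
  refine (mem_span_or_isUnit hmax _).resolve_left fun hm => ?_
  refine (Ideal.ne_top_iff_one _).1 (IsLocalRing.maximalIdeal.isMaximal R).ne_top ?_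
  rw [hmax, ← hxy]
  exact add_mem (Ideal.mul_mem_left _ _ (Ideal.mem_span_singleton_self _))
    (Ideal.mul_mem_left _ _ hm)

variable [IsDomain R] [CharZero R]

lemma natCast_mem_span_pow_iff (hℓ : ℓ.Prime)
    (hmax : IsLocalRing.maximalIdeal R = Ideal.span {(ℓ : R)}) {m c : ℕ} (hm : m ≠ 0) :
    (m : R) ∈ Ideal.span {(ℓ : R) ^ c} ↔ c ≤ padicValNat ℓ m := by
  have := Fact.mk hℓ
  rw [Ideal.mem_span_singleton]
  constructor
  · intro h
    by_contra! hlt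
    obtain ⟨k, hk⟩ := pow_padicValNat_dvd (p := ℓ) (n := m)
    have hnd : ¬ ℓ ∣ k := fun ⟨t, ht⟩ => pow_succ_padicValNat_not_dvd hm
      ⟨t, by rw [pow_succ, mul_assoc, ← ht, ← hk]⟩
    have h1 : (ℓ : R) ^ padicValNat ℓ m * ℓ ∣ (ℓ : R) ^ padicValNat ℓ m * k := by
      rw [← pow_succ]
      refine (pow_dvd_pow _ hlt).trans ?_
      convert! h using 1
      conv_rhs => rw [hk]
      push_cast
      rfl
    have h0 : (ℓ : R) ≠ 0 := Nat.cast_ne_zero.2 hℓ.ne_zero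
    have h2 := isUnit_of_dvd_unit ((mul_dvd_mul_iff_left (pow_ne_zero _ h0)).1 h1)
      (isUnit_natCast hℓ hmax hnd)
    have h3 : (ℓ : R) ∈ IsLocalRing.maximalIdeal R :=
      hmax ▸ Ideal.mem_span_singleton_self _
    exact (IsLocalRing.mem_maximalIdeal _).1 h3 h2
  · intro h
    have := Nat.cast_dvd_cast (α := R) ((pow_dvd_pow ℓ h).trans pow_padicValNat_dvd)
    rwa [Nat.cast_pow] at this

end LocalRing

/-! ### Position of the vectors F_λ in the filtration of L -/

section Filtration

variable {R : Type*} [CommRing R] {F : Type*} [Field F] [Fintype F] {n ℓ : ℕ}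

lemma smul_mem_reduction (X : Submodule (resField R ℓ)[GLn F n] (reduction R F n ℓ)) (a : R[GLn F n])
    {x : reduction R F n ℓ} (hx : x ∈ X) : a • x ∈ X := by
  rw [← redHom_smul]
  exact X.smul_mem _ hx

lemma mem_span_singleton_reduction {x y : reduction R F n ℓ} :
    x ∈ Submodule.span (resField R ℓ)[GLn F n] {y} ↔ ∃ a : R[GLn F n], a • y = x := by
  rw [Submodule.mem_span_singleton]
  constructor
  · rintro ⟨a, rfl⟩
    obtain ⟨a, rfl⟩ := redHom_surjective R F n ℓ a
    exact ⟨a, (redHom_smul R F n ℓ a y).symm⟩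
  · rintro ⟨a, rfl⟩
    exact ⟨redHom R F n ℓ a, redHom_smul R F n ℓ a y⟩

lemma single_one_smul_eq_zero {s : R} (hs : s ∈ Ideal.span {(ℓ : R)}) (x : reduction R F n ℓ) :
    (MonoidAlgebra.single 1 s : R[GLn F n]) • x = 0 := by
  refine smul_eq_zero_of_redHom_eq_zero R F n ℓ ?_ x
  simp [Ideal.Quotient.eq_zero_iff_mem.2 hs]

lemma single_one_smul_mem_iff {s : R} (hs : IsUnit s)
    (X : Submodule (resField R ℓ)[GLn F n] (reduction R F n ℓ)) {x : reduction R F n ℓ} :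
    (MonoidAlgebra.single 1 s : R[GLn F n]) • x ∈ X ↔ x ∈ X := by
  refine ⟨fun h => ?_, smul_mem_reduction X _⟩
  obtain ⟨s, rfl⟩ := hs
  have := smul_mem_reduction X (MonoidAlgebra.single 1 ((s⁻¹ : Rˣ) : R)) h
  rwa [single_smul_single_smul, mul_one, Units.inv_mul, ← MonoidAlgebra.one_def, one_smul] at this

lemma exists_projElt_smul_reduction (ψ : AddChar F R) (b : Fin n → F) (x : reduction R F n ℓ) :
    ∃ s : R, projElt (lamOf ψ b) • x =
      (MonoidAlgebra.single 1 s : R[GLn F n]) • charVec ℓ (lamOf ψ b) := by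
  obtain ⟨x, rfl⟩ := toReduction_surjective R F n ℓ x
  obtain ⟨s, hs⟩ := exists_projElt_smul ψ b x
  exact ⟨s, by rw [← map_smul, hs, map_smul, charVec]⟩

lemma projElt_smul_charVec (lam : unitri F n →* Rˣ) : projElt lam • charVec ℓ lam =
    (MonoidAlgebra.single 1 (Nat.card (unitri F n) : R) : R[GLn F n]) • charVec ℓ lam := by
  rw [charVec, ← map_smul, projElt_smul_charElt, map_smul]

lemma isUnit_card_unitri (hq : IsUnit (Fintype.card F : R)) :
    IsUnit (Nat.card (unitri F n) : R) := by
  rw [card_unitri, Nat.cast_pow]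
  exact hq.pow _

lemma span_charVec_eq_of_support (ψ : AddChar F R) {b b' : Fin n → F}
    (h : ∀ i j : Fin n, (i : ℕ) + 1 = j → (b i ≠ 0 ↔ b' i ≠ 0)) :
    Submodule.span (resField R ℓ)[GLn F n] {charVec ℓ (lamOf ψ b)} =
      Submodule.span _ {charVec ℓ (lamOf ψ b')} := by
  have key : ∀ b b' : Fin n → F, (∀ i j : Fin n, (i : ℕ) + 1 = j → (b i ≠ 0 ↔ b' i ≠ 0)) →
      Submodule.span (resField R ℓ)[GLn F n] {charVec ℓ (lamOf ψ b')} ≤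
      Submodule.span _ {charVec ℓ (lamOf ψ b)} := by
    intro b b' h
    obtain ⟨a, ha⟩ := exists_charElt_eq_of_support ψ h
    rw [Submodule.span_singleton_le_iff_mem, mem_span_singleton_reduction]
    exact ⟨a, by rw [charVec, charVec, ha, map_smul]⟩
  exact le_antisymm (key _ _ fun i j hij => (h i j hij).symm) (key _ _ h)

lemma charElt_mem_latticeFilt [IsDomain R] [CharZero R] {ψ : AddChar F R}
    (hψ : ψ ≠ 1) {b : Fin n → F} {c : ℕ}
    (h : c ≤ padicValNat ℓ (parab F (Function.support b)).index) :
    charElt (lamOf ψ b) ∈ latticeFilt R F n ℓ c := by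
  intro x
  obtain ⟨s, hs⟩ := exists_projElt_smul ψ (-b) x
  rw [form_charElt hψ b hs]
  refine Ideal.mul_mem_left _ _ (Ideal.mem_span_singleton.2 ?_)
  have := Nat.cast_dvd_cast (α := R) ((pow_dvd_pow ℓ h).trans pow_padicValNat_dvd)
  rwa [Nat.cast_pow] at this

variable [IsLocalRing R]

lemma projElt_smul_eq_zero_or (hmax : IsLocalRing.maximalIdeal R = Ideal.span {(ℓ : R)})
    (ψ : AddChar F R) (b : Fin n → F) (x : reduction R F n ℓ) :
    projElt (lamOf ψ b) • x = 0 ∨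
      charVec ℓ (lamOf ψ b) ∈ Submodule.span (resField R ℓ)[GLn F n] {x} := by
  obtain ⟨s, hs⟩ := exists_projElt_smul_reduction ψ b x
  refine (mem_span_or_isUnit hmax s).imp (fun h => ?_) fun h => ?_
  · rw [hs, single_one_smul_eq_zero h]
  · rw [← single_one_smul_mem_iff h, ← hs]
    exact smul_mem_reduction _ _ (Submodule.mem_span_singleton_self _)

/-- Submodules of `L` are separated by the vectors `F_λ`. -/
lemma exists_charVec_mem_notMem [IsDomain R] (hq : IsUnit (Fintype.card F : R))
    (hmax : IsLocalRing.maximalIdeal R = Ideal.span {(ℓ : R)}) {ψ : AddChar F R} (hψ : ψ ≠ 1)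
    {X Y : Submodule (resField R ℓ)[GLn F n] (reduction R F n ℓ)} (hXY : X < Y) :
    ∃ b : Fin n → F, charVec ℓ (lamOf ψ b) ∈ Y ∧ charVec ℓ (lamOf ψ b) ∉ X := by
  let V := Y ⧸ X.submoduleOf Y
  -- The characters of `U` have values in `R`, so the quotient is regarded as an RG-module before an
  -- eigenvector is chosen.
  let _ : Module R[GLn F n] V := Module.compHom V (redHom R F n ℓ)
  have hV : ∀ (a : R[GLn F n]) (y : reduction R F n ℓ) (hy : y ∈ Y),
      a • (Submodule.Quotient.mk ⟨y, hy⟩ : V) =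
        Submodule.Quotient.mk ⟨a • y, smul_mem_reduction Y a hy⟩ := by
    intro a y hy
    change redHom R F n ℓ a • (Submodule.Quotient.mk ⟨y, hy⟩ : V) = _
    rw [← Submodule.Quotient.mk_smul]
    congr 1
    exact Subtype.ext (redHom_smul R F n ℓ a y)
  have hV0 : ∀ (y : reduction R F n ℓ) (hy : y ∈ Y),
      (Submodule.Quotient.mk ⟨y, hy⟩ : V) = 0 ↔ y ∈ X := fun y hy =>
    Submodule.Quotient.mk_eq_zero _
  have hnt : Nontrivial V := by
    obtain ⟨y, hy, hyX⟩ := Set.exists_of_ssubset hXY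
    exact ⟨⟨Submodule.Quotient.mk ⟨y, hy⟩, 0, fun h => hyX ((hV0 y hy).1 h)⟩⟩
  obtain ⟨b, v, hv, hb⟩ := exists_eigenvector (n := n) (V := V) hq hψ
  obtain ⟨⟨y, hy⟩, rfl⟩ := Submodule.Quotient.mk_surjective _ v
  have h1 : projElt (lamOf ψ b) • (Submodule.Quotient.mk ⟨y, hy⟩ : V) =
      (MonoidAlgebra.single 1 (Nat.card (unitri F n) : R) : R[GLn F n]) •
        (Submodule.Quotient.mk ⟨y, hy⟩ : V) := by
    classical
    rw [projElt, Finset.sum_smul, Finset.sum_congr rfl fun u _ => hb u, Finset.sum_const,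
      Finset.card_univ, ← Nat.cast_smul_eq_nsmul R[GLn F n], MonoidAlgebra.natCast_def,
      Nat.card_eq_fintype_card]
  -- Modulo `X` the projection multiplies the eigenvector by the unit |U|. In `L` itself its value
  -- is a multiple of F_λ, so F_λ lies in `Y` but not in `X`.
  have h2 : projElt (lamOf ψ b) • y ∉ X := by
    rw [← hV0 _ (smul_mem_reduction Y _ hy), ← hV _ _ hy, h1, hV _ _ hy, hV0,
      single_one_smul_mem_iff (isUnit_card_unitri hq), ← hV0 y hy]
    exact hv
  refine ⟨b, ?_, fun h => h2 ?_⟩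
  · have h3 := (projElt_smul_eq_zero_or hmax ψ b y).resolve_left fun h => h2 (h ▸ zero_mem _)
    exact (Submodule.span_singleton_le_iff_mem _ _).2 hy h3
  · obtain ⟨s, hs⟩ := exists_projElt_smul_reduction ψ b y
    rw [hs]
    exact smul_mem_reduction X _ h

variable [IsDomain R] [CharZero R] {ψ : AddChar F R}

/-- For the forward direction, a lift of F_λ in I(c) differs from E_λ by ℓ I, so its λ-component is
`s` times E_λ with `s` congruent to |U|, hence a unit. Pairing with E_{λ⁻¹} then shows that ℓ^c
divides the index. -/
lemma charVec_mem_reductionFilt_iff (hℓ : ℓ.Prime) (hq : IsUnit (Fintype.card F : R))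
    (hmax : IsLocalRing.maximalIdeal R = Ideal.span {(ℓ : R)}) (hψ : ψ ≠ 1)
    {b : Fin n → F} {c : ℕ} : charVec ℓ (lamOf ψ b) ∈ reductionFilt R F n ℓ c ↔
      c ≤ padicValNat ℓ (parab F (Function.support b)).index := by
  refine ⟨?_, fun h => ⟨_, charElt_mem_latticeFilt hψ h, rfl⟩⟩
  rintro ⟨y, hy, hyb⟩
  obtain ⟨z, hz⟩ := (Submodule.Quotient.eq (ellLattice R F n ℓ)).1 hyb
  obtain ⟨s, hs⟩ := exists_projElt_smul ψ b y
  obtain ⟨t, ht⟩ := exists_projElt_smul ψ b z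
  have h1 : s = Nat.card (unitri F n) + ℓ * t := by
    refine single_one_smul_charElt_injective (ψ := ψ) (b := b) ?_
    rw [← hs, eq_add_of_sub_eq' hz, smul_add, projElt_smul_charElt, MonoidAlgebra.single_add,
      add_smul, ← mul_smul, ← Nat.cast_comm, mul_smul, ht, MonoidAlgebra.natCast_def,
      ← mul_smul (MonoidAlgebra.single 1 (ℓ : R)), MonoidAlgebra.single_mul_single, mul_one]
  have h2 : IsUnit s := by
    refine (mem_span_or_isUnit hmax s).resolve_left fun h => ?_
    have h3 : (Nat.card (unitri F n) : R) ∈ Ideal.span {(ℓ : R)} := by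
      rw [eq_sub_of_add_eq h1.symm]
      exact sub_mem h (Ideal.mul_mem_right _ _ (Ideal.mem_span_singleton_self _))
    rw [← hmax] at h3
    exact (IsLocalRing.mem_maximalIdeal _).1 h3 (isUnit_card_unitri hq)
  have h3 := (latticeFilt R F n ℓ c).smul_mem (projElt (lamOf ψ b)) hy (charElt (lamOf ψ (-b)))
  rw [hs, form_single_one_smul, form_charElt_charElt_inv hψ, ← mul_assoc,
    Ideal.unit_mul_mem_iff_mem _ (h2.mul (isUnit_card_unitri hq))] at h3
  exact (natCast_mem_span_pow_iff hℓ hmax Subgroup.index_ne_zero_of_finite).1 h3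

/-- If `a` sends F_λ to F_μ modulo L(c + 1), the μ-component of a E_λ has a unit coefficient `s`,
for otherwise F_μ would lie in L(c + 1). The adjoint operator sends E_{μ⁻¹} to an element with
λ⁻¹-coefficient `t`, and adjointness relates s [G : P(μ)] to t [G : P(λ)] up to units. Equal
valuations make `t` a unit, and a torus element replaces the inverse characters by λ and μ. -/
lemma charVec_mem_span_symm (hℓ : ℓ.Prime) (hq : IsUnit (Fintype.card F : R))
    (hmax : IsLocalRing.maximalIdeal R = Ideal.span {(ℓ : R)}) (hψ : ψ ≠ 1)
    {b b' : Fin n → F} {c : ℕ} (hb : padicValNat ℓ (parab F (Function.support b)).index = c)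
    (hb' : padicValNat ℓ (parab F (Function.support b')).index = c)
    (h : charVec ℓ (lamOf ψ b') ∈ Submodule.span (resField R ℓ)[GLn F n]
      {charVec ℓ (lamOf ψ b)} ⊔ reductionFilt R F n ℓ (c + 1)) :
    charVec ℓ (lamOf ψ b) ∈
      Submodule.span (resField R ℓ)[GLn F n] {charVec ℓ (lamOf ψ b')} := by
  obtain ⟨y, hy, z, hz, hyz⟩ := Submodule.mem_sup.1 h
  obtain ⟨a, rfl⟩ := mem_span_singleton_reduction.1 hy
  obtain ⟨s, hs⟩ := exists_projElt_smul ψ b' (a • charElt (lamOf ψ b))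
  have hsu : IsUnit s := by
    refine (mem_span_or_isUnit hmax s).resolve_left fun hs0 => ?_
    have h1 := congrArg (fun x => projElt (lamOf ψ b') • x) hyz
    simp only [smul_add] at h1
    rw [projElt_smul_charVec, charVec, ← map_smul, ← map_smul, hs, map_smul] at h1
    have h2 : (MonoidAlgebra.single 1 s : R[GLn F n]) •
      toReduction R F n ℓ (charElt (lamOf ψ b')) = 0 := single_one_smul_eq_zero hs0 _
    rw [h2, zero_add] at h1
    have h3 : charVec ℓ (lamOf ψ b') ∈ reductionFilt R F n ℓ (c + 1) := by
      rw [← single_one_smul_mem_iff (isUnit_card_unitri (n := n) hq), ← h1]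
      exact smul_mem_reduction _ _ hz
    have := (charVec_mem_reductionFilt_iff hℓ hq hmax hψ).1 h3
    omega
  obtain ⟨a', ha'⟩ := exists_adjoint (n := n) (F := F) (projElt (lamOf ψ b') * a)
  obtain ⟨t, ht⟩ := exists_projElt_smul ψ (-b) (a' • charElt (lamOf ψ (-b')))
  have hform := ha' (charElt (lamOf ψ b)) (charElt (lamOf ψ (-b')))
  rw [mul_smul, hs, form_single_one_smul, form_charElt_charElt_inv hψ, form_charElt hψ b ht,
    ← mul_assoc] at hform
  have htu : IsUnit t := by
    refine (mem_span_or_isUnit hmax t).resolve_left fun ht0 => ?_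
    have h1 : ((parab F (Function.support b')).index : R) ∈ Ideal.span {(ℓ : R) ^ (c + 1)} := by
      rw [← Ideal.unit_mul_mem_iff_mem _ (hsu.mul (isUnit_card_unitri (n := n) hq)), hform,
        pow_succ']
      have h2 : ((parab F (Function.support b)).index : R) ∈ Ideal.span {(ℓ : R) ^ c} :=
        (natCast_mem_span_pow_iff hℓ hmax Subgroup.index_ne_zero_of_finite).2 hb.ge
      rw [Ideal.mem_span_singleton] at ht0 h2 ⊢
      exact mul_dvd_mul ht0 h2
    have := (natCast_mem_span_pow_iff hℓ hmax Subgroup.index_ne_zero_of_finite).1 h1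
    omega
  have hneg : ∀ b : Fin n → F, Submodule.span (resField R ℓ)[GLn F n]
      {charVec ℓ (lamOf ψ (-b))} = Submodule.span _ {charVec ℓ (lamOf ψ b)} := fun b =>
    span_charVec_eq_of_support ψ fun i _ _ => by simp
  rw [← hneg b', ← Submodule.span_singleton_le_iff_mem, ← hneg b,
    Submodule.span_singleton_le_iff_mem, ← single_one_smul_mem_iff htu]
  have h1 := congrArg (toReduction R F n ℓ) ht
  rw [map_smul, map_smul, map_smul] at h1
  change _ • toReduction R F n ℓ (charElt (lamOf ψ (-b))) ∈ _
  rw [← h1]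
  exact smul_mem_reduction _ _ (smul_mem_reduction _ _ (Submodule.mem_span_singleton_self _))

end Filtration

/-! ### Generation and inclusion in a subquotient -/

section Subquotients

open Submodule

variable {A M : Type*} [Ring A] [AddCommGroup M] [Module A M] {B C : Submodule A M}

lemma subquotient_mk_mem_span_iff {v w : M} {hv : v ∈ C} {hw : w ∈ C} :
    (Submodule.Quotient.mk ⟨v, hv⟩ : C ⧸ B.submoduleOf C) ∈ span A {Submodule.Quotient.mk ⟨w, hw⟩} ↔
      v ∈ span A {w} ⊔ B := by
  rw [mem_span_singleton, mem_sup]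
  constructor
  · rintro ⟨a, ha⟩
    rw [← Submodule.Quotient.mk_smul, eq_comm, Submodule.Quotient.eq] at ha
    exact ⟨a • w, smul_mem _ _ (mem_span_singleton_self _), _, ha, add_sub_cancel _ _⟩
  · rintro ⟨y, hy, z, hz, rfl⟩
    obtain ⟨a, rfl⟩ := mem_span_singleton.1 hy
    refine ⟨a, ?_⟩
    rw [← Submodule.Quotient.mk_smul, eq_comm, Submodule.Quotient.eq]
    change a • w + z - a • w ∈ B
    rwa [add_sub_cancel_left]

lemma smul_subquotient_mk_eq_zero_iff {a : A} {v : M} {hv : v ∈ C} :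
    a • (Submodule.Quotient.mk ⟨v, hv⟩ : C ⧸ B.submoduleOf C) = 0 ↔ a • v ∈ B := by
  rw [← Submodule.Quotient.mk_smul]
  exact Submodule.Quotient.mk_eq_zero _

lemma exists_lt_of_subquotient_lt (hBC : B ≤ C) {X Y : Submodule A (C ⧸ B.submoduleOf C)}
    (h : X < Y) : ∃ X' Y' : Submodule A M, X' < Y' ∧ B ≤ X' ∧ Y' ≤ C ∧
      (∀ v (hv : v ∈ C), Submodule.Quotient.mk ⟨v, hv⟩ ∈ X ↔ v ∈ X') ∧
      ∀ v (hv : v ∈ C), Submodule.Quotient.mk ⟨v, hv⟩ ∈ Y ↔ v ∈ Y' := by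
  let φ : Submodule A (C ⧸ B.submoduleOf C) → Submodule A M := fun X =>
    (X.comap (B.submoduleOf C).mkQ).map C.subtype
  have hφ : ∀ X v (hv : v ∈ C), Submodule.Quotient.mk ⟨v, hv⟩ ∈ X ↔ v ∈ φ X := by
    intro X v hv
    refine ⟨fun h => ⟨⟨v, hv⟩, h, rfl⟩, ?_⟩
    rintro ⟨⟨w, hw⟩, h, rfl⟩
    exact h
  refine ⟨φ X, φ Y, map_strictMono_of_injective (injective_subtype _)
    (comap_strictMono_of_surjective (mkQ_surjective _) h), fun v hv => ?_, ?_, hφ X, hφ Y⟩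
  · rw [← hφ X v (hBC hv), show (Submodule.Quotient.mk ⟨v, hBC hv⟩ : C ⧸ B.submoduleOf C) = 0 from
      (Submodule.Quotient.mk_eq_zero _).2 hv]
    exact zero_mem _
  · rintro _ ⟨⟨w, hw⟩, -, rfl⟩
    exact hw

end Subquotients

/-! ### Parabolic subgroups and supports of characters -/

section Factors

variable {F : Type*} [Field F] {n : ℕ}

lemma parab_support_indic_refls {P : Subgroup (GLn F n)} (hP : IsStandardParabolic F n P) :
    parab F (Function.support (indic F (refls P))) = P := by
  rw [support_indic, parab_refls hP]

lemma parab_inj {J J' : Set (Fin n)} (h : parab F J = parab F J') {i j : Fin n}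
    (hij : (i : ℕ) + 1 = j) : i ∈ J ↔ i ∈ J' := by
  rw [← perm_swap_mem_parab (F := F) hij, h, perm_swap_mem_parab hij]

lemma parabolicOf_lamOf_indic_refls [Finite F] {R : Type*} [CommRing R] {ψ : AddChar F R}
    (hψ : ψ ≠ 1) {P : Subgroup (GLn F n)} (hP : IsStandardParabolic F n P) :
    parabolicOf (lamOf ψ (indic F (refls P))) = P := by
  rw [parabolicOf_lamOf hψ, support_indic, parab_refls hP]

end Factors

/-! ### The images of the F_λ in M(c) -/

section Factors

variable {R : Type*} [CommRing R] [IsDomain R] [CharZero R] {F : Type*} [Field F] [Fintype F] {n ℓ : ℕ}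
  {ψ : AddChar F R}

lemma span_charVec_eq_of_parabolicOf (hψ : ψ ≠ 1) {lam lam' : unitri F n →* Rˣ}
    (h : parabolicOf lam = parabolicOf lam') :
    Submodule.span (resField R ℓ)[GLn F n] {charVec ℓ lam} =
      Submodule.span _ {charVec ℓ lam'} := by
  obtain ⟨b, rfl⟩ := exists_eq_lamOf hψ lam
  obtain ⟨b', rfl⟩ := exists_eq_lamOf hψ lam'
  rw [parabolicOf_lamOf hψ, parabolicOf_lamOf hψ] at h
  exact span_charVec_eq_of_support ψ fun i j hij => parab_inj h hij

lemma parabolicSubmodule_eq (hψ : ψ ≠ 1) (lam : unitri F n →* Rˣ) :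
    parabolicSubmodule R ℓ (parabolicOf lam) =
      Submodule.span (resField R ℓ)[GLn F n] {charVec ℓ lam} := by
  refine le_antisymm (Submodule.span_le.2 ?_) (Submodule.span_mono ?_)
  · rintro _ ⟨lam', h, rfl⟩
    rw [← span_charVec_eq_of_parabolicOf hψ h]
    exact Submodule.mem_span_singleton_self _
  · rintro _ rfl
    exact ⟨lam, rfl, rfl⟩

lemma charVec_mem_reductionFilt (hψ : ψ ≠ 1) {b : Fin n → F} {c : ℕ}
    (h : c ≤ padicValNat ℓ (parab F (Function.support b)).index) :
    charVec ℓ (lamOf ψ b) ∈ reductionFilt R F n ℓ c :=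
  ⟨_, charElt_mem_latticeFilt hψ h, rfl⟩

/-- The image of `F_λ` in `M(c)`, for `λ` in `L(c)`. -/
def factorVec (hψ : ψ ≠ 1) (c : ℕ)
    (b : {b : Fin n → F // padicValNat ℓ (parab F (Function.support b)).index = c}) :
    factor R F n ℓ c :=
  Submodule.Quotient.mk ⟨charVec ℓ (lamOf ψ b), charVec_mem_reductionFilt hψ b.2.ge⟩

lemma parabolicFactor_eq (hψ : ψ ≠ 1) (c : ℕ)
    (b : {b : Fin n → F // padicValNat ℓ (parab F (Function.support b)).index = c}) :
    parabolicFactor R ℓ c (parab F (Function.support (b : Fin n → F))) =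
      Submodule.span _ {factorVec hψ c b} := by
  rw [parabolicFactor, ← parabolicOf_lamOf hψ, parabolicSubmodule_eq hψ]
  apply le_antisymm
  · rintro _ ⟨⟨x, hxc⟩, hx, rfl⟩
    obtain ⟨y, hy, z, hz, hyz⟩ := Submodule.mem_sup.1 (show x ∈ _ ⊔ _ from hx)
    obtain ⟨a, rfl⟩ := Submodule.mem_span_singleton.1 hy
    refine Submodule.mem_span_singleton.2 ⟨a, ?_⟩
    rw [factorVec, ← Submodule.Quotient.mk_smul]
    refine ((Submodule.Quotient.eq _).2 ?_).symm
    change x - a • charVec ℓ (lamOf ψ b) ∈ reductionFilt R F n ℓ (c + 1)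
    rwa [← hyz, add_sub_cancel_left]
  · rw [Submodule.span_singleton_le_iff_mem]
    exact ⟨_, Submodule.mem_sup_left (Submodule.mem_span_singleton_self _), rfl⟩

lemma reductionFilt_succ_le (c : ℕ) :
    reductionFilt R F n ℓ (c + 1) ≤ reductionFilt R F n ℓ c := by
  rintro _ ⟨y, hy, rfl⟩
  exact ⟨y, fun z => Ideal.span_singleton_le_span_singleton.2 (pow_dvd_pow _ c.le_succ) (hy z), rfl⟩

lemma reductionFilt_zero : reductionFilt R F n ℓ 0 = ⊤ := by
  refine eq_top_iff.2 fun x _ => ?_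
  obtain ⟨y, rfl⟩ := toReduction_surjective R F n ℓ x
  exact ⟨y, fun z => by simp, rfl⟩

variable [IsLocalRing R]

/-- A vector F_λ that witnesses a strict inclusion between L(c + 1) and L(c) lies in L(c) but not in
L(c + 1), so the valuation of its index is exactly `c`. This is why the family is indexed by these λ
alone. -/
lemma isEigensystem_factorVec (hℓ : ℓ.Prime) (hq : IsUnit (Fintype.card F : R))
    (hmax : IsLocalRing.maximalIdeal R = Ideal.span {(ℓ : R)}) (hψ : ψ ≠ 1) (c : ℕ) :
    IsEigensystem (factorVec (n := n) (ℓ := ℓ) hψ c)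
      fun b => redHom R F n ℓ (projElt (lamOf ψ b)) where
  exists_mem_notMem X Y hXY := by
    obtain ⟨X', Y', hlt, hB, hC, hX, hY⟩ :=
      exists_lt_of_subquotient_lt (reductionFilt_succ_le c) hXY
    obtain ⟨b, hbY, hbX⟩ := exists_charVec_mem_notMem hq hmax hψ hlt
    have h1 : ¬ c + 1 ≤ padicValNat ℓ (parab F (Function.support b)).index := by
      rw [← charVec_mem_reductionFilt_iff hℓ hq hmax hψ]
      exact fun h => hbX (hB h)
    have h2 := (charVec_mem_reductionFilt_iff hℓ hq hmax hψ).1 (hC hbY)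
    exact ⟨⟨b, by omega⟩, (hY _ _).2 hbY, fun h => hbX ((hX _ _).1 h)⟩
  smul_eq_zero_or b x := by
    obtain ⟨⟨x, hx⟩, rfl⟩ := Submodule.Quotient.mk_surjective _ x
    refine (projElt_smul_eq_zero_or hmax ψ b x).imp (fun h => ?_) fun h => ?_
    · rw [smul_subquotient_mk_eq_zero_iff, redHom_smul, h]
      exact zero_mem _
    · exact subquotient_mk_mem_span_iff.2 (Submodule.mem_sup_left h)
  smul_self_ne_zero b h := by
    rw [factorVec, smul_subquotient_mk_eq_zero_iff, redHom_smul, projElt_smul_charVec,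
      single_one_smul_mem_iff (isUnit_card_unitri hq),
      charVec_mem_reductionFilt_iff hℓ hq hmax hψ, b.2] at h
    omega
  symm b' b h := by
    have h1 := charVec_mem_span_symm hℓ hq hmax hψ b.2 b'.2 (subquotient_mk_mem_span_iff.1 h)
    exact subquotient_mk_mem_span_iff.2 (Submodule.mem_sup_left h1)

/-- A non-zero term contains some F_λ, and the valuation of an index is at most that of |G|. -/
lemma reductionFilt_eq_bot (hℓ : ℓ.Prime) (hq : IsUnit (Fintype.card F : R))
    (hmax : IsLocalRing.maximalIdeal R = Ideal.span {(ℓ : R)}) (hψ : ψ ≠ 1) :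
    reductionFilt R F n ℓ (padicValNat ℓ (Nat.card (GLn F n)) + 1) = ⊥ := by
  by_contra hne
  obtain ⟨b, hb, -⟩ := exists_charVec_mem_notMem hq hmax hψ (bot_lt_iff_ne_bot.2 hne)
  have h1 := (charVec_mem_reductionFilt_iff hℓ hq hmax hψ).1 hb
  have := Fact.mk hℓ
  have h2 := (padicValNat_dvd_iff_le Nat.card_pos.ne').1
    ((pow_padicValNat_dvd (p := ℓ)).trans (Subgroup.index_dvd_card (parab F (Function.support b))))
  omega

end Factors

/-! ### Valuations of q^x - 1 -/

section Valuations

lemma dvd_geomSum_iff {ℓ Q t : ℕ} (h : Q ≡ 1 [MOD ℓ]) :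
    ℓ ∣ ∑ j ∈ Finset.range t, Q ^ j ↔ ℓ ∣ t := by
  have h1 : ∑ j ∈ Finset.range t, Q ^ j ≡ t [MOD ℓ] := by
    refine (Nat.ModEq.sum fun j _ => (h.pow j)).trans ?_
    simp [Nat.ModEq.refl]
  exact h1.dvd_iff dvd_rfl

variable {ℓ q : ℕ} [hℓ : Fact ℓ.Prime]

lemma padicValNat_add_of_lt {a b : ℕ} (ha : a ≠ 0) (h : padicValNat ℓ a < padicValNat ℓ b) :
    padicValNat ℓ (a + b) = padicValNat ℓ a := by
  have hab : a + b ≠ 0 := by omega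
  apply le_antisymm
  · by_contra! hlt
    have h1 : ℓ ^ (padicValNat ℓ a + 1) ∣ a + b := (pow_dvd_pow _ hlt).trans pow_padicValNat_dvd
    have h2 : ℓ ^ (padicValNat ℓ a + 1) ∣ b := (pow_dvd_pow _ h).trans pow_padicValNat_dvd
    exact pow_succ_padicValNat_not_dvd ha ((Nat.dvd_add_left h2).1 h1)
  · rw [← padicValNat_dvd_iff_le hab]
    exact dvd_add pow_padicValNat_dvd ((pow_dvd_pow _ h.le).trans pow_padicValNat_dvd)

/-- The ultrametric inequality for q^(x+r) - 1 = q^r (q^x - 1) + (q^r - 1). -/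
lemma padicValNat_pow_add_sub_one (hq : 2 ≤ q) (hℓq : ¬ ℓ ∣ q) {x r : ℕ} (hx : x ≠ 0)
    (h : padicValNat ℓ (q ^ x - 1) < padicValNat ℓ (q ^ r - 1)) :
    padicValNat ℓ (q ^ (x + r) - 1) = padicValNat ℓ (q ^ x - 1) := by
  have h1 : 1 < q ^ x := Nat.one_lt_pow hx hq
  have h2 : 0 < q ^ r := pow_pos (by omega) r
  have h3 : q ^ (x + r) - 1 = q ^ r * (q ^ x - 1) + (q ^ r - 1) := by
    rw [Nat.mul_sub_one, pow_add, mul_comm]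
    have : q ^ r ≤ q ^ r * q ^ x := Nat.le_mul_of_pos_right _ (by omega)
    omega
  have h4 : padicValNat ℓ (q ^ r * (q ^ x - 1)) = padicValNat ℓ (q ^ x - 1) := by
    rw [padicValNat.mul h2.ne' (by omega), padicValNat.eq_zero_of_not_dvd
      fun h => hℓq (hℓ.out.dvd_of_dvd_pow h), zero_add]
  rw [h3, padicValNat_add_of_lt (mul_ne_zero h2.ne' (by omega)) (h4.trans_lt h), h4]

lemma padicValNat_pow_mul_sub_one (hq : 2 ≤ q) {r t : ℕ} (hr : r ≠ 0) (ht : t ≠ 0) :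
    padicValNat ℓ (q ^ (r * t) - 1) =
      padicValNat ℓ (q ^ r - 1) + padicValNat ℓ (∑ j ∈ Finset.range t, (q ^ r) ^ j) := by
  have h1 : 1 < q ^ r := Nat.one_lt_pow hr hq
  have h2 := geom_sum_mul_of_one_le h1.le t
  have h3 : 1 < (q ^ r) ^ t := Nat.one_lt_pow ht h1
  have h4 : ∑ j ∈ Finset.range t, (q ^ r) ^ j ≠ 0 := by
    intro h
    rw [h, zero_mul] at h2
    omega
  rw [pow_mul, ← h2, mul_comm, padicValNat.mul (by omega) h4]

lemma padicValNat_pow_sub_one_le (hq : 2 ≤ q) {r t : ℕ} (hr : r ≠ 0) (ht : t ≠ 0) :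
    padicValNat ℓ (q ^ r - 1) ≤ padicValNat ℓ (q ^ (r * t) - 1) := by
  rw [padicValNat_pow_mul_sub_one hq hr ht]
  exact Nat.le_add_right _ _

end Valuations

/-! ### The number e and the ℓ-part of |GL_m| -/

section Valuations

variable {F : Type*} [Field F] [Fintype F] {ℓ : ℕ}

lemma not_dvd_of_lt_eNum {k : ℕ} (h2 : 2 ≤ k) (h : k < eNum F ℓ) :
    ¬ ℓ ∣ ∑ j ∈ Finset.range k, Fintype.card F ^ j := by
  rw [Nat.geomSum_eq Fintype.one_lt_card, ← Nat.card_eq_fintype_card]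
  exact fun hd => Nat.notMem_of_lt_sInf h ⟨h2, hd⟩

variable [hℓ : Fact ℓ.Prime]

lemma eNum_spec (hℓF : ¬ ℓ ∣ Fintype.card F)
    : 2 ≤ eNum F ℓ ∧
    ℓ ∣ ∑ j ∈ Finset.range (eNum F ℓ), Fintype.card F ^ j := by
  have hq : 2 ≤ Fintype.card F := Fintype.one_lt_card
  have hne : {i : ℕ | 2 ≤ i ∧ ℓ ∣ (Nat.card F ^ i - 1) / (Nat.card F - 1)}.Nonempty := by
    have h2 := hℓ.out.two_le
    -- A witness is needed because the infimum of an empty set would be the default 0. By Fermat,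
    -- q^(ℓ-1) ≡ 1, so the geometric sum of length ℓ in q^(ℓ-1) is divisible by ℓ. It is a factor of
    -- the sum of length (ℓ-1)ℓ in q.
    refine ⟨(ℓ - 1) * ℓ, by nlinarith [Nat.sub_add_cancel (show 1 ≤ ℓ by omega)], ?_⟩
    rw [Nat.card_eq_fintype_card, ← Nat.geomSum_eq hq]
    have h1 : Fintype.card F ^ (ℓ - 1) ≡ 1 [MOD ℓ] := by
      have := Nat.ModEq.pow_totient ((hℓ.out.coprime_iff_not_dvd.2 hℓF).symm)
      rwa [Nat.totient_prime hℓ.out] at this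
    have h3 : ∑ j ∈ Finset.range ((ℓ - 1) * ℓ), Fintype.card F ^ j =
        (∑ j ∈ Finset.range (ℓ - 1), Fintype.card F ^ j) *
          ∑ j ∈ Finset.range ℓ, (Fintype.card F ^ (ℓ - 1)) ^ j := by
      refine Nat.eq_of_mul_eq_mul_right (show 0 < Fintype.card F - 1 by omega) ?_
      rw [geom_sum_mul_of_one_le (by omega), mul_right_comm, geom_sum_mul_of_one_le (by omega),
        mul_comm (Fintype.card F ^ (ℓ - 1) - 1), geom_sum_mul_of_one_le (Nat.one_le_pow _ _ Fintype.card_pos),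
        pow_mul]
    rw [h3]
    exact ((dvd_geomSum_iff h1).2 dvd_rfl).mul_left _
  have := Nat.sInf_mem hne
  refine ⟨this.1, ?_⟩
  rw [Nat.geomSum_eq hq, ← Nat.card_eq_fintype_card]
  exact this.2

lemma padicValNat_of_lt_eNum {k : ℕ} (hk : k ≠ 0) (h : k < eNum F ℓ) :
    padicValNat ℓ (Fintype.card F ^ k - 1) = padicValNat ℓ (Fintype.card F ^ 1 - 1) := by
  obtain rfl | h2 : k = 1 ∨ 2 ≤ k := by omega
  · rfl
  · have := padicValNat_pow_mul_sub_one (ℓ := ℓ) (Fintype.one_lt_card (α := F)) one_ne_zero hk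
    rw [one_mul, pow_one, padicValNat.eq_zero_of_not_dvd (not_dvd_of_lt_eNum h2 h), add_zero]
      at this
    rw [this, pow_one]

lemma padicValNat_one_lt_eNum (hℓF : ¬ ℓ ∣ Fintype.card F)
    : padicValNat ℓ (Fintype.card F ^ 1 - 1) <
    padicValNat ℓ (Fintype.card F ^ eNum F ℓ - 1) := by
  obtain ⟨h1, h2⟩ := eNum_spec hℓF
  have h3 := padicValNat_pow_mul_sub_one (ℓ := ℓ) (Fintype.one_lt_card (α := F)) one_ne_zero
    (show eNum F ℓ ≠ 0 by omega)
  rw [one_mul] at h3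
  rw [h3, pow_one]
  refine Nat.lt_add_of_pos_right (Nat.pos_of_ne_zero ?_)
  refine (dvd_iff_padicValNat_ne_zero ?_).1 h2
  exact (Finset.sum_pos (fun _ _ => pow_pos Fintype.card_pos _)
    (Finset.nonempty_range_iff.2 (by omega))).ne'

lemma pow_eNum_modEq (hℓF : ¬ ℓ ∣ Fintype.card F)
    {s : ℕ} : Fintype.card F ^ (eNum F ℓ * s) ≡ 1 [MOD ℓ] := by
  have h : Fintype.card F ^ eNum F ℓ ≡ 1 [MOD ℓ] := by
    refine ((Nat.modEq_iff_dvd' (Nat.one_le_pow _ _ Fintype.card_pos)).2 ?_).symm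
    rw [← geom_sum_mul_of_one_le Fintype.card_pos]
    exact (eNum_spec hℓF).2.mul_right _
  rw [pow_mul]
  simpa using h.pow s

lemma padicValNat_mul_of_not_dvd (hℓF : ¬ ℓ ∣ Fintype.card F)
    {s t : ℕ} (hs : s ≠ 0) (ht : ¬ ℓ ∣ t) :
    padicValNat ℓ (Fintype.card F ^ (eNum F ℓ * s * t) - 1) =
      padicValNat ℓ (Fintype.card F ^ (eNum F ℓ * s) - 1) := by
  have h1 := (eNum_spec hℓF).1
  rw [padicValNat_pow_mul_sub_one (Fintype.one_lt_card (α := F))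
    (mul_ne_zero (by omega) hs) (by rintro rfl; simp at ht), padicValNat.eq_zero_of_not_dvd
      (n := ∑ j ∈ Finset.range t, _), add_zero]
  rwa [dvd_geomSum_iff (pow_eNum_modEq hℓF)]

lemma padicValNat_lt_mul_prime (hℓF : ¬ ℓ ∣ Fintype.card F)
    {s : ℕ} (hs : s ≠ 0) :
    padicValNat ℓ (Fintype.card F ^ (eNum F ℓ * s) - 1) <
      padicValNat ℓ (Fintype.card F ^ (eNum F ℓ * s * ℓ) - 1) := by
  have h1 := (eNum_spec hℓF).1
  rw [padicValNat_pow_mul_sub_one (Fintype.one_lt_card (α := F))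
    (mul_ne_zero (by omega) hs) hℓ.out.ne_zero]
  refine Nat.lt_add_of_pos_right (Nat.pos_of_ne_zero ?_)
  refine (dvd_iff_padicValNat_ne_zero ?_).1 ((dvd_geomSum_iff (pow_eNum_modEq hℓF)).2 dvd_rfl)
  exact (Finset.sum_pos (fun _ _ => pow_pos (pow_pos Fintype.card_pos _) _)
    (Finset.nonempty_range_iff.2 hℓ.out.ne_zero)).ne'

/-- Induction on `i`. For i = 0 the remainder of `x` modulo e determines the valuation, which is
that of q - 1. In the step, either the induction hypothesis applies, or `x` is e ℓ^i times a number
prime to ℓ and the valuation is that at e ℓ^i. The valuation at e ℓ^(i+1) is strictly larger in both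
cases. -/
lemma padicValNat_lt_of_not_dvd (hℓF : ¬ ℓ ∣ Fintype.card F)
    (i : ℕ) {x : ℕ} (h : ¬ eNum F ℓ * ℓ ^ i ∣ x) :
    padicValNat ℓ (Fintype.card F ^ x - 1) <
      padicValNat ℓ (Fintype.card F ^ (eNum F ℓ * ℓ ^ i) - 1) := by
  have he := (eNum_spec hℓF).1
  have hq : 2 ≤ Fintype.card F := Fintype.one_lt_card
  induction i with
  | zero =>
    rw [pow_zero, mul_one] at h ⊢
    have hz : x % eNum F ℓ ≠ 0 := fun hz => h (Nat.dvd_of_mod_eq_zero hz)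
    have hlt := Nat.mod_lt x (show 0 < eNum F ℓ by omega)
    have h1 := padicValNat_of_lt_eNum hz hlt
    have h2 := padicValNat_one_lt_eNum hℓF
    rcases Nat.eq_zero_or_pos (x / eNum F ℓ) with h0 | h0
    · rw [← Nat.mod_add_div x (eNum F ℓ), h0, mul_zero, add_zero, h1]
      exact h2
    · rw [← Nat.mod_add_div x (eNum F ℓ), padicValNat_pow_add_sub_one hq hℓF hz, h1]
      · exact h2
      · rw [h1]
        exact h2.trans_le (padicValNat_pow_sub_one_le hq (by omega) h0.ne')
  | succ i ih =>
    have hs : ℓ ^ i ≠ 0 := pow_ne_zero _ hℓ.out.ne_zero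
    have h1 := padicValNat_lt_mul_prime (F := F) hℓF hs
    rw [pow_succ, ← mul_assoc] at h ⊢
    by_cases hd : eNum F ℓ * ℓ ^ i ∣ x
    · obtain ⟨t, rfl⟩ := hd
      rwa [padicValNat_mul_of_not_dvd hℓF hs fun ht => h (mul_dvd_mul_left _ ht)]
    · exact (ih hd).trans h1

/-- The exponent of `ℓ` in the order of `GL_m(F)`. -/
def glVal (F : Type*) [Field F] [Fintype F] (ℓ m : ℕ) : ℕ :=
  ∑ k ∈ Finset.range m, padicValNat ℓ (Fintype.card F ^ (k + 1) - 1)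

lemma glVal_add_one {m : ℕ} (h : m + 1 < eNum F ℓ) :
    glVal F ℓ (m + 1) = glVal F ℓ m + glVal F ℓ 1 := by
  rw [glVal, Finset.sum_range_succ, padicValNat_of_lt_eNum (by omega) h, glVal, glVal,
    Finset.sum_range_one]

/-- In this range, raising the exponent `k` of q^k - 1 by e ℓ^i does not change the valuation for 1
≤ k ≤ m, so the new factors repeat the first `m`. -/
lemma glVal_add_eNum (hℓF : ¬ ℓ ∣ Fintype.card F)
    (i : ℕ) {m : ℕ}
    (h : m + eNum F ℓ * ℓ ^ i < eNum F ℓ * ℓ ^ (i + 1)) :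
    glVal F ℓ (m + eNum F ℓ * ℓ ^ i) = glVal F ℓ m + glVal F ℓ (eNum F ℓ * ℓ ^ i) := by
  have hs : ℓ ^ i ≠ 0 := pow_ne_zero _ hℓ.out.ne_zero
  have he := (eNum_spec hℓF).1
  induction m with
  | zero => simp [glVal]
  | succ m ih =>
    have h1 : glVal F ℓ (m + 1 + eNum F ℓ * ℓ ^ i) = glVal F ℓ (m + eNum F ℓ * ℓ ^ i) +
        padicValNat ℓ (Fintype.card F ^ (m + 1 + eNum F ℓ * ℓ ^ i) - 1) := by
      rw [add_right_comm, glVal, Finset.sum_range_succ, add_right_comm m]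
      rfl
    have h2 : glVal F ℓ (m + 1) = glVal F ℓ m +
        padicValNat ℓ (Fintype.card F ^ (m + 1) - 1) := Finset.sum_range_succ _ _
    have h3 : padicValNat ℓ (Fintype.card F ^ (m + 1 + eNum F ℓ * ℓ ^ i) - 1) =
        padicValNat ℓ (Fintype.card F ^ (m + 1) - 1) := by
      by_cases hd : eNum F ℓ * ℓ ^ i ∣ m + 1
      · obtain ⟨t, ht⟩ := hd
        rw [ht, ← Nat.mul_succ] at h ⊢
        rw [pow_succ, ← mul_assoc] at h
        -- Both multipliers `t` and `t + 1` are then prime to ℓ, so both exponents have the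
        -- valuation at e ℓ^i.
        have htl : t + 1 < ℓ := lt_of_mul_lt_mul_left' h
        have ht0 : t ≠ 0 := by rintro rfl; simp at ht
        rw [padicValNat_mul_of_not_dvd hℓF hs (Nat.not_dvd_of_pos_of_lt (by omega) htl),
          padicValNat_mul_of_not_dvd hℓF hs (Nat.not_dvd_of_pos_of_lt (by omega) (by omega))]
      · exact padicValNat_pow_add_sub_one Fintype.one_lt_card hℓF (by omega)
          (padicValNat_lt_of_not_dvd hℓF i hd)
    rw [h1, h2, h3, ih (by omega)]
    omega

lemma exists_glVal_split (hℓF : ¬ ℓ ∣ Fintype.card F)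
    {m : ℕ} (hm : m ≠ 0)
    (h : ¬ (m = 1 ∨ ∃ i : ℕ, m = eNum F ℓ * ℓ ^ i)) :
    ∃ x y : ℕ, x ≠ 0 ∧ y ≠ 0 ∧ m = x + y ∧ glVal F ℓ m = glVal F ℓ x + glVal F ℓ y := by
  have he := (eNum_spec hℓF).1
  push Not at h
  by_cases hlt : m < eNum F ℓ
  · obtain ⟨k, rfl⟩ : ∃ k, m = k + 1 := ⟨m - 1, by omega⟩
    exact ⟨k, 1, by omega, one_ne_zero, rfl, glVal_add_one hlt⟩
  · have hex : ∃ i, m < eNum F ℓ * ℓ ^ (i + 1) := by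
      refine ⟨m, ?_⟩
      have h1 : m < ℓ ^ m := Nat.lt_pow_self hℓ.out.one_lt
      have h2 : ℓ ^ m ≤ ℓ ^ (m + 1) := Nat.pow_le_pow_right hℓ.out.pos (by omega)
      nlinarith
    classical
    have hi := Nat.find_spec hex
    -- The number found is the largest `i` with e ℓ^i ≤ m, and the part split off is e ℓ^i.
    have hmin : eNum F ℓ * ℓ ^ Nat.find hex ≤ m := by
      rcases Nat.eq_zero_or_pos (Nat.find hex) with h0 | h0
      · rw [h0, pow_zero, mul_one]
        omega
      · have := Nat.find_min hex (Nat.sub_one_lt h0.ne')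
        rw [Nat.sub_add_cancel h0] at this
        omega
    have hne := h.2 (Nat.find hex)
    have hpos : eNum F ℓ * ℓ ^ Nat.find hex ≠ 0 :=
      mul_ne_zero (by omega) (pow_ne_zero _ hℓ.out.ne_zero)
    have hsum : m = (m - eNum F ℓ * ℓ ^ Nat.find hex) + eNum F ℓ * ℓ ^ Nat.find hex := by omega
    refine ⟨_, _, ?_, hpos, hsum, ?_⟩
    · omega
    · conv_lhs => rw [hsum]
      exact glVal_add_eNum hℓF _ (by omega)

end Valuations

/-! ### Orders of block upper triangular groups -/

section BlockCard

lemma padicValNat_prod_of_ne_zero {ℓ : ℕ} [Fact ℓ.Prime] {ι : Type*} {s : Finset ι} {f : ι → ℕ}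
    (h : ∀ i ∈ s, f i ≠ 0) : padicValNat ℓ (∏ i ∈ s, f i) = ∑ i ∈ s, padicValNat ℓ (f i) := by
  classical
  induction s using Finset.induction_on with
  | empty => simp
  | insert i s hi ih =>
    rw [Finset.prod_insert hi, Finset.sum_insert hi, padicValNat.mul (h i (by simp))
      (Finset.prod_ne_zero_iff.2 fun j hj => h j (by simp [hj])),
      ih fun j hj => h j (by simp [hj])]

variable {F : Type*} [Field F] {n : ℕ} {α : Type*} [LinearOrder α]

lemma toSquareBlock_det_ne_zero [Fintype α] {blk : Fin n → α} {g : GLn F n}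
    (hg : g ∈ blockUpper F blk) (k : α) :
    ((g : Matrix (Fin n) (Fin n) F).toSquareBlock blk k).det ≠ 0 := by
  have h1 : (g : Matrix (Fin n) (Fin n) F).det ≠ 0 := g.det_ne_zero
  rw [Matrix.BlockTriangular.det_fintype hg] at h1
  exact Finset.prod_ne_zero_iff.1 h1 k (Finset.mem_univ k)

/-- The diagonal blocks and the entries above them of a block upper triangular matrix. -/
def blockEntries [Fintype α] (blk : Fin n → α) (g : blockUpper F blk) :
    (∀ k, Matrix.GeneralLinearGroup {i // blk i = k} F) ×
      ({ij : Fin n × Fin n // blk ij.1 < blk ij.2} → F) :=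
  (fun k => Matrix.GeneralLinearGroup.mkOfDetNeZero _ (toSquareBlock_det_ne_zero g.2 k),
    fun ij => (g : GLn F n).val ij.1.1 ij.1.2)

lemma blockEntries_bijective [Fintype α] (blk : Fin n → α) :
    Function.Bijective (blockEntries (F := F) blk) := by
  constructor
  · intro g g' h
    ext i j
    rcases lt_trichotomy (blk i) (blk j) with hij | hij | hij
    · exact congrFun (congrArg Prod.snd h) ⟨(i, j), hij⟩
    · have h1 := congrFun (congrArg Prod.fst h) (blk j)
      exact congrArg (fun D : Matrix.GeneralLinearGroup {i // blk i = blk j} F =>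
        D.val ⟨i, hij⟩ ⟨j, rfl⟩) h1
    · exact (g.2 hij).trans (g'.2 hij).symm
  · rintro ⟨D, E⟩
    let M : Matrix (Fin n) (Fin n) F := fun i j =>
      if h : blk i = blk j then (D (blk j)).val ⟨i, h⟩ ⟨j, rfl⟩
      else if h : blk i < blk j then E ⟨(i, j), h⟩ else 0
    have hM : M.BlockTriangular blk := fun i j hij => by
      simp only [M]
      rw [dif_neg hij.ne', dif_neg hij.not_gt]
    have hD : ∀ k, M.toSquareBlock blk k = (D k).val := by
      intro k
      ext ⟨i, hi⟩ ⟨j, hj⟩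
      subst hj
      exact dif_pos hi
    have hdet : M.det ≠ 0 := by
      rw [Matrix.BlockTriangular.det_fintype hM]
      refine Finset.prod_ne_zero_iff.2 fun k _ => ?_
      rw [hD]
      exact (D k).det_ne_zero
    refine ⟨⟨Matrix.GeneralLinearGroup.mkOfDetNeZero M hdet, hM⟩, Prod.ext ?_ ?_⟩
    · ext k : 1
      exact Units.ext (hD k)
    · ext ⟨⟨i, j⟩, hij⟩
      exact (dif_neg (show blk i ≠ blk j from hij.ne)).trans (dif_pos hij)

lemma card_GL_reindex {ι : Type*} [Fintype ι] [DecidableEq ι] {m : ℕ}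
    (e : ι ≃ Fin m) :
    Nat.card (Matrix.GeneralLinearGroup ι F) = Nat.card (Matrix.GeneralLinearGroup (Fin m) F) :=
  Nat.card_congr (Units.mapEquiv (Matrix.reindexAlgEquiv F F e).toMulEquiv).toEquiv

variable [Fintype F]

lemma card_blockUpper [Fintype α] (blk : Fin n → α) : Nat.card (blockUpper F blk) =
    (∏ k, Nat.card (Matrix.GeneralLinearGroup {i // blk i = k} F)) *
      Fintype.card F ^ Nat.card {ij : Fin n × Fin n // blk ij.1 < blk ij.2} := by
  rw [Nat.card_congr (Equiv.ofBijective _ (blockEntries_bijective blk)), Nat.card_prod,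
    Nat.card_pi, Nat.card_fun, Nat.card_eq_fintype_card (α := F)]

variable {ℓ : ℕ} [hℓ : Fact ℓ.Prime]

lemma padicValNat_card_GL (hℓF : ¬ ℓ ∣ Fintype.card F) (m : ℕ) :
    padicValNat ℓ (Nat.card (Matrix.GeneralLinearGroup (Fin m) F)) = glVal F ℓ m := by
  have hq : 1 < Fintype.card F := Fintype.one_lt_card
  have h1 : ∀ i : Fin m, Fintype.card F ^ m - Fintype.card F ^ (i : ℕ) =
      Fintype.card F ^ (i : ℕ) * (Fintype.card F ^ (m - 1 - i + 1) - 1) := by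
    intro i
    rw [Nat.mul_sub_one, ← pow_add]
    congr 2
    omega
  have h2 : ∀ k, Fintype.card F ^ (k + 1) - 1 ≠ 0 := fun k => by
    have := Nat.one_lt_pow (show k + 1 ≠ 0 by omega) hq
    omega
  rw [Matrix.card_GL_field, padicValNat_prod_of_ne_zero fun i _ => by
    rw [h1]; exact mul_ne_zero (pow_pos (by omega) _).ne' (h2 _)]
  rw [glVal, ← Finset.sum_range_reflect, ← Fin.sum_univ_eq_sum_range
    (fun j => padicValNat ℓ (Fintype.card F ^ (m - 1 - j + 1) - 1))]
  refine Finset.sum_congr rfl fun i _ => ?_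
  rw [h1, padicValNat.mul (pow_pos (by omega) _).ne' (h2 _), padicValNat.eq_zero_of_not_dvd
    fun h => hℓF (hℓ.out.dvd_of_dvd_pow h), zero_add]

/-- The exponent of `ℓ` in the order of a standard parabolic subgroup. -/
lemma padicValNat_card_ofComposition (hℓF : ¬ ℓ ∣ Fintype.card F) (a : Composition n) :
    padicValNat ℓ (Nat.card (ofComposition (F := F) a)) = (a.blocks.map (glVal F ℓ)).sum := by
  have hfib : ∀ k : Fin a.length, {i // a.index i = k} ≃ Fin (a.blocksFun k) := fun k =>
    { toFun := fun i => Fin.cast (by rw [i.2]) (a.invEmbedding i)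
      invFun := fun j => ⟨a.embedding k j, a.index_embedding k j⟩
      left_inv := by
        rintro ⟨i, rfl⟩
        exact Subtype.ext (a.embedding_comp_inv i)
      right_inv := fun j => by
        ext
        simp }
  have hq : 1 < Fintype.card F := Fintype.one_lt_card
  rw [ofComposition, card_blockUpper, padicValNat.mul
    (Finset.prod_ne_zero_iff.2 fun _ _ => Nat.card_pos.ne') (pow_pos (by omega) _).ne',
    padicValNat.eq_zero_of_not_dvd (n := Fintype.card F ^ _)
    fun h => hℓF (hℓ.out.dvd_of_dvd_pow h), add_zero, padicValNat_prod_of_ne_zero fun _ _ => Nat.card_pos.ne']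
  rw [Finset.sum_congr rfl fun k _ => by
    rw [card_GL_reindex (hfib k), padicValNat_card_GL hℓF]]
  rw [← a.ofFn_blocksFun, List.map_ofFn, List.sum_ofFn]
  rfl

lemma padicValNat_index (P : Subgroup (GLn F n)) : padicValNat ℓ (Nat.card P) +
    padicValNat ℓ P.index = padicValNat ℓ (Nat.card (GLn F n)) := by
  rw [← P.card_mul_index, padicValNat.mul Nat.card_pos.ne' Subgroup.index_ne_zero_of_finite]

end BlockCard

/-! ### Exchanging, splitting and sorting blocks by transports -/

section Cuts

/-- The partial sums of a list of natural numbers. -/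
def cuts (l : List ℕ) : Set ℕ := {s | ∃ k, (l.take k).sum = s}

lemma zero_mem_cuts (l : List ℕ) : 0 ∈ cuts l := ⟨0, by simp⟩

lemma sum_mem_cuts (l : List ℕ) : l.sum ∈ cuts l := ⟨l.length, by simp⟩

lemma le_sum_of_mem_cuts {l : List ℕ} {s : ℕ} (h : s ∈ cuts l) : s ≤ l.sum := by
  obtain ⟨k, rfl⟩ := h
  conv_rhs => rw [← List.take_append_drop k l, List.sum_append]
  exact Nat.le_add_right _ _

lemma mem_cuts_append {l l' : List ℕ} {s : ℕ} :
    s ∈ cuts (l ++ l') ↔ s ∈ cuts l ∨ ∃ t ∈ cuts l', s = l.sum + t := by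
  constructor
  · rintro ⟨k, rfl⟩
    rcases le_total k l.length with h | h
    · exact Or.inl ⟨k, by rw [List.take_append_of_le_length h]⟩
    · refine Or.inr ⟨_, ⟨k - l.length, rfl⟩, ?_⟩
      rw [List.take_append, List.take_of_length_le h, List.sum_append]
  · rintro (⟨k, rfl⟩ | ⟨_, ⟨k, rfl⟩, rfl⟩)
    · refine ⟨min k l.length, ?_⟩
      rw [List.take_append_of_le_length (min_le_right _ _)]
      congr 1
      simp
    · refine ⟨l.length + k, ?_⟩
      rw [List.take_append, List.take_of_length_le (by omega), List.sum_append]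
      simp

lemma mem_cuts_singleton {x s : ℕ} : s ∈ cuts [x] ↔ s = 0 ∨ s = x := by
  constructor
  · rintro ⟨_ | k, rfl⟩ <;> simp
  · rintro (rfl | rfl)
    · exact zero_mem_cuts _
    · exact ⟨1, by simp⟩

lemma mem_cuts_append_pair {l l' : List ℕ} {x y s : ℕ} : s ∈ cuts (l ++ [x, y] ++ l') ↔
    s ∈ cuts l ∨ s = l.sum + x ∨ ∃ t ∈ cuts l', s = l.sum + x + y + t := by
  have h0 : l ++ [x, y] ++ l' = l ++ [x] ++ [y] ++ l' := by simp
  rw [h0, mem_cuts_append, mem_cuts_append, mem_cuts_append]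
  simp only [mem_cuts_singleton, List.sum_append, List.sum_singleton]
  constructor
  · rintro (((h | ⟨t, rfl | rfl, rfl⟩) | ⟨t, rfl | rfl, rfl⟩) | ⟨t, ht, rfl⟩)
    · exact Or.inl h
    · exact Or.inl (sum_mem_cuts l)
    · exact Or.inr (Or.inl rfl)
    · exact Or.inr (Or.inl rfl)
    · exact Or.inr (Or.inr ⟨0, zero_mem_cuts _, rfl⟩)
    · exact Or.inr (Or.inr ⟨t, ht, rfl⟩)
  · rintro (h | rfl | ⟨t, ht, rfl⟩)
    · exact Or.inl (Or.inl (Or.inl h))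
    · exact Or.inl (Or.inl (Or.inr ⟨x, Or.inr rfl, rfl⟩))
    · exact Or.inr ⟨t, ht, rfl⟩

lemma mem_cuts_append_singleton_append {l l' : List ℕ} {x s : ℕ} : s ∈ cuts (l ++ [x] ++ l') ↔
    s ∈ cuts l ∨ ∃ t ∈ cuts l', s = l.sum + x + t := by
  rw [mem_cuts_append, mem_cuts_append]
  simp only [mem_cuts_singleton, List.sum_append, List.sum_singleton]
  constructor
  · rintro ((h | ⟨t, rfl | rfl, rfl⟩) | ⟨t, ht, rfl⟩)
    · exact Or.inl h
    · exact Or.inl (sum_mem_cuts l)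
    · exact Or.inr ⟨0, zero_mem_cuts _, rfl⟩
    · exact Or.inr ⟨t, ht, rfl⟩
  · rintro (h | ⟨t, ht, rfl⟩)
    · exact Or.inl (Or.inl h)
    · exact Or.inr ⟨t, ht, rfl⟩

/-- The permutation interchanging two adjacent intervals, of lengths `y` and `x`. -/
def blockSwap {n s x y : ℕ} (hn : s + x + y ≤ n) : Equiv.Perm (Fin n) where
  toFun i := ⟨if (i : ℕ) < s then i else if (i : ℕ) < s + y then i + x
    else if (i : ℕ) < s + x + y then i - y else i, by have := i.2; split_ifs <;> omega⟩
  invFun i := ⟨if (i : ℕ) < s then i else if (i : ℕ) < s + x then i + y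
    else if (i : ℕ) < s + x + y then i - x else i, by have := i.2; split_ifs <;> omega⟩
  left_inv i := by ext; simp only; split_ifs <;> omega
  right_inv i := by ext; simp only; split_ifs <;> omega

/-- The indices `i` such that `i + 1` does not belong to `C`. -/
def noCut (n : ℕ) (C : Set ℕ) : Set (Fin n) := {i | (i : ℕ) + 1 ∉ C}

/-- The cut of `C` at `s + x` is permitted but not required, so the same permutation serves both for
exchanging two blocks and for splitting one. -/
lemma isTransport_blockSwap {n s x y : ℕ} (hn : s + x + y ≤ n) {C C' : Set ℕ}
    (hout : ∀ k, k ≤ s ∨ s + x + y ≤ k → (k ∈ C ↔ k ∈ C')) (hs : s ∈ C) (ht : s + x + y ∈ C)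
    (hC : ∀ k, s < k → k < s + x + y → k ∈ C → k = s + x)
    (hC' : ∀ k, s < k → k < s + x + y → (k ∈ C' ↔ k = s + y)) :
    IsTransport (noCut n C) (noCut n C') (blockSwap hn) := by
  have hval : ∀ i : Fin n, ((i : ℕ) < s ∧ (blockSwap hn i : ℕ) = i) ∨
      (s ≤ i ∧ (i : ℕ) < s + y ∧ (blockSwap hn i : ℕ) = i + x) ∨
      (s + y ≤ i ∧ (i : ℕ) < s + x + y ∧ (blockSwap hn i : ℕ) + y = i) ∨
      (s + x + y ≤ i ∧ (blockSwap hn i : ℕ) = i) := by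
    intro i
    have : (blockSwap hn i : ℕ) = if (i : ℕ) < s then (i : ℕ) else if (i : ℕ) < s + y then i + x
      else if (i : ℕ) < s + x + y then i - y else i := rfl
    split_ifs at this <;> omega
  have hs' : s ∈ C' := (hout s (Or.inl le_rfl)).1 hs
  have ht' : s + x + y ∈ C' := (hout _ (Or.inr le_rfl)).1 ht
  constructor
  · intro i j hij hi
    change (i : ℕ) + 1 ∉ C' at hi
    have h1 : (i : ℕ) + 1 ≠ s := fun h => hi (by rwa [h])
    have h2 : (i : ℕ) + 1 ≠ s + x + y := fun h => hi (by rwa [h])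
    have h3 : ¬ (s < (i : ℕ) + 1 ∧ (i : ℕ) + 1 < s + x + y ∧ (i : ℕ) + 1 = s + y) :=
      fun h => hi ((hC' _ h.1 h.2.1).2 h.2.2)
    have hvi := hval i
    have hvj := hval j
    refine ⟨by omega, fun hv => ?_⟩
    by_cases hin : s < (blockSwap hn i : ℕ) + 1 ∧ (blockSwap hn i : ℕ) + 1 < s + x + y
    · have := hC _ hin.1 hin.2 hv
      omega
    · have h4 : (blockSwap hn i : ℕ) = i := by omega
      rw [h4] at hv
      exact hi ((hout _ (by omega)).1 hv)
  · intro i j hij hi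
    change (blockSwap hn i : ℕ) + 1 ∉ C at hi
    have h1 : (blockSwap hn i : ℕ) + 1 ≠ s := fun h => hi (by rwa [h])
    have h2 : (blockSwap hn i : ℕ) + 1 ≠ s + x + y := fun h => hi (by rwa [h])
    have hvi := hval i
    have hvj := hval j
    rcases lt_or_ge j i with hlt | hge
    · exact Or.inr hlt
    · have hle := Fin.le_def.1 hge
      refine Or.inl ⟨by omega, fun hv => ?_⟩
      by_cases hin : s < (i : ℕ) + 1 ∧ (i : ℕ) + 1 < s + x + y
      · have := (hC' _ hin.1 hin.2).1 hv
        omega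
      · have h4 : (blockSwap hn i : ℕ) = i := by omega
        rw [h4] at hi
        exact hi ((hout _ (by omega)).2 hv)

/-- Transport, by a chain of permutations, between the sets of indices of lists of cuts. -/
def Reaches (n : ℕ) (l l' : List ℕ) : Prop :=
  Relation.ReflTransGen (fun J J' => ∃ h, IsTransport J J' h) (noCut n (cuts l)) (noCut n (cuts l'))

lemma reaches_swap {n x y : ℕ} {l l' : List ℕ} (hn : (l ++ [x, y] ++ l').sum ≤ n) :
    Reaches n (l ++ [x, y] ++ l') (l ++ [y, x] ++ l') := by
  have hn' : l.sum + x + y ≤ n := by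
    simp only [List.sum_append, List.sum_cons, List.sum_nil] at hn
    omega
  refine .single ⟨_, isTransport_blockSwap hn' (fun k hk => ?_) ?_ ?_ (fun k h1 h2 => ?_)
    fun k h1 h2 => ?_⟩
  · rw [mem_cuts_append_pair, mem_cuts_append_pair, add_right_comm l.sum y x]
    refine or_congr_right' fun hkl => ?_
    have h0 : k ≠ l.sum := fun h => hkl (h ▸ sum_mem_cuts l)
    have hz := zero_mem_cuts l'
    constructor
    · rintro (rfl | h)
      · exact Or.inr ⟨0, hz, by omega⟩
      · exact Or.inr h
    · rintro (rfl | h)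
      · exact Or.inr ⟨0, hz, by omega⟩
      · exact Or.inr h
  · exact mem_cuts_append_pair.2 (Or.inl (sum_mem_cuts l))
  · exact mem_cuts_append_pair.2 (Or.inr (Or.inr ⟨0, zero_mem_cuts _, rfl⟩))
  · rw [mem_cuts_append_pair]
    rintro (h | h | ⟨t, -, h⟩)
    · have := le_sum_of_mem_cuts h
      omega
    · exact h
    · omega
  · rw [mem_cuts_append_pair]
    constructor
    · rintro (h | h | ⟨t, -, h⟩)
      · have := le_sum_of_mem_cuts h
        omega
      · exact h
      · omega
    · exact fun h => Or.inr (Or.inl h)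

/-- The parts come out as `y, x` because `IsTransport` requires the pieces of a single block to
appear in reversed order. -/
lemma reaches_split {n x y : ℕ} {l l' : List ℕ} (hn : (l ++ [x + y] ++ l').sum ≤ n) :
    Reaches n (l ++ [x + y] ++ l') (l ++ [y, x] ++ l') := by
  have hn' : l.sum + x + y ≤ n := by
    simp only [List.sum_append, List.sum_cons, List.sum_nil] at hn
    omega
  refine .single ⟨_, isTransport_blockSwap hn' (fun k hk => ?_) ?_ ?_ (fun k h1 h2 => ?_)
    fun k h1 h2 => ?_⟩
  · rw [mem_cuts_append_singleton_append, mem_cuts_append_pair, add_right_comm l.sum y x,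
      ← add_assoc]
    refine or_congr_right' fun hkl => ?_
    have h0 : k ≠ l.sum := fun h => hkl (h ▸ sum_mem_cuts l)
    refine ⟨Or.inr, ?_⟩
    rintro (rfl | h)
    · exact ⟨0, zero_mem_cuts _, by omega⟩
    · exact h
  · exact mem_cuts_append_singleton_append.2 (Or.inl (sum_mem_cuts l))
  · exact mem_cuts_append_singleton_append.2 (Or.inr ⟨0, zero_mem_cuts _, by omega⟩)
  · rw [mem_cuts_append_singleton_append]
    rintro (h | ⟨t, -, h⟩)
    · have := le_sum_of_mem_cuts h
      omega
    · omega
  · rw [mem_cuts_append_pair]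
    constructor
    · rintro (h | h | ⟨t, -, h⟩)
      · have := le_sum_of_mem_cuts h
        omega
      · exact h
      · omega
    · exact fun h => Or.inr (Or.inl h)

lemma reaches_of_perm {n : ℕ} {l l' : List ℕ} (h : l.Perm l') (l₀ : List ℕ)
    (hn : (l₀ ++ l).sum ≤ n) : Reaches n (l₀ ++ l) (l₀ ++ l') := by
  induction h generalizing l₀ with
  | nil => exact .refl
  | cons x _ ih =>
    have := ih (l₀ ++ [x]) (by simpa [add_assoc] using hn)
    simpa using this
  | swap x y l =>
    have := reaches_swap (n := n) (x := y) (y := x) (l := l₀) (l' := l) (by simpa using hn)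
    simpa using this
  | trans h1 _ ih1 ih2 =>
    refine (ih1 l₀ hn).trans (ih2 l₀ ?_)
    rwa [List.sum_append, ← h1.sum_eq, ← List.sum_append]

variable {F : Type*} [Field F] [Fintype F] {n ℓ : ℕ} [hℓ : Fact ℓ.Prime]

/-- Strong induction on the block size: a block of an inadmissible size is split without changing
the ℓ-part of the order, and both pieces are treated in turn. -/
lemma exists_reaches_singleton (hℓF : ¬ ℓ ∣ Fintype.card F) {m : ℕ} (hm : m ≠ 0)
    (l₁ l₂ : List ℕ) (hn : (l₁ ++ [m] ++ l₂).sum ≤ n) : ∃ l' : List ℕ,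
      Reaches n (l₁ ++ [m] ++ l₂) (l₁ ++ l' ++ l₂) ∧ l'.sum = m ∧
      (l'.map (glVal F ℓ)).sum = glVal F ℓ m ∧
      ∀ s ∈ l', s = 1 ∨ ∃ i : ℕ, s = eNum F ℓ * ℓ ^ i := by
  induction m using Nat.strong_induction_on generalizing l₁ l₂ with
  | _ m ih =>
  by_cases hgood : m = 1 ∨ ∃ i : ℕ, m = eNum F ℓ * ℓ ^ i
  · exact ⟨[m], .refl, by simp, by simp, by simpa using hgood⟩
  · obtain ⟨x, y, hx, hy, rfl, hg⟩ := exists_glVal_split hℓF hm hgood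
    simp only [List.sum_append, List.sum_singleton] at hn
    obtain ⟨ly, h1, h2, h3, h4⟩ := ih y (by omega) hy l₁ ([x] ++ l₂)
      (by simp only [List.sum_append, List.sum_singleton]; omega)
    obtain ⟨lx, h5, h6, h7, h8⟩ := ih x (by omega) hx (l₁ ++ ly) l₂
      (by simp only [List.sum_append, List.sum_singleton]; omega)
    refine ⟨ly ++ lx, ?_, ?_, ?_, ?_⟩
    · have h0 := reaches_split (n := n) (x := x) (y := y) (l := l₁) (l' := l₂)
        (by simp only [List.sum_append, List.sum_singleton]; omega)
      simp only [List.append_assoc, List.cons_append, List.nil_append] at h0 h1 h5 ⊢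
      exact (h0.trans h1).trans h5
    · rw [List.sum_append, h2, h6, add_comm]
    · rw [List.map_append, List.sum_append, h3, h7, hg, add_comm]
    · intro s hs
      exact (List.mem_append.1 hs).elim (h4 s) (h8 s)

lemma exists_reaches (hℓF : ¬ ℓ ∣ Fintype.card F) {l : List ℕ} (hl : ∀ m ∈ l, m ≠ 0)
    (l₁ : List ℕ) (hn : (l₁ ++ l).sum ≤ n) : ∃ l' : List ℕ,
      Reaches n (l₁ ++ l) (l₁ ++ l') ∧ l'.sum = l.sum ∧
      (l'.map (glVal F ℓ)).sum = (l.map (glVal F ℓ)).sum ∧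
      ∀ s ∈ l', s = 1 ∨ ∃ i : ℕ, s = eNum F ℓ * ℓ ^ i := by
  induction l generalizing l₁ with
  | nil => exact ⟨[], .refl, rfl, rfl, by simp⟩
  | cons m l ih =>
    obtain ⟨lm, h1, h2, h3, h4⟩ := exists_reaches_singleton hℓF (hl m (by simp)) l₁ l
      (by simpa using hn)
    simp only [List.sum_append, List.sum_cons] at hn
    obtain ⟨l', h5, h6, h7, h8⟩ := ih (fun s hs => hl s (by simp [hs])) (l₁ ++ lm)
      (by simp only [List.sum_append]; omega)
    refine ⟨lm ++ l', ?_, ?_, ?_, ?_⟩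
    · simp only [List.append_assoc, List.cons_append, List.nil_append] at h1 h5 ⊢
      exact h1.trans h5
    · rw [List.sum_append, h2, h6, List.sum_cons]
    · rw [List.map_append, List.sum_append, h3, h7, List.map_cons, List.sum_cons]
    · intro s hs
      exact (List.mem_append.1 hs).elim (h4 s) (h8 s)

end Cuts

/-! ### Compositions and their sets of cuts -/

section Composition

lemma composition_index_mono {n : ℕ} (a : Composition n) : Monotone a.index := by
  intro i j hij
  by_contra! h
  have h1 := a.lt_sizeUpTo_index_succ j
  have h2 := a.monotone_sizeUpTo (show (a.index j : ℕ) + 1 ≤ a.index i from Fin.lt_def.1 h)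
  have h3 := a.sizeUpTo_index_le i
  have h4 := Fin.le_def.1 hij
  rw [Fin.val_succ] at h1
  omega

lemma index_eq_iff_notMem_cuts {n : ℕ} (a : Composition n) {i j : Fin n} (hij : (i : ℕ) + 1 = j) :
    a.index i = a.index j ↔ (i : ℕ) + 1 ∉ cuts a.blocks := by
  have h1 := a.lt_sizeUpTo_index_succ i
  have h2 := a.lt_sizeUpTo_index_succ j
  have h3 := a.sizeUpTo_index_le i
  have h4 := a.sizeUpTo_index_le j
  rw [Fin.val_succ] at h1 h2
  constructor
  · rintro h ⟨k, hk⟩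
    change a.sizeUpTo k = _ at hk
    rw [← h] at h2 h4
    rcases le_or_gt k (a.index i) with hle | hlt
    · have := a.monotone_sizeUpTo hle
      omega
    · have := a.monotone_sizeUpTo (show (a.index i : ℕ) + 1 ≤ k from hlt)
      omega
  · intro h
    by_contra hne
    have hlt : (a.index i : ℕ) < a.index j := Fin.lt_def.1 (lt_of_le_of_ne
      (composition_index_mono a (Fin.le_def.2 (by omega))) hne)
    have := a.monotone_sizeUpTo (show (a.index i : ℕ) + 1 ≤ a.index j from hlt)
    exact h ⟨a.index i + 1, by change a.sizeUpTo _ = _; omega⟩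

lemma parab_noCut_blocks {F : Type*} [Field F] {n : ℕ} (a : Composition n) :
    parab F (noCut n (cuts a.blocks)) = ofComposition a := by
  refine (parab_eq_iff (borel_le_blockUpper (composition_index_mono a))).2 fun i j hij => ?_
  rw [perm_swap_mem_blockUpper, index_eq_iff_notMem_cuts a hij]
  rfl

lemma exists_list_cuts (C : Set ℕ) (n : ℕ) : ∃ l : List ℕ, (∀ m ∈ l, m ≠ 0) ∧ l.sum = n ∧
    ∀ k, 0 < k → k < n → (k ∈ cuts l ↔ k ∈ C) := by
  induction n with
  | zero => exact ⟨[], by simp, rfl, fun k h1 h2 => by omega⟩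
  | succ n ih =>
    obtain ⟨l, h1, h2, h3⟩ := ih
    rcases l.eq_nil_or_concat' with rfl | ⟨l', m, rfl⟩
    · refine ⟨[n + 1], by simp, by simp, fun k h4 h5 => ?_⟩
      simp only [List.sum_nil] at h2
      omega
    · simp only [List.sum_append, List.sum_singleton] at h2
      have hm : m ≠ 0 := h1 m (by simp)
      have hl' : ∀ k, k ∈ cuts l' → k < n := fun k hk => by
        have := le_sum_of_mem_cuts hk
        omega
      by_cases hC : n ∈ C
      · refine ⟨l' ++ [m] ++ [1], ?_, ?_, fun k h4 h5 => ?_⟩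
        · intro x hx
          rcases List.mem_append.1 hx with hx | hx
          · exact h1 x hx
          · simp_all
        · simp only [List.sum_append, List.sum_singleton, h2]
        · rw [mem_cuts_append]
          simp only [mem_cuts_singleton, List.sum_append, List.sum_singleton, h2]
          rcases Nat.lt_succ_iff_lt_or_eq.1 h5 with h6 | rfl
          · rw [← h3 k h4 h6, or_iff_left]
            rintro ⟨t, -, rfl⟩
            omega
          · exact iff_of_true (Or.inr ⟨0, Or.inl rfl, rfl⟩) hC
      · refine ⟨l' ++ [m + 1], ?_, ?_, fun k h4 h5 => ?_⟩
        · intro x hx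
          rcases List.mem_append.1 hx with hx | hx
          · exact h1 x (by simp [hx])
          · simp_all
        · simp only [List.sum_append, List.sum_singleton]
          omega
        · rcases Nat.lt_succ_iff_lt_or_eq.1 h5 with h6 | rfl
          · rw [← h3 k h4 h6, mem_cuts_append, mem_cuts_append]
            simp only [mem_cuts_singleton]
            refine or_congr_right ⟨?_, ?_⟩
            · rintro ⟨t, rfl | rfl, rfl⟩
              · exact ⟨0, Or.inl rfl, rfl⟩
              · omega
            · rintro ⟨t, rfl | rfl, rfl⟩
              · exact ⟨0, Or.inl rfl, rfl⟩
              · omega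
          · refine iff_of_false (fun h => ?_) hC
            rw [mem_cuts_append] at h
            simp only [mem_cuts_singleton] at h
            rcases h with h | ⟨t, rfl | rfl, h⟩
            · exact absurd (hl' _ h) (lt_irrefl _)
            · omega
            · omega

end Composition

/-! ### Every standard parabolic subgroup reaches a member of 𝒫^* -/

section Reduction

variable {F : Type*} [Field F] [Fintype F] {n ℓ : ℕ}

/-- Every standard parabolic subgroup can be transported to a member of `𝒫^*` with the same
exponent of `ℓ` in the index. -/
lemma exists_mem_PStarAt (hℓ : ℓ.Prime) (hℓF : ¬ ℓ ∣ Fintype.card F)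
    (J : Set (Fin n)) : ∃ J' : Set (Fin n),
      Relation.ReflTransGen (fun J J' => ∃ h, IsTransport J J' h) J J' ∧
      parab F J' ∈ PStarAt F n ℓ (padicValNat ℓ (parab F J).index) := by
  have := Fact.mk hℓ
  obtain ⟨l, hpos, hsum, hcuts⟩ := exists_list_cuts
    {k | ∃ i : Fin n, (i : ℕ) + 1 = k ∧ i ∉ J} n
  have hJ : ∀ i j : Fin n, (i : ℕ) + 1 = j → (i ∈ noCut n (cuts l) ↔ i ∈ J) := by
    intro i j hij
    change (i : ℕ) + 1 ∉ _ ↔ _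
    rw [hcuts _ (by omega) (by omega), not_iff_comm]
    constructor
    · exact fun h => ⟨i, rfl, h⟩
    · rintro ⟨k, hk, hkJ⟩
      rwa [← show k = i from Fin.ext (by omega)]
  obtain ⟨l', h1, h2, h3, h4⟩ := exists_reaches (F := F) (n := n) hℓF hpos [] (by simp [hsum])
  set l'' := l'.insertionSort (· ≤ ·) with hl''
  have hperm : l''.Perm l' := List.perm_insertionSort _ _
  have hgood : ∀ s ∈ l'', s = 1 ∨ ∃ i : ℕ, s = eNum F ℓ * ℓ ^ i := fun s hs =>
    h4 s (hperm.mem_iff.1 hs)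
  have h5 := reaches_of_perm (n := n) hperm.symm [] (by simp [h2, hsum])
  let a : Composition n := ⟨l, fun {i} hi => Nat.pos_of_ne_zero (hpos i hi), hsum⟩
  let a'' : Composition n := ⟨l'', fun {i} hi => by
    rcases hgood i hi with rfl | ⟨k, rfl⟩
    · exact one_pos
    · have := (eNum_spec (F := F) hℓF).1
      exact Nat.mul_pos (by omega) (pow_pos hℓ.pos _), by rw [hperm.sum_eq, h2, hsum]⟩
  have hparab : parab F J = ofComposition a := by
    rw [← parab_noCut_blocks, parab_eq_iff (borel_le_parab _)]
    intro i j hij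
    rw [perm_swap_mem_parab hij]
    exact (hJ i j hij).symm
  refine ⟨noCut n (cuts l''), ?_, ⟨a'', List.pairwise_insertionSort _ _, hgood,
    parab_noCut_blocks a''⟩, ?_⟩
  -- The identity permutation is a transport from `J` to the set attached to its list of blocks. The
  -- two sets can differ only in the last index, which corresponds to no reflection.
  · refine .head ⟨1, ?_⟩ (h1.trans h5)
    constructor
    · exact fun i j hij hi => ⟨hij, (hJ i j hij).1 hi⟩
    · exact fun i j hij hi => Or.inl ⟨hij, (hJ i j hij).2 hi⟩
  · have e1 := padicValNat_index (ℓ := ℓ) (ofComposition (F := F) a)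
    have e2 := padicValNat_index (ℓ := ℓ) (ofComposition (F := F) a'')
    rw [padicValNat_card_ofComposition hℓF] at e1 e2
    have e3 : (a''.blocks.map (glVal F ℓ)).sum = (a.blocks.map (glVal F ℓ)).sum :=
      (hperm.map _).sum_eq.trans h3
    rw [show parab F (noCut n (cuts l'')) = ofComposition a'' from parab_noCut_blocks a'', hparab]
    omega

end Reduction

/-! ### The submodules N(P) for P in 𝒫^*(c) -/

section Final

variable {F : Type*} [Field F] {n ℓ : ℕ}

lemma isStandardParabolic_of_mem_PStarAt {c : ℕ} {P : Subgroup (GLn F n)}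
    (hP : P ∈ PStarAt F n ℓ c) : IsStandardParabolic F n P := by
  obtain ⟨⟨a, -, -, rfl⟩, -⟩ := hP
  exact borel_le_blockUpper (composition_index_mono a)

/-- The indices of the vectors in `M(c)` attached to the parabolic subgroups in `𝒫^*(c)`. -/
def starIndices (F : Type*) [Field F] (n ℓ c : ℕ) :
    Set {b : Fin n → F // padicValNat ℓ (parab F (Function.support b)).index = c} :=
  {b | parab F (Function.support (b : Fin n → F)) ∈ PStarAt F n ℓ c}

/-- The index in `M(c)` of a member of `𝒫^*(c)`. -/
def starIndex {c : ℕ} {P : Subgroup (GLn F n)} (hP : P ∈ PStarAt F n ℓ c) :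
    {b : Fin n → F // padicValNat ℓ (parab F (Function.support b)).index = c} :=
  ⟨indic F (refls P), by
    rw [parab_support_indic_refls (isStandardParabolic_of_mem_PStarAt hP)]
    exact hP.2⟩

lemma parab_support_starIndex {c : ℕ} {P : Subgroup (GLn F n)} (hP : P ∈ PStarAt F n ℓ c) :
    parab F (Function.support (starIndex hP : Fin n → F)) = P :=
  parab_support_indic_refls (isStandardParabolic_of_mem_PStarAt hP)

lemma starIndex_mem {c : ℕ} {P : Subgroup (GLn F n)} (hP : P ∈ PStarAt F n ℓ c) :
    starIndex hP ∈ starIndices F n ℓ c := by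
  change parab F (Function.support (starIndex hP : Fin n → F)) ∈ PStarAt F n ℓ c
  rwa [parab_support_starIndex]

lemma isPValue_iff (c : ℕ) : IsPValue F n ℓ c ↔
    Nonempty {b : Fin n → F // padicValNat ℓ (parab F (Function.support b)).index = c} := by
  constructor
  · rintro ⟨P, hP, rfl⟩
    exact ⟨⟨indic F (refls P), by rw [parab_support_indic_refls hP]⟩⟩
  · rintro ⟨b, rfl⟩
    exact ⟨_, borel_le_parab _, rfl⟩

lemma exists_charElt_eq_of_reflTransGen [Fintype F] {R : Type*} [CommRing R]
    (hq : IsUnit (Fintype.card F : R)) (ψ : AddChar F R)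
    {J J' : Set (Fin n)}
    (h : Relation.ReflTransGen (fun J J' => ∃ h, IsTransport J J' h) J J') :
    ∃ a : R[GLn F n], charElt (lamOf ψ (indic F J')) = a • charElt (lamOf ψ (indic F J)) := by
  induction h with
  | refl => exact ⟨1, (one_smul _ _).symm⟩
  | tail _ h ih =>
    obtain ⟨h, H⟩ := h
    obtain ⟨a, ha⟩ := ih
    obtain ⟨a', ha'⟩ := H.exists_charElt_eq hq ψ
    exact ⟨a' * a, by rw [ha', ha, mul_smul]⟩

variable [Fintype F] {R : Type*} [CommRing R] [IsDomain R] [CharZero R] {ψ : AddChar F R}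

lemma parabolicFactor_eq_span_starIndex (hψ : ψ ≠ 1) {c : ℕ} {P : Subgroup (GLn F n)}
    (hP : P ∈ PStarAt F n ℓ c) :
    parabolicFactor R ℓ c P = Submodule.span _ {factorVec hψ c (starIndex hP)} := by
  rw [← parabolicFactor_eq, parab_support_starIndex]

lemma image_parabolicFactor (hψ : ψ ≠ 1) (c : ℕ) :
    parabolicFactor R ℓ c '' PStarAt F n ℓ c =
      (fun b => Submodule.span _ {factorVec hψ c b}) '' starIndices F n ℓ c := by
  ext X
  constructor
  · rintro ⟨P, hP, rfl⟩
    exact ⟨starIndex hP, starIndex_mem hP, (parabolicFactor_eq_span_starIndex hψ hP).symm⟩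
  · rintro ⟨b, hb, rfl⟩
    exact ⟨_, hb, parabolicFactor_eq hψ c b⟩

/-- The hypothesis on `T` in the eigensystem lemmas: a transport into 𝒫^* keeps the index valuation
and stays in the submodule generated by the original vector. -/
lemma exists_mem_starIndices (hℓ : ℓ.Prime) (hℓF : ¬ ℓ ∣ Fintype.card F)
    (hq : IsUnit (Fintype.card F : R)) (hψ : ψ ≠ 1) (c : ℕ)
    (b : {b : Fin n → F // padicValNat ℓ (parab F (Function.support b)).index = c}) :
    ∃ b' ∈ starIndices F n ℓ c,
      factorVec (R := R) hψ c b' ∈ Submodule.span (resField R ℓ)[GLn F n] {factorVec hψ c b} := by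
  obtain ⟨J', h1, h2⟩ := exists_mem_PStarAt (F := F) hℓ hℓF (Function.support (b : Fin n → F))
  rw [b.2] at h2
  obtain ⟨a, ha⟩ := exists_charElt_eq_of_reflTransGen hq ψ h1
  refine ⟨⟨indic F J', ?_⟩, ?_, ?_⟩
  · rw [support_indic]
    exact h2.2
  · change parab F (Function.support (indic F J')) ∈ PStarAt F n ℓ c
    rwa [support_indic]
  · refine subquotient_mk_mem_span_iff.2 (Submodule.mem_sup_left ?_)
    have h3 : Submodule.span (resField R ℓ)[GLn F n]
        {charVec ℓ (lamOf ψ (indic F (Function.support (b : Fin n → F))))} =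
        Submodule.span _ {charVec ℓ (lamOf ψ b)} :=
      span_charVec_eq_of_support ψ fun i _ _ => indic_ne_zero_iff
    rw [← h3, mem_span_singleton_reduction]
    exact ⟨a, by rw [charVec, charVec, ha, map_smul]⟩

end Final

end SteinbergGL

end

/-! ### The main theorem -/

open SteinbergGL
theorem mainTheorem1 {F R : Type*} [Field F] [Fintype F] [CommRing R] [IsDomain R]
    [IsPrincipalIdealRing R] [IsLocalRing R] [CharZero R]
    (n p ℓ : ℕ) (hn : 2 ≤ n) [CharP F p] (hp : p.Prime) (hℓ : ℓ.Prime) (hℓp : ℓ ≠ p)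
    (hmax : IsLocalRing.maximalIdeal R = Ideal.span {(ℓ : R)})
    (ζ : R) (hζ : IsPrimitiveRoot ζ p) :
    (∀ P : Subgroup (GLn F n), IsStandardParabolic F n P →
      (∃ lam : unitri F n →* Rˣ, parabolicOf lam = P) ∧
      parabolicSubmodule R ℓ P ≤ reductionFilt R F n ℓ (padicValNat ℓ P.index) ∧
      ∀ lam : unitri F n →* Rˣ, parabolicOf lam = P →
        parabolicSubmodule R ℓ P = Submodule.span _ {charVec ℓ lam}) ∧
    (∀ c : ℕ, IsPValue F n ℓ c →
      IsDirectSumOf (parabolicFactor R ℓ c '' PStarAt F n ℓ c) ∧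
      (∀ P ∈ PStarAt F n ℓ c, IsSimpleModule (resField R ℓ)[GLn F n] (parabolicFactor R ℓ c P)) ∧
      (∀ P ∈ PStarAt F n ℓ c, ∀ Q ∈ PStarAt F n ℓ c,
        parabolicFactor R ℓ c P ≠ parabolicFactor R ℓ c Q →
        IsEmpty (parabolicFactor R ℓ c P ≃ₗ[(resField R ℓ)[GLn F n]] parabolicFactor R ℓ c Q))) ∧
    (∀ c : ℕ, IsSimpleModule (resField R ℓ)[GLn F n] (factor R F n ℓ c) ↔
      IsPValue F n ℓ c ∧ ∀ P ∈ PStarAt F n ℓ c, ∀ Q ∈ PStarAt F n ℓ c,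
        parabolicFactor R ℓ c P = parabolicFactor R ℓ c Q) ∧
    (∀ c : ℕ, (PStarAt F n ℓ c).ncard = 1 →
      IsSimpleModule (resField R ℓ)[GLn F n] (factor R F n ℓ c)) ∧
    ((∀ c : ℕ, IsPValue F n ℓ c → (PStarAt F n ℓ c).ncard = 1) →
      ∃ s : CompositionSeries (Submodule (resField R ℓ)[GLn F n] (reduction R F n ℓ)),
        RelSeries.head s = ⊥ ∧ RelSeries.last s = ⊤ ∧
        Set.range s = Set.range (reductionFilt R F n ℓ)) := by
  classical
  have hℓF : ¬ ℓ ∣ Fintype.card F := by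
    obtain ⟨k, -, hk⟩ := FiniteField.card F p
    rw [hk]
    exact fun h => hℓp ((Nat.prime_dvd_prime_iff_eq hℓ hp).1 (hℓ.dvd_of_dvd_pow h))
  have hq : IsUnit (Fintype.card F : R) := isUnit_natCast hℓ hmax hℓF
  obtain ⟨ψ, hψ⟩ := exists_addChar_ne_one (F := F) hp hζ
  have H := isEigensystem_factorVec (n := n) hℓ hq hmax hψ
  have hT := exists_mem_starIndices (n := n) hℓ hℓF hq hψ
  have hsimple : ∀ c : ℕ, IsSimpleModule (resField R ℓ)[GLn F n] (factor R F n ℓ c) ↔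
      IsPValue F n ℓ c ∧ ∀ P ∈ PStarAt F n ℓ c, ∀ Q ∈ PStarAt F n ℓ c,
        parabolicFactor R ℓ c P = parabolicFactor R ℓ c Q := by
    intro c
    rw [(H c).isSimpleModule_iff _ (hT c), isPValue_iff]
    refine and_congr_right fun _ => ⟨fun h P hP Q hQ => ?_, fun h i hi j hj => ?_⟩
    · rw [parabolicFactor_eq_span_starIndex hψ hP, parabolicFactor_eq_span_starIndex hψ hQ]
      exact h _ (starIndex_mem hP) _ (starIndex_mem hQ)
    · rw [← parabolicFactor_eq, ← parabolicFactor_eq]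
      exact h _ hi _ hj
  have hone : ∀ c : ℕ, (PStarAt F n ℓ c).ncard = 1 →
      IsSimpleModule (resField R ℓ)[GLn F n] (factor R F n ℓ c) := by
    intro c hc
    obtain ⟨P, hP⟩ := Set.ncard_eq_one.1 hc
    have hPm : P ∈ PStarAt F n ℓ c := hP ▸ rfl
    refine (hsimple c).2 ⟨⟨P, isStandardParabolic_of_mem_PStarAt hPm, hPm.2⟩, ?_⟩
    rw [hP]
    rintro _ rfl _ rfl
    rfl
  refine ⟨fun P hP => ?_, fun c hc => ⟨?_, fun P hP => ?_, fun P hP Q hQ hne => ?_⟩, hsimple,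
    hone, fun hall => ?_⟩
  · have hlam := parabolicOf_lamOf_indic_refls (F := F) hψ hP
    refine ⟨⟨_, hlam⟩, ?_, fun lam h => by rw [← h, parabolicSubmodule_eq hψ]⟩
    conv_lhs => rw [← hlam, parabolicSubmodule_eq hψ]
    rw [Submodule.span_singleton_le_iff_mem]
    exact charVec_mem_reductionFilt hψ (by rw [parab_support_indic_refls hP])
  · rw [image_parabolicFactor hψ]
    exact (H c).isDirectSumOf _ (hT c)
  · rw [parabolicFactor_eq_span_starIndex hψ hP]
    exact (H c).isSimpleModule _
  · rw [parabolicFactor_eq_span_starIndex hψ hP, parabolicFactor_eq_span_starIndex hψ hQ] at hne ⊢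
    exact (H c).isEmpty_linearEquiv hne
  · have hstep : ∀ c, JordanHolderLattice.IsMaximal (reductionFilt R F n ℓ (c + 1))
        (reductionFilt R F n ℓ c) ∨ reductionFilt R F n ℓ (c + 1) = reductionFilt R F n ℓ c := by
      intro c
      by_cases hc : IsPValue F n ℓ c
      · exact Or.inl ((covBy_iff_quot_is_simple (reductionFilt_succ_le c)).2 (hone c (hall c hc)))
      · right
        -- A strict inclusion is witnessed by some F_λ, whose parabolic subgroup has index valuation
        -- exactly `c`. So the filtration is constant at `c` unless `c` is a 𝒫-value.
        by_contra hne
        obtain ⟨b, hb, hb'⟩ := exists_charVec_mem_notMem hq hmax hψ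
          (lt_of_le_of_ne (reductionFilt_succ_le c) hne)
        rw [charVec_mem_reductionFilt_iff hℓ hq hmax hψ] at hb hb'
        exact hc ((isPValue_iff c).2 ⟨⟨b, by omega⟩⟩)
    set C := padicValNat ℓ (Nat.card (GLn F n)) + 1
    have hC : reductionFilt R F n ℓ C = ⊥ := reductionFilt_eq_bot hℓ hq hmax hψ
    obtain ⟨s, h1, h2, h3⟩ := exists_compositionSeries_of_antitone _ hstep 0 C
    rw [zero_add, hC] at h1
    rw [reductionFilt_zero] at h2
    refine ⟨s, h1, h2, h3.trans (Set.Subset.antisymm (Set.image_subset_range _ _) ?_)⟩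
    rintro _ ⟨c, rfl⟩
    -- Beyond `C` all terms are zero, so finitely many steps already give the whole range.
    rcases le_total c C with hc | hc
    · exact ⟨c, ⟨c.zero_le, by omega⟩, rfl⟩
    · refine ⟨C, ⟨C.zero_le, by omega⟩, ?_⟩
      rw [hC, eq_comm, eq_bot_iff, ← hC]
      exact antitone_nat_of_succ_le reductionFilt_succ_le hc
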